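/- **SMI categories.** A *symmetric bimonoidal intermuting (SMI) category* is a category $\mathcal C$ with two symmetric monoidal structures $(\vee,\bot)$ and $(\wedge,\top)$, with associativity isomorphisms $\check b^{\to}_{A,B,C}:A\vee(B\vee C)\to(A\vee B)\vee C$, $\hat b^{\to}_{A,B,C}:A\wedge(B\wedge C)\to(A\wedge B)\wedge C$, symmetries $\check c,\hat c$, right identity isomorphisms $\check\delta^{\to}_A:A\vee\bot\to A$, $\hat\delta^{\to}_A:A\wedge\top\to A$ and left identity isomorphisms $\check\sigma^{\to}_A:\bot\vee A\to A$, $\hat\sigma^{\to}_A:\top\wedge A\to A$ (the superscript $^{\leftarrow}$ denotes inverses), together with a natural transformation $$c^k_{A,B,C,D}:(A\wedge B)\vee(C\wedge D)\to(A\vee C)\wedge(B\vee D),$$ isomorphisms $\hat w^{\leftarrow}_\bot:\bot\to\bot\wedge\bot$ and $\check w^{\to}_\top:\top\vee\top\to\top$ (with inverses $\hat w^{\to}_\bot$, $\check w^{\leftarrow}_\top$) and an arrow $\kappa:\bot\to\top$, such that 1. $(c^k_{A,B,D,E}\wedge 1)\circ c^k_{A\wedge B,C,D\wedge E,F}\circ(\hat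 b^{\to}\vee\hat b^{\to})=\hat b^{\to}\circ(1\wedge c^k_{B,C,E,F})\circ c^k_{A,B\wedge C,D,E\wedge F}$; 2. $c^k_{A\vee B,D\vee E,C,F}\circ(c^k_{A,D,B,E}\vee 1)\circ\check b^{\to}=(\check b^{\to}\wedge\check b^{\to})\circ c^k_{A,D,B\vee C,E\vee F}\circ(1\vee c^k_{B,E,C,F})$; 3. $c^k_{B,A,D,C}\circ(\hat c_{A,B}\vee\hat c_{C,D})=\hat c_{A\vee C,B\vee D}\circ c^k_{A,B,C,D}$; 4. $c^k_{B,D,A,C}\circ\check c_{A\wedge C,B\wedge D}=(\check c_{A,B}\wedge\check c_{C,D})\circ c^k_{A,C,B,D}$; 5. $c^k_{A,B,\bot,\bot}=(\check\delta^{\leftarrow}_A\wedge\check\delta^{\leftarrow}_B)\circ\check\delta^{\to}_{A\wedge B}\circ(1\vee\hat w^{\to}_\bot)$; 6. $c^k_{A,\top,B,\top}=(1\wedge\check w^{\leftarrow}_\top)\circ\hat\delta^{\leftarrow}_{A\vee B}\circ(\hat\delta^{\to}_A\vee\hat\delta^{\to}_B)$; 7. $\check b^{\to}_{\top,\top,\top}=(\check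 w^{\leftarrow}_\top\vee 1)\circ(1\vee\check w^{\to}_\top)$; 8. $\hat b^{\to}_{\bot,\bot,\bot}=(\hat w^{\leftarrow}_\bot\wedge 1)\circ(1\wedge\hat w^{\to}_\bot)$; 9. $1_\top\vee\kappa=\check w^{\leftarrow}_\top\circ\check\delta^{\to}_\top$; 10. $1_\bot\wedge\kappa=\hat\delta^{\leftarrow}_\bot\circ\hat w^{\to}_\bot$; 11. $c^k_{\top,\bot,\bot,\top}=(\check\delta^{\leftarrow}_\top\wedge\check\sigma^{\leftarrow}_\top)\circ\hat\delta^{\leftarrow}_\top\circ\kappa\circ\check\delta^{\to}_\bot\circ(\hat\sigma^{\to}_\bot\vee\hat\delta^{\to}_\bot)$; 12. $\check c_{\top,\top}=\check w^{\leftarrow}_\top\circ\check w^{\to}_\top$; 13. $\hat c_{\bot,\bot}=\hat w^{\leftarrow}_\bot\circ\hat w^{\to}_\bot$. **The construction.** Let $\Delta^+$ be the category of the ordinals $[k]=\{0,\dots,k\}$, $k\ge 0$, and order-preserving maps; the object $[k]$ is denoted by $k$. For a strict monoidal category $(\mathcal D,\otimes,I)$ and an arrow $f:k\to l$ of $(\Delta^+)^{op}$,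 given by an order-preserving $\varphi:[l]\to[k]$, let $\overline W\mathcal D(f):\mathcal D^k\to\mathcal D^l$ be the functor whose $j$-th coordinate at $(A_1,\dots,A_k)$ is the tensor product, in increasing order of $i$, of the $A_i$ with $\varphi(j-1)<i\le\varphi(j)$ (it is $I$ when there is no such $i$). Let $\mathcal C$ be an SMI category that is strict monoidal with respect to both $\vee,\bot$ and $\wedge,\top$, and let $n,m\ge 0$. The *$(n,m)$-reduced bar construction* $\overline W\mathcal C_{n,m}$ sends an object $(k_1,\dots,k_{n+m})$ of $((\Delta^+)^{op})^{n+m}$ to $\mathcal C^{k_1\cdots k_{n+m}}$, whose coordinates are indexed by tuples $(i_1,\dots,i_{n+m})$ with $1\le i_s\le k_s$. It sends an arrow $f=(f_1,\dots,f_{n+m})$, $f_i:k_i\to l_i$, to the composite $f^*$, in the order $i=1,2,\dots,n+m$ (the functor for $i=1$ is applied first), of the functors $[\overline W\mathcal D_i(f_i)]^{l_1\cdots l_{i-1}}$, where $\mathcal D_i=\mathcal C^{k_{i+1}\cdots k_{n+m}}$ with the componentwise monoidal structure given by $\vee,\bot$ if $i\le n$ and by $\wedge,\top$ if $i>n$.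 **Theorem.** For all $n,m\ge 0$ and every such $\mathcal C$, $\overline W\mathcal C_{n,m}$ is a lax functor from $((\Delta^+)^{op})^{n+m}$ to $\mathit{Cat}$: it preserves identity arrows, and for every composable pair $f:\vec k\to\vec l$, $g:\vec l\to\vec{\jmath}$ there is a natural transformation $\omega_{g,f}:g^*\circ f^*\to(g\circ f)^*$ such that $\omega_{1,f}$ and $\omega_{f,1}$ are identities and, for all composable $f,g,h$, $$\omega_{h\circ g,f}\circ\omega_{h,g}(f^*)=\omega_{h,g\circ f}\circ h^*(\omega_{g,f}).$$ Moreover, the $\omega_{g,f}$ may be chosen canonically: for each pair $f,g$ and each coordinate of $\mathcal C^{j_1\cdots j_{n+m}}$ there is an arrow term, built by composition, $\vee$ and $\wedge$ from identities, $\check b^{\to},\check b^{\leftarrow},\hat b^{\to},\hat b^{\leftarrow}$, $\check\delta^{\to},\check\delta^{\leftarrow},\hat\delta^{\to},\hat\delta^{\leftarrow}$, $\check\sigma^{\to},\check\sigma^{\leftarrow},\hat\sigma^{\to},\hat\sigma^{\leftarrow}$ (all of which are identities in $\mathcal C$), the symmetries $\check c,\hat c$, and $c^k$, $\check w^{\to}_\top$,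 $\hat w^{\leftarrow}_\bot$, $\kappa$, over letters $p_{i_1\dots i_{n+m}}$ $(1\le i_s\le k_s)$, which does not depend on $\mathcal C$ and such that for every $\vec A\in\mathcal C^{k_1\cdots k_{n+m}}$ that coordinate of $\omega_{g,f}(\vec A)$ is obtained from the term by substituting $A_{i_1\dots i_{n+m}}$ for $p_{i_1\dots i_{n+m}}$. If $n+m\le 1$, all $\omega_{g,f}$ can be taken to be identities, so that $\overline W\mathcal C_{n,m}$ is an ordinary functor. -/

import Mathlib

open CategoryTheory

universe v u

namespace SMI

/-! ### Symmetric bimonoidal intermuting categories -/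

/-- Two symmetric monoidal structures `(∨, ⊥)` and `(∧, ⊤)` on the same category. -/
class BiSymmetric (C : Type u) [Category.{v} C] where
  /-- the monoidal structure given by `∨` and `⊥` -/
  veeMon : MonoidalCategory C
  /-- its symmetry -/
  veeSymm : @SymmetricCategory C _ veeMon
  /-- the monoidal structure given by `∧` and `⊤` -/
  wedgeMon : MonoidalCategory C
  /-- its symmetry -/
  wedgeSymm : @SymmetricCategory C _ wedgeMon

section Operations

variable {C : Type u} [Category.{v} C] [BiSymmetric C]

/-- `A ∨ B` -/
abbrev vee (A B : C) : C := (BiSymmetric.veeMon (C := C)).tensorObj A B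

/-- `A ∧ B` -/
abbrev wedge (A B : C) : C := (BiSymmetric.wedgeMon (C := C)).tensorObj A B

/-- `f ∨ g` -/
abbrev veeHom {A B A' B' : C} (f : A ⟶ A') (g : B ⟶ B') : vee A B ⟶ vee A' B' :=
  (BiSymmetric.veeMon (C := C)).tensorHom f g

/-- `f ∧ g` -/
abbrev wedgeHom {A B A' B' : C} (f : A ⟶ A') (g : B ⟶ B') : wedge A B ⟶ wedge A' B' :=
  (BiSymmetric.wedgeMon (C := C)).tensorHom f g

/-- the unit `⊥` of `∨` -/
abbrev bot : C := (BiSymmetric.veeMon (C := C)).tensorUnit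

/-- the unit `⊤` of `∧` -/
abbrev top : C := (BiSymmetric.wedgeMon (C := C)).tensorUnit

scoped infixr:65 " ∨ₒ " => SMI.vee
scoped infixr:70 " ∧ₒ " => SMI.wedge
scoped infixr:65 " ∨ₕ " => SMI.veeHom
scoped infixr:70 " ∧ₕ " => SMI.wedgeHom

/-- associativity `A ∨ (B ∨ C) ≅ (A ∨ B) ∨ C` -/
abbrev veeB (A B D : C) : A ∨ₒ (B ∨ₒ D) ≅ (A ∨ₒ B) ∨ₒ D :=
  ((BiSymmetric.veeMon (C := C)).associator A B D).symm

/-- right identity `A ∨ ⊥ ≅ A` -/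
abbrev veeDelta (A : C) : A ∨ₒ bot ≅ A := (BiSymmetric.veeMon (C := C)).rightUnitor A

/-- left identity `⊥ ∨ A ≅ A` -/
abbrev veeSigma (A : C) : bot ∨ₒ A ≅ A := (BiSymmetric.veeMon (C := C)).leftUnitor A

/-- symmetry `A ∨ B ≅ B ∨ A` -/
abbrev veeC (A B : C) : A ∨ₒ B ≅ B ∨ₒ A :=
  letI := BiSymmetric.veeMon (C := C)
  letI := BiSymmetric.veeSymm (C := C)
  BraidedCategory.braiding A B

/-- associativity `A ∧ (B ∧ C) ≅ (A ∧ B) ∧ C` -/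
abbrev wedgeB (A B D : C) : A ∧ₒ (B ∧ₒ D) ≅ (A ∧ₒ B) ∧ₒ D :=
  ((BiSymmetric.wedgeMon (C := C)).associator A B D).symm

/-- right identity `A ∧ ⊤ ≅ A` -/
abbrev wedgeDelta (A : C) : A ∧ₒ top ≅ A := (BiSymmetric.wedgeMon (C := C)).rightUnitor A

/-- left identity `⊤ ∧ A ≅ A` -/
abbrev wedgeSigma (A : C) : top ∧ₒ A ≅ A := (BiSymmetric.wedgeMon (C := C)).leftUnitor A

/-- symmetry `A ∧ B ≅ B ∧ A` -/
abbrev wedgeC (A B : C) : A ∧ₒ B ≅ B ∧ₒ A :=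
  letI := BiSymmetric.wedgeMon (C := C)
  letI := BiSymmetric.wedgeSymm (C := C)
  BraidedCategory.braiding A B

end Operations

/-- A symmetric bimonoidal intermuting (SMI) category. -/
class SMICategory (C : Type u) [Category.{v} C] extends BiSymmetric C where
  /-- intermutation -/
  ck : ∀ A B D E : C, (A ∧ₒ B) ∨ₒ (D ∧ₒ E) ⟶ (A ∨ₒ D) ∧ₒ (B ∨ₒ E)
  /-- the isomorphism `⊥ ⟶ ⊥ ∧ ⊥` -/
  wBot : (bot : C) ≅ (bot : C) ∧ₒ bot
  /-- the isomorphism `⊤ ∨ ⊤ ⟶ ⊤` -/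
  wTop : (top : C) ∨ₒ top ≅ (top : C)
  /-- the arrow `⊥ ⟶ ⊤` -/
  kappa : (bot : C) ⟶ (top : C)
  ck_natural : ∀ {A A' B B' D D' E E' : C} (f : A ⟶ A') (g : B ⟶ B') (h : D ⟶ D') (i : E ⟶ E'),
    ((f ∧ₕ g) ∨ₕ (h ∧ₕ i)) ≫ ck A' B' D' E' = ck A B D E ≫ ((f ∨ₕ h) ∧ₕ (g ∨ₕ i))
  eq1 : ∀ A B D A' B' D' : C,
    ((wedgeB A B D).hom ∨ₕ (wedgeB A' B' D').hom) ≫ ck (A ∧ₒ B) D (A' ∧ₒ B') D' ≫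
        (ck A B A' B' ∧ₕ 𝟙 (D ∨ₒ D')) =
      ck A (B ∧ₒ D) A' (B' ∧ₒ D') ≫ (𝟙 (A ∨ₒ A') ∧ₕ ck B D B' D') ≫
        (wedgeB (A ∨ₒ A') (B ∨ₒ B') (D ∨ₒ D')).hom
  eq2 : ∀ A B D A' B' D' : C,
    (veeB (A ∧ₒ A') (B ∧ₒ B') (D ∧ₒ D')).hom ≫ (ck A A' B B' ∨ₕ 𝟙 (D ∧ₒ D')) ≫
        ck (A ∨ₒ B) (A' ∨ₒ B') D D' =
      (𝟙 (A ∧ₒ A') ∨ₕ ck B B' D D') ≫ ck A A' (B ∨ₒ D) (B' ∨ₒ D') ≫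
        ((veeB A B D).hom ∧ₕ (veeB A' B' D').hom)
  eq3 : ∀ A B D E : C,
    ((wedgeC A B).hom ∨ₕ (wedgeC D E).hom) ≫ ck B A E D =
      ck A B D E ≫ (wedgeC (A ∨ₒ D) (B ∨ₒ E)).hom
  eq4 : ∀ A B D E : C,
    (veeC (A ∧ₒ D) (B ∧ₒ E)).hom ≫ ck B E A D =
      ck A D B E ≫ ((veeC A B).hom ∧ₕ (veeC D E).hom)
  eq5 : ∀ A B : C,
    ck A B bot bot =
      (𝟙 (A ∧ₒ B) ∨ₕ wBot.inv) ≫ (veeDelta (A ∧ₒ B)).hom ≫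
        ((veeDelta A).inv ∧ₕ (veeDelta B).inv)
  eq6 : ∀ A B : C,
    ck A top B top =
      ((wedgeDelta A).hom ∨ₕ (wedgeDelta B).hom) ≫ (wedgeDelta (A ∨ₒ B)).inv ≫
        (𝟙 (A ∨ₒ B) ∧ₕ wTop.inv)
  eq7 : (veeB (top : C) top top).hom = (𝟙 (top : C) ∨ₕ wTop.hom) ≫ (wTop.inv ∨ₕ 𝟙 (top : C))
  eq8 : (wedgeB (bot : C) bot bot).hom = (𝟙 (bot : C) ∧ₕ wBot.inv) ≫ (wBot.hom ∧ₕ 𝟙 (bot : C))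
  eq9 : (𝟙 (top : C) ∨ₕ kappa) = (veeDelta (top : C)).hom ≫ wTop.inv
  eq10 : (𝟙 (bot : C) ∧ₕ kappa) = wBot.inv ≫ (wedgeDelta (bot : C)).inv
  eq11 : ck (top : C) bot bot top =
    ((wedgeSigma (bot : C)).hom ∨ₕ (wedgeDelta (bot : C)).hom) ≫ (veeDelta (bot : C)).hom ≫
      kappa ≫ (wedgeDelta (top : C)).inv ≫
        ((veeDelta (top : C)).inv ∧ₕ (veeSigma (top : C)).inv)
  eq12 : (veeC (top : C) top).hom = wTop.hom ≫ wTop.inv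
  eq13 : (wedgeC (bot : C) bot).hom = wBot.inv ≫ wBot.hom

/-- A monoidal category is strict when its associativity and identity isomorphisms are
identities. -/
structure IsStrict {C : Type u} [Category.{v} C] (M : MonoidalCategory C) : Prop where
  assoc_obj : ∀ X Y Z : C,
    M.tensorObj (M.tensorObj X Y) Z = M.tensorObj X (M.tensorObj Y Z)
  leftUnit_obj : ∀ X : C, M.tensorObj M.tensorUnit X = X
  rightUnit_obj : ∀ X : C, M.tensorObj X M.tensorUnit = X
  assoc_hom : ∀ X Y Z : C, (M.associator X Y Z).hom = eqToHom (assoc_obj X Y Z)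
  leftUnit_hom : ∀ X : C, (M.leftUnitor X).hom = eqToHom (leftUnit_obj X)
  rightUnit_hom : ∀ X : C, (M.rightUnitor X).hom = eqToHom (rightUnit_obj X)

/-- An SMI category that is strict monoidal with respect to both `∨, ⊥` and `∧, ⊤`. -/
class StrictSMICategory (C : Type u) [Category.{v} C] extends SMICategory C where
  vee_strict : IsStrict (BiSymmetric.veeMon (C := C))
  wedge_strict : IsStrict (BiSymmetric.wedgeMon (C := C))

/-! ### Formulae and canonical arrow terms -/

/-- Propositional formulae over the letters `P`. -/
inductive Formula (P : Type) : Type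
  | letter (p : P) : Formula P
  | bot : Formula P
  | top : Formula P
  | vee (X Y : Formula P) : Formula P
  | wedge (X Y : Formula P) : Formula P

/-- Arrow terms built from identities, the associativity, symmetry and identity isomorphisms of both
monoidal structures, intermutation `ck`, `wTop : ⊤ ∨ ⊤ ⟶ ⊤`, `wBot : ⊥ ⟶ ⊥ ∧ ⊥` and
`kappa : ⊥ ⟶ ⊤` by composition, `∨` and `∧`. (The inverses of `wTop` and `wBot` are not used.) -/
inductive ArrowTerm {P : Type} : Formula P → Formula P → Type
  | id (X : Formula P) : ArrowTerm X X
  | comp {X Y Z : Formula P} (s : ArrowTerm X Y) (t : ArrowTerm Y Z) : ArrowTerm X Z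
  | vee {X Y X' Y' : Formula P} (s : ArrowTerm X X') (t : ArrowTerm Y Y') :
      ArrowTerm (X.vee Y) (X'.vee Y')
  | wedge {X Y X' Y' : Formula P} (s : ArrowTerm X X') (t : ArrowTerm Y Y') :
      ArrowTerm (X.wedge Y) (X'.wedge Y')
  | veeB (X Y Z : Formula P) : ArrowTerm (X.vee (Y.vee Z)) ((X.vee Y).vee Z)
  | veeBInv (X Y Z : Formula P) : ArrowTerm ((X.vee Y).vee Z) (X.vee (Y.vee Z))
  | veeDelta (X : Formula P) : ArrowTerm (X.vee .bot) X
  | veeDeltaInv (X : Formula P) : ArrowTerm X (X.vee .bot)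
  | veeSigma (X : Formula P) : ArrowTerm (Formula.bot.vee X) X
  | veeSigmaInv (X : Formula P) : ArrowTerm X (Formula.bot.vee X)
  | veeC (X Y : Formula P) : ArrowTerm (X.vee Y) (Y.vee X)
  | wedgeB (X Y Z : Formula P) : ArrowTerm (X.wedge (Y.wedge Z)) ((X.wedge Y).wedge Z)
  | wedgeBInv (X Y Z : Formula P) : ArrowTerm ((X.wedge Y).wedge Z) (X.wedge (Y.wedge Z))
  | wedgeDelta (X : Formula P) : ArrowTerm (X.wedge .top) X
  | wedgeDeltaInv (X : Formula P) : ArrowTerm X (X.wedge .top)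
  | wedgeSigma (X : Formula P) : ArrowTerm (Formula.top.wedge X) X
  | wedgeSigmaInv (X : Formula P) : ArrowTerm X (Formula.top.wedge X)
  | wedgeC (X Y : Formula P) : ArrowTerm (X.wedge Y) (Y.wedge X)
  | ck (X Y Z U : Formula P) :
      ArrowTerm ((X.wedge Y).vee (Z.wedge U)) ((X.vee Z).wedge (Y.vee U))
  | wTop : ArrowTerm (Formula.top.vee .top) .top
  | wBot : ArrowTerm .bot (Formula.bot.wedge .bot)
  | kappa : ArrowTerm .bot .top

section Interpretation

variable {P : Type} {C : Type u} [Category.{v} C] [SMICategory C]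

/-- The object of `C` obtained from a formula by replacing each letter `p` by `A p`. -/
def Formula.eval (A : P → C) : Formula P → C
  | .letter p => A p
  | .bot => SMI.bot
  | .top => SMI.top
  | .vee X Y => X.eval A ∨ₒ Y.eval A
  | .wedge X Y => X.eval A ∧ₒ Y.eval A

/-- The arrow of `C` obtained from an arrow term by replacing each letter `p` by `A p`. -/
def ArrowTerm.eval (A : P → C) : {X Y : Formula P} → ArrowTerm X Y → (X.eval A ⟶ Y.eval A)
  | _, _, .id X => 𝟙 (X.eval A)
  | _, _, .comp s t => s.eval A ≫ t.eval A
  | _, _, .vee s t => s.eval A ∨ₕ t.eval A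
  | _, _, .wedge s t => s.eval A ∧ₕ t.eval A
  | _, _, .veeB X Y Z => (SMI.veeB (X.eval A) (Y.eval A) (Z.eval A)).hom
  | _, _, .veeBInv X Y Z => (SMI.veeB (X.eval A) (Y.eval A) (Z.eval A)).inv
  | _, _, .veeDelta X => (SMI.veeDelta (X.eval A)).hom
  | _, _, .veeDeltaInv X => (SMI.veeDelta (X.eval A)).inv
  | _, _, .veeSigma X => (SMI.veeSigma (X.eval A)).hom
  | _, _, .veeSigmaInv X => (SMI.veeSigma (X.eval A)).inv
  | _, _, .veeC X Y => (SMI.veeC (X.eval A) (Y.eval A)).hom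
  | _, _, .wedgeB X Y Z => (SMI.wedgeB (X.eval A) (Y.eval A) (Z.eval A)).hom
  | _, _, .wedgeBInv X Y Z => (SMI.wedgeB (X.eval A) (Y.eval A) (Z.eval A)).inv
  | _, _, .wedgeDelta X => (SMI.wedgeDelta (X.eval A)).hom
  | _, _, .wedgeDeltaInv X => (SMI.wedgeDelta (X.eval A)).inv
  | _, _, .wedgeSigma X => (SMI.wedgeSigma (X.eval A)).hom
  | _, _, .wedgeSigmaInv X => (SMI.wedgeSigma (X.eval A)).inv
  | _, _, .wedgeC X Y => (SMI.wedgeC (X.eval A) (Y.eval A)).hom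
  | _, _, .ck X Y Z U => SMICategory.ck (X.eval A) (Y.eval A) (Z.eval A) (U.eval A)
  | _, _, .wTop => SMICategory.wTop.hom
  | _, _, .wBot => SMICategory.wBot.hom
  | _, _, .kappa => SMICategory.kappa

end Interpretation

/-- An arrow term over the letters `P`, together with its source and target. -/
structure CanonicalArrow (P : Type) where
  /-- the source -/
  source : Formula P
  /-- the target -/
  target : Formula P
  /-- the arrow term -/
  term : ArrowTerm source target

/-! ### The reduced bar construction based on one monoidal category

`SimplexCategory` is the topologist's simplicial category; `k.unop.len` is the natural number (the
geometric dimension) that names the object `k` of `SimplexCategoryᵒᵖ`. -/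

/-- The order-preserving map `{0, …, k + 1} → {0, …, l + 1}`, preserving the first and the last
element, that presents graphically an arrow `f : k ⟶ l` of `SimplexCategoryᵒᵖ`: it is the
complement of the graph of the monotone map `φ = f.unop : {0, …, l} → {0, …, k}`, and sends `y` to
the number of `x` with `φ x < y`. -/
def dual {k l : SimplexCategoryᵒᵖ} (f : k ⟶ l) (y : ℕ) : ℕ :=
  (Finset.univ.filter
    fun x : Fin (l.unop.len + 1) => (f.unop.toOrderHom x : ℕ) < y).card

/-- The positions among `1, …, k` that `dual f` sends to the position `j` among `1, …, l`, in
increasing order. (A position `i` is the element `i - 1` of `Fin k`.) -/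
def fibre {k l : SimplexCategoryᵒᵖ} (f : k ⟶ l) (j : Fin l.unop.len) : List (Fin k.unop.len) :=
  (List.finRange k.unop.len).filter fun i => dual f (i + 1) = j + 1

/-- The functor `(A_i) ↦ A_{i₁} ⊗ (A_{i₂} ⊗ ⋯ )` for a list of indices; the empty list gives the
unit. -/
def tensorList {ι : Type} (D : Type u) [Category.{v} D] [MonoidalCategory D] :
    List ι → ((ι → D) ⥤ D)
  | [] => (Functor.const (ι → D)).obj (MonoidalCategoryStruct.tensorUnit D)
  | i :: L =>
      Functor.prod' (Pi.eval (fun _ => D) i) (tensorList D L) ⋙ MonoidalCategory.tensor D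

/-- The reduced bar construction based on `D`, on an arrow `f : k ⟶ l` of `SimplexCategoryᵒᵖ`: the
`j`-th coordinate of the functor `D ^ k ⥤ D ^ l` is the tensor product, in order, of the coordinates
in the fibre of `f` over `j`. -/
def bar (D : Type u) [Category.{v} D] [MonoidalCategory D] {k l : SimplexCategoryᵒᵖ} (f : k ⟶ l) :
    (Fin k.unop.len → D) ⥤ (Fin l.unop.len → D) :=
  Functor.pi' fun j => tensorList D (fibre f j)

/-! ### The iterated reduced bar construction -/

/-- The tuples `(i₁, …, i_N)` indexing the `k₁ ⋯ k_N` coordinates of an object of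
`C ^ (k₁ ⋯ k_N)`. -/
abbrev MultiIndex {N : ℕ} (k : Fin N → SimplexCategoryᵒᵖ) : Type :=
  ∀ i : Fin N, Fin (k i).unop.len

section Iterated

variable (C : Type u) [Category.{v} C]

/-- The isomorphism from `C ^ (k₁ k₂ ⋯ k_N)` to `(C ^ (k₂ ⋯ k_N)) ^ k₁`. -/
def curryPower {N : ℕ} (k : Fin (N + 1) → SimplexCategoryᵒᵖ) :
    (MultiIndex k → C) ⥤ (Fin (k 0).unop.len → MultiIndex (fun i : Fin N => k i.succ) → C) where
  obj A a β := A (Fin.cons (α := fun i => Fin (k i).unop.len) a β)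
  map h a β := h (Fin.cons (α := fun i => Fin (k i).unop.len) a β)

/-- The isomorphism from `(C ^ (k₂ ⋯ k_N)) ^ k₁` to `C ^ (k₁ k₂ ⋯ k_N)`. -/
def uncurryPower {N : ℕ} (k : Fin (N + 1) → SimplexCategoryᵒᵖ) :
    (Fin (k 0).unop.len → MultiIndex (fun i : Fin N => k i.succ) → C) ⥤ (MultiIndex k → C) where
  obj A α := A (α 0) fun i => α i.succ
  map h α := h (α 0) fun i => α i.succ

/-- The reduced bar construction iterated along the monoidal structures `T 0, …, T (N - 1)` on `C`.
The functor of `(f₁, …, f_N)` is first the functor of `f₁` in the reduced bar construction based on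
`D = C ^ (k₂ ⋯ k_N)` with the componentwise monoidal structure given by the first tensor, then the
`l₁`-th power of the functor of `(f₂, …, f_N)`. Unfolding, it is the composite for
`i = 1, …, N` of the `l₁ ⋯ l_{i-1}`-th powers of the functors of `f_i` in the reduced bar
constructions based on `C ^ (k_{i+1} ⋯ k_N)` with the `i`-th tensor. -/
def iteratedBar : {N : ℕ} → (T : Fin N → MonoidalCategory C) → {k l : Fin N → SimplexCategoryᵒᵖ} →
    (k ⟶ l) → ((MultiIndex k → C) ⥤ (MultiIndex l → C))
  | 0, _, _, _, _ => Pi.comap (fun _ => C) fun _ i => i.elim0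
  | _ + 1, T, k, l, f =>
      letI := T 0
      curryPower C k ⋙ bar (MultiIndex (fun i => k (Fin.succ i)) → C) (f 0) ⋙
        Functor.pi (fun _ => iteratedBar (fun i => T i.succ) (k := fun i => k i.succ)
          (l := fun i => l i.succ) (fun i => f i.succ)) ⋙
        uncurryPower C l

/-- The list of tensors used in the `(n, m)`-reduced bar construction: `∨` for the first `n`
coordinates, `∧` for the last `m`. -/
@[reducible] def tensors [BiSymmetric C] (n m : ℕ) (i : Fin (n + m)) : MonoidalCategory C :=
  if (i : ℕ) < n then BiSymmetric.veeMon else BiSymmetric.wedgeMon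

/-- The functor `f^*` that the `(n, m)`-reduced bar construction based on `C` assigns to an arrow
`f` of `(SimplexCategoryᵒᵖ) ^ (n + m)`. -/
def pull [BiSymmetric C] (n m : ℕ) {k l : Fin (n + m) → SimplexCategoryᵒᵖ} (f : k ⟶ l) :
    (MultiIndex k → C) ⥤ (MultiIndex l → C) :=
  iteratedBar C (tensors C n m) f

/-- The `(n, m)`-reduced bar construction based on `C`: its objects and its arrows. (The category
`(SimplexCategoryᵒᵖ) ^ (n + m)` is regarded as a bicategory whose only 2-cells are identities.) -/
def reducedBar [BiSymmetric C] (n m : ℕ) :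
    PrelaxFunctor (LocallyDiscrete (Fin (n + m) → SimplexCategoryᵒᵖ)) Cat.{v, u} where
  obj k := Cat.of (MultiIndex k.as → C)
  map f := (pull C n m f.as).toCatHom
  map₂ η := eqToHom (by rw [LocallyDiscrete.eq_of_hom η])
  map₂_id _ := rfl
  map₂_comp _ _ := (eqToHom_trans _ _).symm

end Iterated

/-! ### The comparison cells of a lax functor extending given data on objects and arrows -/

section Lax

universe w₁ w₂ v₁ v₂ u₁ u₂

variable {B : Type u₁} [Bicategory.{w₁, v₁} B] {K : Type u₂} [Bicategory.{w₂, v₂} K]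

/-- The 2-cell `𝟙 ⟶ R (𝟙 a)` of a lax functor `F` whose action on objects, arrows and 2-cells is
`R`. -/
def laxId {R : PrelaxFunctor B K} (F : LaxFunctor B K) (hF : F.toPrelaxFunctor = R) (a : B) :
    𝟙 (R.obj a) ⟶ R.map (𝟙 a) :=
  hF ▸ F.mapId a

/-- The 2-cell `R g ∘ R f ⟶ R (g ∘ f)` of a lax functor `F` whose action on objects, arrows and
2-cells is `R`. -/
def laxComp {R : PrelaxFunctor B K} (F : LaxFunctor B K) (hF : F.toPrelaxFunctor = R) {a b c : B}
    (f : a ⟶ b) (g : b ⟶ c) : R.map f ≫ R.map g ⟶ R.map (f ≫ g) :=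
  hF ▸ F.mapComp f g

end Lax

end SMI

/-! A structure `T` interchanges with `S` (`Inter S T`) when the product and the unit of `T` are lax
monoidal for `S` and the associativity and unit isomorphisms of `T` are `S`-monoidal. A symmetric
structure interchanges with itself, and the SMI equations make `∨` interchange with `∧`
(`smiInter`). With `∨` placed below `∧`, every pair `k ≤ k'` has an interchange, and every triple `k
≤ k' ≤ k''` satisfies a hexagon together with its unit versions (`smiHex`), as in an iterated
monoidal category.

The functor `f^*` is built by recursion on the coordinates: products along the fibres of the first
arrow, then a power of the functor `F` of the remaining arrows. Comparing `g^* ∘ f^*` with `(g ∘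
f)^*` requires moving the products of the first arrow of `g` past `F`. The first structure lies
below all later ones, so `F` is lax monoidal for it (`iterLax`), and `chi : ⊗ F(A_i) ⟶ F(⊗ A_i)`
does this. There remain the comparison for the other coordinates, given by recursion, and the
concatenation of lists, which is an identity by strictness because fibres of a composite are
concatenated fibres (`fibre_comp`). The result is `stepΩ`, iterated as `iterΩ`.

Associativity (`stepΩ_assoc`) follows from associativity for the remaining coordinates once their
comparison is a monoidal transformation for the first structure. Monoidality is therefore carried
through the recursion (`stepΩ_isMon`), which in turn needs the lax structures of `F` for `b ≤ b'` to
be compatible (`iterDouble`); this is where the hexagons enter. In the unit laws every `chi` is an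
identity: for one identity arrow because `F` is monoidally the identity functor, for the other
because all fibres are singletons.

For the arrow terms, the construction is carried out in all strict SMI categories with interpreted
letters at once, and each of its arrows is shown to interpret one term (`iterΩ_mem`). Terms can be
composed because formulae with the same value in all such categories differ only by the monoid laws,
as the indiscrete model `FormulaClass` shows. -/

namespace SMI

/-! ### Explicit monoidal structures -/

section Explicit

variable {D : Type u} [Category.{v} D]

/-- The tensor product of two objects for a given monoidal structure. -/
abbrev ten (S : MonoidalCategory D) (A B : D) : D := S.tensorObj A B

/-- The unit of a given monoidal structure. -/
abbrev un (S : MonoidalCategory D) : D := S.tensorUnit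

/-- The tensor product of two arrows for a given monoidal structure. -/
abbrev th (S : MonoidalCategory D) {A A' B B' : D} (f : A ⟶ A') (g : B ⟶ B') :
    ten S A B ⟶ ten S A' B' := S.tensorHom f g

/-- The associator of a given monoidal structure. -/
abbrev as (S : MonoidalCategory D) (A B E : D) : ten S (ten S A B) E ≅ ten S A (ten S B E) :=
  S.associator A B E

/-- The left unitor of a given monoidal structure. -/
abbrev lu (S : MonoidalCategory D) (A : D) : ten S (un S) A ≅ A := S.leftUnitor A

/-- The right unitor of a given monoidal structure. -/
abbrev ru (S : MonoidalCategory D) (A : D) : ten S A (un S) ≅ A := S.rightUnitor A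

@[simp]
theorem th_comp (S : MonoidalCategory D) {A A' A'' B B' B'' : D} (f : A ⟶ A') (f' : A' ⟶ A'')
    (g : B ⟶ B') (g' : B' ⟶ B'') : th S f g ≫ th S f' g' = th S (f ≫ f') (g ≫ g') :=
  S.tensorHom_comp_tensorHom f g f' g'

@[simp]
theorem th_comp_assoc (S : MonoidalCategory D) {A A' A'' B B' B'' X : D} (f : A ⟶ A')
    (f' : A' ⟶ A'') (g : B ⟶ B') (g' : B' ⟶ B'') (k : ten S A'' B'' ⟶ X) :
    th S f g ≫ th S f' g' ≫ k = th S (f ≫ f') (g ≫ g') ≫ k := by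
  rw [← Category.assoc, th_comp]

@[simp]
theorem th_id (S : MonoidalCategory D) (A B : D) : th S (𝟙 A) (𝟙 B) = 𝟙 (ten S A B) :=
  S.id_tensorHom_id A B

theorem th_comp_id (S : MonoidalCategory D) {A A' A'' : D} (B : D) (f : A ⟶ A') (g : A' ⟶ A'') :
    th S (f ≫ g) (𝟙 B) = th S f (𝟙 B) ≫ th S g (𝟙 B) := by simp

theorem th_id_comp (S : MonoidalCategory D) {A A' A'' : D} (B : D) (f : A ⟶ A') (g : A' ⟶ A'') :
    th S (𝟙 B) (f ≫ g) = th S (𝟙 B) f ≫ th S (𝟙 B) g := by simp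

theorem as_nat (S : MonoidalCategory D) {A A' B B' E E' : D} (f : A ⟶ A') (g : B ⟶ B')
    (h : E ⟶ E') : th S (th S f g) h ≫ (as S A' B' E').hom =
      (as S A B E).hom ≫ th S f (th S g h) :=
  S.associator_naturality f g h

theorem lu_nat (S : MonoidalCategory D) {A A' : D} (f : A ⟶ A') :
    th S (𝟙 (un S)) f ≫ (lu S A').hom = (lu S A).hom ≫ f :=
  letI := S
  (congrArg (· ≫ _) (MonoidalCategory.id_tensorHom _ f)).trans
    (MonoidalCategory.leftUnitor_naturality f)

theorem ru_nat (S : MonoidalCategory D) {A A' : D} (f : A ⟶ A') :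
    th S f (𝟙 (un S)) ≫ (ru S A').hom = (ru S A).hom ≫ f :=
  letI := S
  (congrArg (· ≫ _) (MonoidalCategory.tensorHom_id f _)).trans
    (MonoidalCategory.rightUnitor_naturality f)

/-- The componentwise monoidal structure on a power of a category. -/
abbrev piMon (K : Type) (S : MonoidalCategory D) : MonoidalCategory (K → D) :=
  @Pi.monoidalCategory K (fun _ => D) _ (fun _ => S)

end Explicit

/-! ### Interchange of two monoidal structures -/

section Interchange

variable {D : Type u} [Category.{v} D]

/-- The data and the laws of a duoidal structure: `T` is a monoidal structure in the
2-category of monoidal categories, with respect to `S`, and lax monoidal functors. -/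
structure Inter (S T : MonoidalCategory D) where
  x : ∀ A B A' B', ten S (ten T A B) (ten T A' B') ⟶ ten T (ten S A A') (ten S B B')
  i2 : ten S (un T) (un T) ⟶ un T
  i1 : un S ⟶ ten T (un S) (un S)
  i0 : un S ⟶ un T
  x_nat : ∀ {A A' B B' E E' G G' : D} (f : A ⟶ A') (g : B ⟶ B') (f' : E ⟶ E') (g' : G ⟶ G'),
    th S (th T f g) (th T f' g') ≫ x _ _ _ _ = x _ _ _ _ ≫ th T (th S f f') (th S g g')
  -- `x_assoc`, `x_left`, `x_right` make the product of `T` lax monoidal for `S`; `i_assoc`,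
  -- `i_left`, `i_right` make its unit an `S`-monoid. The laws ending in `T` say that the associator
  -- and the unitors of `T` are `S`-monoidal.
  x_assoc : ∀ A B A' B' A'' B'',
    th S (x A B A' B') (𝟙 (ten T A'' B'')) ≫ x _ _ _ _ ≫
        th T (as S A A' A'').hom (as S B B' B'').hom =
      (as S (ten T A B) (ten T A' B') (ten T A'' B'')).hom ≫
        th S (𝟙 (ten T A B)) (x A' B' A'' B'') ≫ x _ _ _ _
  x_left : ∀ A B, th S i1 (𝟙 (ten T A B)) ≫ x _ _ _ _ ≫ th T (lu S A).hom (lu S B).hom =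
    (lu S (ten T A B)).hom
  x_right : ∀ A B, th S (𝟙 (ten T A B)) i1 ≫ x _ _ _ _ ≫ th T (ru S A).hom (ru S B).hom =
    (ru S (ten T A B)).hom
  i_assoc : th S i2 (𝟙 (un T)) ≫ i2 = (as S _ _ _).hom ≫ th S (𝟙 (un T)) i2 ≫ i2
  i_left : th S i0 (𝟙 (un T)) ≫ i2 = (lu S _).hom
  i_right : th S (𝟙 (un T)) i0 ≫ i2 = (ru S _).hom
  x_asT : ∀ A B E A' B' E',
    th S (as T A B E).hom (as T A' B' E').hom ≫ x _ _ _ _ ≫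
        th T (𝟙 (ten S A A')) (x B E B' E') =
      x _ _ _ _ ≫ th T (x A B A' B') (𝟙 (ten S E E')) ≫ (as T _ _ _).hom
  i_asT : i1 ≫ th T i1 (𝟙 (un S)) ≫ (as T _ _ _).hom = i1 ≫ th T (𝟙 (un S)) i1
  x_luT : ∀ A B, x (un T) A (un T) B ≫ th T i2 (𝟙 (ten S A B)) ≫ (lu T _).hom =
    th S (lu T A).hom (lu T B).hom
  i_luT : i1 ≫ th T i0 (𝟙 (un S)) ≫ (lu T _).hom = 𝟙 _
  x_ruT : ∀ A B, x A (un T) B (un T) ≫ th T (𝟙 (ten S A B)) i2 ≫ (ru T _).hom =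
    th S (ru T A).hom (ru T B).hom
  i_ruT : i1 ≫ th T (𝟙 (un S)) i0 ≫ (ru T _).hom = 𝟙 _

/-- The compatibility of the three interchanges between three monoidal structures. -/
structure Hex {R S T : MonoidalCategory D} (a : Inter R S) (b : Inter R T) (c : Inter S T) :
    Prop where
  x_bb : ∀ A B E G A' B' E' G',
    a.x (ten T A B) (ten T E G) (ten T A' B') (ten T E' G') ≫
        th S (b.x A B A' B') (b.x E G E' G') ≫ c.x _ _ _ _ =
      th R (c.x A B E G) (c.x A' B' E' G') ≫ b.x _ _ _ _ ≫
        th T (a.x A E A' E') (a.x B G B' G')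
  x_bn : a.i1 ≫ th S b.i1 b.i1 ≫ c.x _ _ _ _ = b.i1 ≫ th T a.i1 a.i1
  x_nb : a.i2 ≫ c.i1 = th R c.i1 c.i1 ≫ b.x _ _ _ _ ≫ th T a.i2 a.i2
  x_nn : a.i0 ≫ c.i1 = b.i1 ≫ th T a.i0 a.i0
  i_bb : a.x (un T) (un T) (un T) (un T) ≫ th S b.i2 b.i2 ≫ c.i2 = th R c.i2 c.i2 ≫ b.i2
  i_bn : a.i1 ≫ th S b.i0 b.i0 ≫ c.i2 = b.i0
  i_nb : a.i2 ≫ c.i0 = th R c.i0 c.i0 ≫ b.i2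
  i_nn : a.i0 ≫ c.i0 = b.i0

/-- The componentwise interchange on a power of a category. -/
def Inter.pi (K : Type) {S T : MonoidalCategory D} (a : Inter S T) :
    Inter (piMon K S) (piMon K T) where
  x A B A' B' i := a.x (A i) (B i) (A' i) (B' i)
  i2 _ := a.i2
  i1 _ := a.i1
  i0 _ := a.i0
  x_nat f g f' g' := funext fun i => a.x_nat (f i) (g i) (f' i) (g' i)
  x_assoc A B A' B' A'' B'' :=
    funext fun i => a.x_assoc (A i) (B i) (A' i) (B' i) (A'' i) (B'' i)
  x_left A B := funext fun i => a.x_left (A i) (B i)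
  x_right A B := funext fun i => a.x_right (A i) (B i)
  i_assoc := funext fun _ => a.i_assoc
  i_left := funext fun _ => a.i_left
  i_right := funext fun _ => a.i_right
  x_asT A B E A' B' E' := funext fun i => a.x_asT (A i) (B i) (E i) (A' i) (B' i) (E' i)
  i_asT := funext fun _ => a.i_asT
  x_luT A B := funext fun i => a.x_luT (A i) (B i)
  i_luT := funext fun _ => a.i_luT
  x_ruT A B := funext fun i => a.x_ruT (A i) (B i)
  i_ruT := funext fun _ => a.i_ruT

theorem Hex.pi (K : Type) {R S T : MonoidalCategory D} {a : Inter R S} {b : Inter R T}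
    {c : Inter S T} (h : Hex a b c) : Hex (a.pi K) (b.pi K) (c.pi K) where
  x_bb A B E G A' B' E' G' :=
    funext fun i => h.x_bb (A i) (B i) (E i) (G i) (A' i) (B' i) (E' i) (G' i)
  x_bn := funext fun _ => h.x_bn
  x_nb := funext fun _ => h.x_nb
  x_nn := funext fun _ => h.x_nn
  i_bb := funext fun _ => h.i_bb
  i_bn := funext fun _ => h.i_bn
  i_nb := funext fun _ => h.i_nb
  i_nn := funext fun _ => h.i_nn

end Interchange

/-! ### Lax monoidal functors and monoidal transformations -/

section LaxMonoidal

variable {D : Type u} [Category.{v} D] {E : Type u} [Category.{v} E]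
  {G : Type u} [Category.{v} G]

/-- A lax monoidal structure on a functor, for given monoidal structures. -/
structure Lax (S : MonoidalCategory D) (S' : MonoidalCategory E) (F : D ⥤ E) where
  ε : un S' ⟶ F.obj (un S)
  μ : ∀ A B, ten S' (F.obj A) (F.obj B) ⟶ F.obj (ten S A B)
  μ_nat : ∀ {A A' B B' : D} (f : A ⟶ A') (g : B ⟶ B'),
    th S' (F.map f) (F.map g) ≫ μ A' B' = μ A B ≫ F.map (th S f g)
  assoc : ∀ A B X, th S' (μ A B) (𝟙 (F.obj X)) ≫ μ (ten S A B) X ≫ F.map (as S A B X).hom =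
    (as S' _ _ _).hom ≫ th S' (𝟙 (F.obj A)) (μ B X) ≫ μ A (ten S B X)
  left : ∀ A, th S' ε (𝟙 (F.obj A)) ≫ μ _ A ≫ F.map (lu S A).hom = (lu S' _).hom
  right : ∀ A, th S' (𝟙 (F.obj A)) ε ≫ μ A _ ≫ F.map (ru S A).hom = (ru S' _).hom

/-- The compatibility of the lax monoidal structures on a functor with two interchanges. -/
structure Double {R S : MonoidalCategory D} {R' S' : MonoidalCategory E} (a : Inter R S)
    (a' : Inter R' S') {F : D ⥤ E} (r : Lax R R' F) (s : Lax S S' F) : Prop where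
  bb : ∀ A B A' B', a'.x (F.obj A) (F.obj B) (F.obj A') (F.obj B') ≫
      th S' (r.μ A A') (r.μ B B') ≫ s.μ _ _ =
    th R' (s.μ A B) (s.μ A' B') ≫ r.μ _ _ ≫ F.map (a.x A B A' B')
  bn : a'.i1 ≫ th S' r.ε r.ε ≫ s.μ _ _ = r.ε ≫ F.map a.i1
  nb : a'.i2 ≫ s.ε = th R' s.ε s.ε ≫ r.μ _ _ ≫ F.map a.i2
  nn : a'.i0 ≫ s.ε = r.ε ≫ F.map a.i0

/-- A natural transformation, given by its components, is monoidal. -/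
structure IsMon {S : MonoidalCategory D} {S' : MonoidalCategory E} {F F' : D ⥤ E}
    (l : Lax S S' F) (l' : Lax S S' F') (η : ∀ A, F.obj A ⟶ F'.obj A) : Prop where
  unit : l.ε ≫ η _ = l'.ε
  mul : ∀ A B, l.μ A B ≫ η _ = th S' (η A) (η B) ≫ l'.μ A B

namespace Lax

/-- The identity functor is lax monoidal. -/
def id (S : MonoidalCategory D) : Lax S S (𝟭 D) where
  ε := 𝟙 _
  μ _ _ := 𝟙 _
  μ_nat _ _ := by simp
  assoc _ _ _ := by simp
  left _ := by simp
  right _ := by simp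

/-- Lax monoidal functors compose. -/
def comp {S : MonoidalCategory D} {S' : MonoidalCategory E} {S'' : MonoidalCategory G}
    {F : D ⥤ E} {H : E ⥤ G} (l : Lax S S' F) (m : Lax S' S'' H) : Lax S S'' (F ⋙ H) where
  ε := m.ε ≫ H.map l.ε
  μ A B := m.μ _ _ ≫ H.map (l.μ A B)
  μ_nat {A A' B B'} f g := by
    change th S'' (H.map (F.map f)) (H.map (F.map g)) ≫ _ = _ ≫ H.map (F.map (th S f g))
    rw [reassoc_of% m.μ_nat, Category.assoc, ← H.map_comp, ← H.map_comp, l.μ_nat]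
  assoc A B X := by
    have h1 := m.μ_nat (l.μ A B) (𝟙 (F.obj X))
    have h2 := m.μ_nat (𝟙 (F.obj A)) (l.μ B X)
    have h3 := m.assoc (F.obj A) (F.obj B) (F.obj X)
    rw [H.map_id] at h1 h2
    change th S'' (m.μ _ _ ≫ H.map (l.μ A B)) (𝟙 (H.obj (F.obj X))) ≫
        (m.μ _ _ ≫ H.map (l.μ _ X)) ≫ H.map (F.map (as S A B X).hom) =
      (as S'' (H.obj (F.obj A)) (H.obj (F.obj B)) (H.obj (F.obj X))).hom ≫
        th S'' (𝟙 (H.obj (F.obj A))) (m.μ _ _ ≫ H.map (l.μ B X)) ≫ m.μ _ _ ≫ H.map (l.μ A _)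
    rw [th_comp_id, th_id_comp]
    simp only [Category.assoc]
    rw [reassoc_of% h1, reassoc_of% h2, ← H.map_comp, ← H.map_comp, ← H.map_comp, l.assoc,
      H.map_comp, reassoc_of% h3]
  left A := by
    have h1 := m.μ_nat l.ε (𝟙 (F.obj A))
    rw [H.map_id] at h1
    change th S'' (m.ε ≫ H.map l.ε) (𝟙 (H.obj (F.obj A))) ≫
      (m.μ _ _ ≫ H.map (l.μ _ A)) ≫ H.map (F.map (lu S A).hom) = (lu S'' (H.obj (F.obj A))).hom
    rw [th_comp_id, Category.assoc, Category.assoc, reassoc_of% h1, ← H.map_comp, ← H.map_comp,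
      l.left, m.left]
  right A := by
    have h1 := m.μ_nat (𝟙 (F.obj A)) l.ε
    rw [H.map_id] at h1
    change th S'' (𝟙 (H.obj (F.obj A))) (m.ε ≫ H.map l.ε) ≫
      (m.μ _ _ ≫ H.map (l.μ A _)) ≫ H.map (F.map (ru S A).hom) = (ru S'' (H.obj (F.obj A))).hom
    rw [th_id_comp, Category.assoc, Category.assoc, reassoc_of% h1, ← H.map_comp, ← H.map_comp,
      l.right, m.right]

/-- A power of a lax monoidal functor. -/
def pi (K : Type) {S : MonoidalCategory D} {S' : MonoidalCategory E} {F : D ⥤ E}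
    (l : Lax S S' F) : Lax (piMon K S) (piMon K S') (Functor.pi fun _ : K => F) where
  ε _ := l.ε
  μ A B i := l.μ (A i) (B i)
  μ_nat f g := funext fun i => l.μ_nat (f i) (g i)
  assoc A B X := funext fun i => l.assoc (A i) (B i) (X i)
  left A := funext fun i => l.left (A i)
  right A := funext fun i => l.right (A i)

/-- A family of lax monoidal functors gives a lax monoidal functor into a power. -/
def pi' {K : Type} {S : MonoidalCategory D} {S' : MonoidalCategory E} {F : K → D ⥤ E}
    (l : ∀ i, Lax S S' (F i)) : Lax S (piMon K S') (Functor.pi' F) where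
  ε i := (l i).ε
  μ A B i := (l i).μ A B
  μ_nat f g := funext fun i => (l i).μ_nat f g
  assoc A B X := funext fun i => (l i).assoc A B X
  left A := funext fun i => (l i).left A
  right A := funext fun i => (l i).right A

/-- The lax monoidal structure on the projections of a power. -/
def eval {K : Type} (S : MonoidalCategory D) (i : K) :
    Lax (piMon K S) S (Pi.eval (fun _ => D) i) where
  ε := 𝟙 _
  μ _ _ := 𝟙 _
  μ_nat _ _ := (Category.comp_id _).trans (Category.id_comp _).symm
  assoc A B X := by
    change th S (𝟙 (ten S (A i) (B i))) (𝟙 (X i)) ≫ 𝟙 _ ≫ (as S (A i) (B i) (X i)).hom =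
      (as S (A i) (B i) (X i)).hom ≫ th S (𝟙 (A i)) (𝟙 (ten S (B i) (X i))) ≫ 𝟙 _
    simp
  left A := by
    change th S (𝟙 (un S)) (𝟙 (A i)) ≫ 𝟙 _ ≫ (lu S (A i)).hom = (lu S (A i)).hom
    simp
  right A := by
    change th S (𝟙 (A i)) (𝟙 (un S)) ≫ 𝟙 _ ≫ (ru S (A i)).hom = (ru S (A i)).hom
    simp

/-- The unit of a second monoidal structure gives a constant lax monoidal functor. -/
@[simps] def const (S : MonoidalCategory D) {S' T : MonoidalCategory E} (a : Inter S' T) :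
    Lax S S' ((Functor.const D).obj (un T)) where
  ε := a.i0
  μ _ _ := a.i2
  μ_nat _ _ := by simp
  assoc _ _ _ := by simpa using a.i_assoc
  left _ := by simpa using a.i_left
  right _ := by simpa using a.i_right

/-- The product, for a second monoidal structure, of two lax monoidal functors. -/
def tensor {S : MonoidalCategory D} {S' T : MonoidalCategory E} (a : Inter S' T)
    {F H : D ⥤ E} (l : Lax S S' F) (m : Lax S S' H) :
    Lax S S' (F.prod' H ⋙ @MonoidalCategory.tensor E _ T) where
  ε := a.i1 ≫ th T l.ε m.ε
  μ A B := a.x _ _ _ _ ≫ th T (l.μ A B) (m.μ A B)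
  μ_nat f g := by
    change th S' (th T (F.map f) (H.map f)) (th T (F.map g) (H.map g)) ≫
        a.x _ _ _ _ ≫ th T (l.μ _ _) (m.μ _ _) =
      (a.x _ _ _ _ ≫ th T (l.μ _ _) (m.μ _ _)) ≫ th T (F.map (th S f g)) (H.map (th S f g))
    rw [reassoc_of% a.x_nat, Category.assoc, th_comp, th_comp, l.μ_nat, m.μ_nat]
  assoc A B X := by
    change th S' (a.x _ _ _ _ ≫ th T (l.μ A B) (m.μ A B)) (𝟙 (ten T (F.obj X) (H.obj X))) ≫
        (a.x _ _ _ _ ≫ th T (l.μ _ _) (m.μ _ _)) ≫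
          th T (F.map (as S A B X).hom) (H.map (as S A B X).hom) =
      (as S' (ten T (F.obj A) (H.obj A)) (ten T (F.obj B) (H.obj B))
        (ten T (F.obj X) (H.obj X))).hom ≫
        th S' (𝟙 (ten T (F.obj A) (H.obj A))) (a.x _ _ _ _ ≫ th T (l.μ B X) (m.μ B X)) ≫
          a.x _ _ _ _ ≫ th T (l.μ _ _) (m.μ _ _)
    have e1 : th S' (a.x _ _ _ _ ≫ th T (l.μ A B) (m.μ A B)) (𝟙 (ten T (F.obj X) (H.obj X))) =
      th S' (a.x _ _ _ _) (𝟙 _) ≫ th S' (th T (l.μ A B) (m.μ A B)) (th T (𝟙 _) (𝟙 _)) := by simp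
    have e2 : th S' (𝟙 (ten T (F.obj A) (H.obj A))) (a.x _ _ _ _ ≫ th T (l.μ B X) (m.μ B X)) =
      th S' (𝟙 _) (a.x _ _ _ _) ≫ th S' (th T (𝟙 _) (𝟙 _)) (th T (l.μ B X) (m.μ B X)) := by simp
    rw [e1, e2]
    simp only [Category.assoc]
    rw [reassoc_of% a.x_nat, reassoc_of% a.x_nat, th_comp, th_comp, th_comp, l.assoc, m.assoc,
      ← th_comp, reassoc_of% a.x_assoc]
  left A := by
    change th S' (a.i1 ≫ th T l.ε m.ε) (𝟙 (ten T (F.obj A) (H.obj A))) ≫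
        (a.x _ _ _ _ ≫ th T (l.μ _ _) (m.μ _ _)) ≫
          th T (F.map (lu S A).hom) (H.map (lu S A).hom) = (lu S' (ten T (F.obj A) (H.obj A))).hom
    have e1 : th S' (a.i1 ≫ th T l.ε m.ε) (𝟙 (ten T (F.obj A) (H.obj A))) =
      th S' a.i1 (𝟙 _) ≫ th S' (th T l.ε m.ε) (th T (𝟙 _) (𝟙 _)) := by simp
    rw [e1]
    simp only [Category.assoc]
    rw [reassoc_of% a.x_nat, th_comp, th_comp, l.left, m.left, a.x_left]
  right A := by
    change th S' (𝟙 (ten T (F.obj A) (H.obj A))) (a.i1 ≫ th T l.ε m.ε) ≫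
        (a.x _ _ _ _ ≫ th T (l.μ _ _) (m.μ _ _)) ≫
          th T (F.map (ru S A).hom) (H.map (ru S A).hom) = (ru S' (ten T (F.obj A) (H.obj A))).hom
    have e1 : th S' (𝟙 (ten T (F.obj A) (H.obj A))) (a.i1 ≫ th T l.ε m.ε) =
      th S' (𝟙 _) a.i1 ≫ th S' (th T (𝟙 _) (𝟙 _)) (th T l.ε m.ε) := by simp
    rw [e1]
    simp only [Category.assoc]
    rw [reassoc_of% a.x_nat, th_comp, th_comp, l.right, m.right, a.x_right]

end Lax

namespace Double

variable {R S : MonoidalCategory D} {R' S' : MonoidalCategory E} {R'' S'' : MonoidalCategory G}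
  {a : Inter R S} {a' : Inter R' S'} {a'' : Inter R'' S''}

theorem comp {F : D ⥤ E} {H : E ⥤ G} {r : Lax R R' F} {s : Lax S S' F} {r' : Lax R' R'' H}
    {s' : Lax S' S'' H} (h : Double a a' r s) (h' : Double a' a'' r' s') :
    Double a a'' (r.comp r') (s.comp s') where
  bb A B A' B' := by
    change a''.x (H.obj (F.obj A)) (H.obj (F.obj B)) (H.obj (F.obj A')) (H.obj (F.obj B')) ≫
        th S'' (r'.μ _ _ ≫ H.map (r.μ A A')) (r'.μ _ _ ≫ H.map (r.μ B B')) ≫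
          s'.μ _ _ ≫ H.map (s.μ _ _) =
      th R'' (s'.μ _ _ ≫ H.map (s.μ A B)) (s'.μ _ _ ≫ H.map (s.μ A' B')) ≫
        (r'.μ _ _ ≫ H.map (r.μ _ _)) ≫ H.map (F.map (a.x A B A' B'))
    rw [← th_comp, ← th_comp, Category.assoc, reassoc_of% s'.μ_nat, reassoc_of% h'.bb, Category.assoc,
      Category.assoc, reassoc_of% r'.μ_nat]
    simp only [← H.map_comp]
    rw [h.bb]
  bn := by
    change a''.i1 ≫ th S'' (r'.ε ≫ H.map r.ε) (r'.ε ≫ H.map r.ε) ≫ s'.μ _ _ ≫ H.map (s.μ _ _) =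
      (r'.ε ≫ H.map r.ε) ≫ H.map (F.map a.i1)
    rw [← th_comp, Category.assoc, reassoc_of% s'.μ_nat, reassoc_of% h'.bn, Category.assoc]
    simp only [← H.map_comp]
    rw [h.bn]
  nb := by
    change a''.i2 ≫ s'.ε ≫ H.map s.ε = th R'' (s'.ε ≫ H.map s.ε) (s'.ε ≫ H.map s.ε) ≫
      (r'.μ _ _ ≫ H.map (r.μ _ _)) ≫ H.map (F.map a.i2)
    rw [← th_comp, Category.assoc, Category.assoc, reassoc_of% r'.μ_nat, reassoc_of% h'.nb]
    simp only [← H.map_comp]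
    rw [h.nb]
  nn := by
    change a''.i0 ≫ s'.ε ≫ H.map s.ε = (r'.ε ≫ H.map r.ε) ≫ H.map (F.map a.i0)
    rw [reassoc_of% h'.nn, Category.assoc]
    simp only [← H.map_comp]
    rw [h.nn]

theorem pi (K : Type) {F : D ⥤ E} {r : Lax R R' F} {s : Lax S S' F} (h : Double a a' r s) :
    Double (a.pi K) (a'.pi K) (r.pi K) (s.pi K) where
  bb A B A' B' := funext fun i => h.bb (A i) (B i) (A' i) (B' i)
  bn := funext fun _ => h.bn
  nb := funext fun _ => h.nb
  nn := funext fun _ => h.nn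

theorem pi' {K : Type} {F : K → D ⥤ E} {r : ∀ i, Lax R R' (F i)} {s : ∀ i, Lax S S' (F i)}
    (h : ∀ i, Double a a' (r i) (s i)) : Double a (a'.pi K) (Lax.pi' r) (Lax.pi' s) where
  bb A B A' B' := funext fun i => (h i).bb A B A' B'
  bn := funext fun i => (h i).bn
  nb := funext fun i => (h i).nb
  nn := funext fun i => (h i).nn

theorem eval {K : Type} (a : Inter R S) (i : K) :
    Double (a.pi K) a (Lax.eval R i) (Lax.eval S i) where
  bb A B A' B' := by
    change a.x _ _ _ _ ≫ th S (𝟙 (ten R (A i) (A' i))) (𝟙 (ten R (B i) (B' i))) ≫ 𝟙 _ =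
      th R (𝟙 (ten S (A i) (B i))) (𝟙 (ten S (A' i) (B' i))) ≫ 𝟙 _ ≫
        a.x (A i) (B i) (A' i) (B' i)
    simp
  bn := by
    change a.i1 ≫ th S (𝟙 (un R)) (𝟙 (un R)) ≫ 𝟙 _ = 𝟙 _ ≫ a.i1
    simp
  nb := by
    change a.i2 ≫ 𝟙 _ = th R (𝟙 (un S)) (𝟙 (un S)) ≫ 𝟙 _ ≫ a.i2
    simp
  nn := by
    change a.i0 ≫ 𝟙 _ = 𝟙 _ ≫ a.i0
    simp

variable {T' : MonoidalCategory E} {b : Inter R' T'} {c : Inter S' T'}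

/-- For a constant functor at the unit of `T'`, the four conditions are the four `i_` fields of
`Hex`. -/
theorem const (a : Inter R S) (h : Hex a' b c) : Double a a' (Lax.const R b) (Lax.const S c) where
  bb _ _ _ _ := by simpa using h.i_bb
  bn := by simpa using h.i_bn
  nb := by simpa using h.i_nb
  nn := by simpa using h.i_nn

/-- The four `x_` fields of `Hex` are the case of the product functor itself; naturality of the
interchanges reduces the general case to it. -/
theorem tensor (h : Hex a' b c) {F H : D ⥤ E} {r : Lax R R' F} {s : Lax S S' F}
    {r' : Lax R R' H} {s' : Lax S S' H} (d : Double a a' r s) (d' : Double a a' r' s') :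
    Double a a' (Lax.tensor b r r') (Lax.tensor c s s') where
  bb A B A' B' := by
    change a'.x (ten T' (F.obj A) (H.obj A)) (ten T' (F.obj B) (H.obj B))
          (ten T' (F.obj A') (H.obj A')) (ten T' (F.obj B') (H.obj B')) ≫
        th S' (b.x _ _ _ _ ≫ th T' (r.μ A A') (r'.μ A A'))
          (b.x _ _ _ _ ≫ th T' (r.μ B B') (r'.μ B B')) ≫ c.x _ _ _ _ ≫ th T' (s.μ _ _) (s'.μ _ _) =
      th R' (c.x _ _ _ _ ≫ th T' (s.μ A B) (s'.μ A B))
          (c.x _ _ _ _ ≫ th T' (s.μ A' B') (s'.μ A' B')) ≫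
        (b.x _ _ _ _ ≫ th T' (r.μ _ _) (r'.μ _ _)) ≫
          th T' (F.map (a.x A B A' B')) (H.map (a.x A B A' B'))
    rw [← th_comp, ← th_comp, Category.assoc, Category.assoc, Category.assoc, reassoc_of% c.x_nat,
      reassoc_of% h.x_bb, reassoc_of% b.x_nat]
    simp only [th_comp]
    rw [d.bb, d'.bb]
  bn := by
    change a'.i1 ≫ th S' (b.i1 ≫ th T' r.ε r'.ε) (b.i1 ≫ th T' r.ε r'.ε) ≫
        c.x _ _ _ _ ≫ th T' (s.μ _ _) (s'.μ _ _) =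
      (b.i1 ≫ th T' r.ε r'.ε) ≫ th T' (F.map a.i1) (H.map a.i1)
    rw [← th_comp, Category.assoc, reassoc_of% c.x_nat, reassoc_of% h.x_bn, Category.assoc]
    simp only [th_comp]
    rw [d.bn, d'.bn]
  nb := by
    change a'.i2 ≫ c.i1 ≫ th T' s.ε s'.ε =
      th R' (c.i1 ≫ th T' s.ε s'.ε) (c.i1 ≫ th T' s.ε s'.ε) ≫
        (b.x _ _ _ _ ≫ th T' (r.μ _ _) (r'.μ _ _)) ≫ th T' (F.map a.i2) (H.map a.i2)
    rw [← th_comp, Category.assoc, Category.assoc, reassoc_of% b.x_nat, reassoc_of% h.x_nb]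
    simp only [th_comp]
    rw [d.nb, d'.nb]
  nn := by
    change a'.i0 ≫ c.i1 ≫ th T' s.ε s'.ε =
      (b.i1 ≫ th T' r.ε r'.ε) ≫ th T' (F.map a.i0) (H.map a.i0)
    rw [reassoc_of% h.x_nn, Category.assoc]
    simp only [th_comp]
    rw [d.nn, d'.nn]

end Double

end LaxMonoidal

/-! ### Products of lists of coordinates and their lax monoidal structures. -/

section Lists

variable {D : Type u} [Category.{v} D] {E : Type u} [Category.{v} E]
  {G : Type u} [Category.{v} G] {ι κ : Type}

/-- The product of a list of coordinates for a given monoidal structure. -/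
abbrev tl (S : MonoidalCategory D) (L : List ι) : (ι → D) ⥤ D := @tensorList ι D _ S L

/-- The functor whose coordinates are the products of the coordinates in given lists. -/
abbrev barL (S : MonoidalCategory D) (ℓ : κ → List ι) : (ι → D) ⥤ (κ → D) :=
  Functor.pi' fun j => tl S (ℓ j)

/-- The lax monoidal structure on the product of a list of coordinates. -/
def listLax {R S : MonoidalCategory D} (a : Inter R S) :
    ∀ L : List ι, Lax (piMon ι R) R (tl S L)
  | [] => Lax.const (piMon ι R) a
  | i :: L => Lax.tensor a (Lax.eval R i) (listLax a L)

/-- A product of a list is assembled from a constant, projections and binary products, each of which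
is compatible. -/
theorem listDouble {R S T : MonoidalCategory D} {a : Inter R S} {b : Inter R T} {c : Inter S T}
    (h : Hex a b c) : ∀ L : List ι, Double (a.pi ι) a (listLax b L) (listLax c L)
  | [] => Double.const (a.pi ι) h
  | i :: L => Double.tensor h (Double.eval a i) (listDouble h L)

/-- The lax monoidal structure on `barL`. -/
def barLax {R S : MonoidalCategory D} (a : Inter R S) (ℓ : κ → List ι) :
    Lax (piMon ι R) (piMon κ R) (barL S ℓ) :=
  Lax.pi' fun j => listLax a (ℓ j)

theorem barDouble {R S T : MonoidalCategory D} {a : Inter R S} {b : Inter R T} {c : Inter S T}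
    (h : Hex a b c) (ℓ : κ → List ι) : Double (a.pi ι) (a.pi κ) (barLax b ℓ) (barLax c ℓ) :=
  Double.pi' fun j => listDouble h (ℓ j)

/-! ### Concatenation -/

/-- The product of two lists of coordinates, compared with that of their concatenation. -/
def gApp (S : MonoidalCategory D) (A : ι → D) :
    ∀ L L' : List ι, ten S ((tl S L).obj A) ((tl S L').obj A) ⟶ (tl S (L ++ L')).obj A
  | [], L' => (lu S ((tl S L').obj A)).hom
  | i :: L, L' => (as S (A i) ((tl S L).obj A) ((tl S L').obj A)).hom ≫
      th S (𝟙 (A i)) (gApp S A L L')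

theorem gApp_nat (S : MonoidalCategory D) {A B : ι → D} (f : A ⟶ B) (L L' : List ι) :
    th S ((tl S L).map f) ((tl S L').map f) ≫ gApp S B L L' =
      gApp S A L L' ≫ (tl S (L ++ L')).map f := by
  induction L with
  | nil => exact lu_nat S _
  | cons i L ih =>
    change th S (th S (f i) ((tl S L).map f)) ((tl S L').map f) ≫ (as S _ _ _).hom ≫ th S _ _ =
      ((as S _ _ _).hom ≫ th S _ _) ≫ th S (f i) ((tl S (L ++ L')).map f)
    rw [reassoc_of% as_nat, th_comp, ih, Category.assoc, th_comp, Category.comp_id,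
      Category.id_comp]

/-- Concatenation is assembled from the left unitor and the associator of `S`, and both are
`R`-monoidal by `i_luT`, `x_luT`, `i_asT` and `x_asT`. -/
theorem gApp_isMon {R S : MonoidalCategory D} (a : Inter R S) (L L' : List ι) :
    IsMon (Lax.tensor a (listLax a L) (listLax a L')) (listLax a (L ++ L'))
      (fun A => gApp S A L L') := by
  induction L with
  | nil =>
    constructor
    · change (a.i1 ≫ th S a.i0 (listLax a L').ε) ≫ (lu S _).hom = (listLax a L').ε
      rw [← Category.id_comp (listLax a L').ε, ← Category.comp_id a.i0, ← th_comp, Category.assoc,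
        Category.assoc, lu_nat, reassoc_of% a.i_luT, Category.id_comp]
    · intro A B
      change (a.x _ _ _ _ ≫ th S a.i2 ((listLax a L').μ A B)) ≫ (lu S _).hom =
        th R (lu S _).hom (lu S _).hom ≫ (listLax a L').μ A B
      rw [← Category.id_comp ((listLax a L').μ A B), ← Category.comp_id a.i2, ← th_comp,
        Category.assoc, Category.assoc, lu_nat, reassoc_of% a.x_luT, Category.id_comp]
  | cons i L ih =>
    constructor
    · have h := ih.unit
      change (a.i1 ≫ th S (listLax a L).ε (listLax a L').ε) ≫ gApp S _ L L' =
        (listLax a (L ++ L')).ε at h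
      change (a.i1 ≫ th S (a.i1 ≫ th S (𝟙 (un R)) (listLax a L).ε) (listLax a L').ε) ≫
        (as S _ _ _).hom ≫ th S (𝟙 _) (gApp S _ L L') =
        a.i1 ≫ th S (𝟙 (un R)) (listLax a (L ++ L')).ε
      rw [← h, ← Category.id_comp (listLax a L').ε, ← th_comp, Category.id_comp,
        Category.assoc, Category.assoc, reassoc_of% as_nat, reassoc_of% a.i_asT]
      simp
    · intro A B
      have h := ih.mul A B
      change (a.x _ _ _ _ ≫ th S ((listLax a L).μ A B) ((listLax a L').μ A B)) ≫ gApp S _ L L' =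
        th R (gApp S A L L') (gApp S B L L') ≫ (listLax a (L ++ L')).μ A B at h
      change (a.x _ _ _ _ ≫ th S (a.x _ _ _ _ ≫ th S (𝟙 (ten R (A i) (B i)))
            ((listLax a L).μ A B)) ((listLax a L').μ A B)) ≫
          (as S _ _ _).hom ≫ th S (𝟙 _) (gApp S _ L L') =
        th R ((as S _ _ _).hom ≫ th S (𝟙 (A i)) (gApp S A L L'))
            ((as S _ _ _).hom ≫ th S (𝟙 (B i)) (gApp S B L L')) ≫
          a.x _ _ _ _ ≫ th S (𝟙 (ten R (A i) (B i))) ((listLax a (L ++ L')).μ A B)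
      rw [← th_comp R, Category.assoc, Category.assoc, reassoc_of% a.x_nat, th_comp, th_id,
        Category.id_comp, ← h, Category.assoc, th_id_comp, reassoc_of% a.x_asT,
        ← Category.id_comp ((listLax a L').μ A B), ← th_comp, Category.id_comp,
        Category.assoc, reassoc_of% as_nat]
      simp only [th_comp, Category.comp_id]

/-- The product of the products of some lists of coordinates, compared with the product of the
concatenation of these lists. -/
def gFlat (S : MonoidalCategory D) (ℓ : κ → List ι) (A : ι → D) :
    ∀ K : List κ, (tl S K).obj ((barL S ℓ).obj A) ⟶ (tl S (K.flatMap ℓ)).obj A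
  | [] => 𝟙 (un S)
  | j :: K => th S (𝟙 ((tl S (ℓ j)).obj A)) (gFlat S ℓ A K) ≫ gApp S A (ℓ j) (K.flatMap ℓ)

theorem gFlat_nat (S : MonoidalCategory D) (ℓ : κ → List ι) {A B : ι → D} (f : A ⟶ B)
    (K : List κ) :
    (tl S K).map ((barL S ℓ).map f) ≫ gFlat S ℓ B K =
      gFlat S ℓ A K ≫ (tl S (K.flatMap ℓ)).map f := by
  induction K with
  | nil => exact (Category.comp_id _).trans (Category.id_comp _).symm
  | cons j K ih =>
    change th S ((tl S (ℓ j)).map f) ((tl S K).map ((barL S ℓ).map f)) ≫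
        th S (𝟙 _) (gFlat S ℓ B K) ≫ gApp S B (ℓ j) (K.flatMap ℓ) =
      (th S (𝟙 _) (gFlat S ℓ A K) ≫ gApp S A (ℓ j) (K.flatMap ℓ)) ≫
        (tl S (ℓ j ++ K.flatMap ℓ)).map f
    rw [th_comp_assoc, ih, Category.assoc, ← gApp_nat, th_comp_assoc, Category.comp_id,
      Category.id_comp]

theorem gFlat_isMon {R S : MonoidalCategory D} (a : Inter R S) (ℓ : κ → List ι) (K : List κ) :
    IsMon ((barLax a ℓ).comp (listLax a K)) (listLax a (K.flatMap ℓ))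
      (fun A => gFlat S ℓ A K) := by
  induction K with
  | nil =>
    constructor
    · change (a.i0 ≫ 𝟙 _) ≫ 𝟙 _ = a.i0
      simp
    · intro A B
      change (a.i2 ≫ 𝟙 _) ≫ 𝟙 _ = th R (𝟙 _) (𝟙 _) ≫ a.i2
      simp
  | cons j K ih =>
    constructor
    · have h := ih.unit
      have h' := (gApp_isMon a (ℓ j) (K.flatMap ℓ)).unit
      change ((listLax a K).ε ≫ (tl S K).map (barLax a ℓ).ε) ≫ gFlat S ℓ _ K =
        (listLax a (K.flatMap ℓ)).ε at h
      change (a.i1 ≫ th S (listLax a (ℓ j)).ε (listLax a (K.flatMap ℓ)).ε) ≫ gApp S _ _ _ =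
        (listLax a (ℓ j ++ K.flatMap ℓ)).ε at h'
      change ((a.i1 ≫ th S (𝟙 _) (listLax a K).ε) ≫
          th S (listLax a (ℓ j)).ε ((tl S K).map (barLax a ℓ).ε)) ≫
            th S (𝟙 _) (gFlat S ℓ _ K) ≫ gApp S _ _ _ = (listLax a (ℓ j ++ K.flatMap ℓ)).ε
      rw [← h', ← h]
      simp only [th_comp, th_comp_assoc, Category.assoc, Category.id_comp, Category.comp_id]
    · intro A B
      have h := ih.mul A B
      have h' := (gApp_isMon a (ℓ j) (K.flatMap ℓ)).mul A B
      change ((listLax a K).μ _ _ ≫ (tl S K).map ((barLax a ℓ).μ A B)) ≫ gFlat S ℓ _ K =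
        th R (gFlat S ℓ A K) (gFlat S ℓ B K) ≫ (listLax a (K.flatMap ℓ)).μ A B at h
      change (a.x _ _ _ _ ≫ th S ((listLax a (ℓ j)).μ A B) ((listLax a (K.flatMap ℓ)).μ A B)) ≫
          gApp S _ _ _ = th R (gApp S A _ _) (gApp S B _ _) ≫
            (listLax a (ℓ j ++ K.flatMap ℓ)).μ A B at h'
      change ((a.x _ _ _ _ ≫ th S (𝟙 _) ((listLax a K).μ _ _)) ≫
          th S ((listLax a (ℓ j)).μ A B) ((tl S K).map ((barLax a ℓ).μ A B))) ≫
            th S (𝟙 _) (gFlat S ℓ _ K) ≫ gApp S _ _ _ =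
        th R (th S (𝟙 _) (gFlat S ℓ A K) ≫ gApp S A _ _)
            (th S (𝟙 _) (gFlat S ℓ B K) ≫ gApp S B _ _) ≫
          (listLax a (ℓ j ++ K.flatMap ℓ)).μ A B
      rw [← th_comp R, Category.assoc (th R _ _), ← h']
      simp only [Category.assoc]
      rw [reassoc_of% a.x_nat]
      simp only [th_comp_assoc, Category.assoc, Category.id_comp, Category.comp_id, th_id, ← h]

/-! ### Lax monoidal functors and products of lists -/

/-- A power of a functor. -/
abbrev pw (F : D ⥤ E) : (ι → D) ⥤ (ι → E) := Functor.pi fun _ => F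

/-- The arrow from the product of the images by a lax monoidal functor to the image of the
product. -/
def chi {S : MonoidalCategory D} {S' : MonoidalCategory E} {F : D ⥤ E} (l : Lax S S' F)
    (A : ι → D) : ∀ L : List ι, (tl S' L).obj ((pw F).obj A) ⟶ F.obj ((tl S L).obj A)
  | [] => l.ε
  | i :: L => th S' (𝟙 (F.obj (A i))) (chi l A L) ≫ l.μ (A i) ((tl S L).obj A)

/-- The family of arrows `chi` for a family of lists. -/
def chiBar {S : MonoidalCategory D} {S' : MonoidalCategory E} {F : D ⥤ E} (l : Lax S S' F)
    (A : ι → D) (ℓ : κ → List ι) :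
    (barL S' ℓ).obj ((pw F).obj A) ⟶ (pw F).obj ((barL S ℓ).obj A) :=
  fun j => chi l A (ℓ j)

theorem chi_nat {S : MonoidalCategory D} {S' : MonoidalCategory E} {F : D ⥤ E} (l : Lax S S' F)
    {A B : ι → D} (f : A ⟶ B) (L : List ι) :
    (tl S' L).map ((pw F).map f) ≫ chi l B L =
      chi l A L ≫ F.map ((tl S L).map f) := by
  induction L with
  | nil =>
    change 𝟙 _ ≫ l.ε = l.ε ≫ F.map (𝟙 _)
    simp
  | cons i L ih =>
    change th S' (F.map (f i)) ((tl S' L).map ((pw F).map f)) ≫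
        th S' (𝟙 (F.obj (B i))) (chi l B L) ≫ l.μ (B i) _ =
      (th S' (𝟙 (F.obj (A i))) (chi l A L) ≫ l.μ (A i) _) ≫
        F.map (th S (f i) ((tl S L).map f))
    rw [th_comp_assoc, ih, Category.assoc, ← l.μ_nat, th_comp_assoc, Category.comp_id,
      Category.id_comp]

theorem chi_id (S : MonoidalCategory D) (A : ι → D) (L : List ι) :
    chi (Lax.id S) A L = 𝟙 ((tl S L).obj A) := by
  induction L with
  | nil => rfl
  | cons i L ih =>
    change th S (𝟙 (A i)) (chi (Lax.id S) A L) ≫ 𝟙 _ = 𝟙 (ten S (A i) ((tl S L).obj A))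
    rw [ih]
    exact (Category.comp_id _).trans (th_id S _ _)

/-- In the associativity law this splits the passage of a product through two functors into two
successive passages. -/
theorem chi_comp {S : MonoidalCategory D} {S' : MonoidalCategory E} {S'' : MonoidalCategory G}
    {F : D ⥤ E} {H : E ⥤ G} (l : Lax S S' F) (m : Lax S' S'' H) (A : ι → D) (L : List ι) :
    (chi (l.comp m) A L : (tl S'' L).obj ((pw H).obj ((pw F).obj A)) ⟶ _) =
      chi m ((pw F).obj A) L ≫ H.map (chi l A L) := by
  induction L with
  | nil => rfl
  | cons i L ih =>
    refine (congrArg (fun z => th S'' (𝟙 _) z ≫ m.μ _ _ ≫ H.map (l.μ _ _)) ih).trans ?_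
    change th S'' (𝟙 _) (chi m ((pw F).obj A) L ≫ H.map (chi l A L)) ≫ m.μ _ _ ≫
        H.map (l.μ _ _) =
      (th S'' (𝟙 _) (chi m _ L) ≫ m.μ _ _) ≫ H.map (th S' (𝟙 (F.obj (A i))) (chi l A L) ≫ l.μ _ _)
    rw [th_id_comp, H.map_comp, Category.assoc, Category.assoc, ← reassoc_of% m.μ_nat,
      H.map_id]

/-- Monoidal transformations are compatible with `chi`. -/
theorem chi_isMon {S : MonoidalCategory D} {S' : MonoidalCategory E} {F F' : D ⥤ E}
    {l : Lax S S' F} {l' : Lax S S' F'} {η : ∀ A, F.obj A ⟶ F'.obj A} (h : IsMon l l' η)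
    (A : ι → D) (L : List ι) :
    chi l A L ≫ η _ =
      (tl S' L).map (fun i => η (A i) : (pw F).obj A ⟶ (pw F').obj A) ≫
        chi l' A L := by
  induction L with
  | nil => exact h.unit.trans (Category.id_comp _).symm
  | cons i L ih =>
    change (th S' (𝟙 _) (chi l A L) ≫ l.μ _ _) ≫ η _ =
      th S' (η (A i)) ((tl S' L).map _) ≫ th S' (𝟙 _) (chi l' A L) ≫ l'.μ _ _
    rw [Category.assoc, h.mul, th_comp_assoc, th_comp_assoc, ih, Category.comp_id,
      Category.id_comp]
    rfl

/-- `chi` is compatible with concatenation. -/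
theorem chi_gApp {S : MonoidalCategory D} {S' : MonoidalCategory E} {F : D ⥤ E} (l : Lax S S' F)
    (A : ι → D) (L L' : List ι) :
    th S' (chi l A L) (chi l A L') ≫ l.μ _ _ ≫ F.map (gApp S A L L') =
      gApp S' ((pw F).obj A) L L' ≫ chi l A (L ++ L') := by
  induction L with
  | nil =>
    change th S' l.ε (chi l A L') ≫ l.μ _ _ ≫ F.map (lu S _).hom = (lu S' _).hom ≫ chi l A L'
    have e : th S' l.ε (chi l A L') = th S' (𝟙 _) (chi l A L') ≫ th S' l.ε (𝟙 _) := by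
      rw [th_comp, Category.id_comp, Category.comp_id]
    rw [e, Category.assoc, l.left, lu_nat]
  | cons i L ih =>
    change th S' (th S' (𝟙 _) (chi l A L) ≫ l.μ _ _) (chi l A L') ≫ l.μ _ _ ≫
        F.map ((as S (A i) _ _).hom ≫ th S (𝟙 _) (gApp S A L L')) =
      ((as S' _ _ _).hom ≫ th S' (𝟙 _) (gApp S' _ L L')) ≫ th S' (𝟙 (F.obj (A i)))
        (chi l A (L ++ L')) ≫ l.μ _ _
    rw [Category.assoc, th_comp_assoc, ← ih, ← Category.comp_id (chi l A L'), ← th_comp,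
      F.map_comp, Category.assoc, reassoc_of% l.assoc, ← l.μ_nat, Category.comp_id,
      reassoc_of% as_nat]
    simp

/-- `chi` is compatible with `gFlat`. -/
theorem chi_gFlat {S : MonoidalCategory D} {S' : MonoidalCategory E} {F : D ⥤ E} (l : Lax S S' F)
    (ℓ : κ → List ι) (A : ι → D) (K : List κ) :
    (tl S' K).map (chiBar l A ℓ) ≫
      chi l ((barL S ℓ).obj A) K ≫ F.map (gFlat S ℓ A K) =
    gFlat S' ℓ ((pw F).obj A) K ≫ chi l A (K.flatMap ℓ) := by
  induction K with
  | nil =>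
    change 𝟙 _ ≫ l.ε ≫ F.map (𝟙 _) = 𝟙 _ ≫ l.ε
    simp
  | cons j K ih =>
    change th S' (chi l A (ℓ j)) ((tl S' K).map (chiBar l A ℓ)) ≫ (th S' (𝟙 _) (chi l _ K) ≫ l.μ _ _) ≫
        F.map (th S (𝟙 _) (gFlat S ℓ A K) ≫ gApp S A (ℓ j) (K.flatMap ℓ)) =
      (th S' (𝟙 _) (gFlat S' ℓ _ K) ≫ gApp S' _ (ℓ j) (K.flatMap ℓ)) ≫
        chi l A (ℓ j ++ K.flatMap ℓ)
    rw [Category.assoc _ _ (chi l A (ℓ j ++ K.flatMap ℓ)), ← chi_gApp, F.map_comp, Category.assoc,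
      ← reassoc_of% l.μ_nat]
    simp only [th_comp_assoc, F.map_id, Category.comp_id, Category.id_comp, ih]

/-- `chi` is monoidal for a second monoidal structure. -/
theorem chi_double {R S : MonoidalCategory D} {R' S' : MonoidalCategory E} {a : Inter R S}
    {a' : Inter R' S'} {F : D ⥤ E} {r : Lax R R' F} {s : Lax S S' F} (h : Double a a' r s)
    (L : List ι) :
    IsMon ((r.pi ι).comp (listLax a' L)) ((listLax a L).comp r) (fun A => chi s A L) := by
  induction L with
  | nil =>
    constructor
    · change (a'.i0 ≫ 𝟙 _) ≫ s.ε = r.ε ≫ F.map a.i0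
      rw [Category.comp_id, h.nn]
    · intro A B
      change (a'.i2 ≫ 𝟙 _) ≫ s.ε = th R' s.ε s.ε ≫ r.μ _ _ ≫ F.map a.i2
      rw [Category.comp_id, h.nb]
  | cons i L ih =>
    constructor
    · have h' := ih.unit
      change ((listLax a' L).ε ≫ (tl S' L).map (r.pi ι).ε) ≫ chi s _ L =
        r.ε ≫ F.map (listLax a L).ε at h'
      change ((a'.i1 ≫ th S' (𝟙 _) (listLax a' L).ε) ≫ th S' r.ε ((tl S' L).map (r.pi ι).ε)) ≫
        th S' (𝟙 _) (chi s _ L) ≫ s.μ _ _ = r.ε ≫ F.map (a.i1 ≫ th S (𝟙 _) (listLax a L).ε)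
      rw [F.map_comp, ← reassoc_of% h.bn, ← s.μ_nat]
      simp only [th_comp_assoc, Category.comp_id, Category.id_comp, Category.assoc, ← h',
        F.map_id]
    · intro A B
      have h' := ih.mul A B
      change ((listLax a' L).μ _ _ ≫ (tl S' L).map ((r.pi ι).μ A B)) ≫ chi s _ L =
        th R' (chi s A L) (chi s B L) ≫ r.μ _ _ ≫ F.map ((listLax a L).μ A B) at h'
      change ((a'.x _ _ _ _ ≫ th S' (𝟙 _) ((listLax a' L).μ _ _)) ≫
          th S' (r.μ _ _) ((tl S' L).map ((r.pi ι).μ A B))) ≫ th S' (𝟙 _) (chi s _ L) ≫ s.μ _ _ =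
        th R' (th S' (𝟙 _) (chi s A L) ≫ s.μ _ _) (th S' (𝟙 _) (chi s B L) ≫ s.μ _ _) ≫
          r.μ _ _ ≫ F.map (a.x _ _ _ _ ≫ th S (𝟙 _) ((listLax a L).μ A B))
      rw [← th_comp R', F.map_comp, Category.assoc _ _ (r.μ _ _ ≫ _), ← reassoc_of% h.bb,
        ← s.μ_nat, reassoc_of% a'.x_nat]
      simp only [th_comp_assoc, Category.comp_id, Category.id_comp, Category.assoc, F.map_id, th_id]
      exact congrArg (fun z => a'.x _ _ _ _ ≫ th S' (r.μ (A i) (B i)) z ≫ s.μ _ _)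
        ((Category.assoc _ _ _).symm.trans h')

end Lists

/-! ### Arrows that are identities up to equalities of objects -/

section EqHom

variable {D : Type u} [Category.{v} D] {E : Type u} [Category.{v} E]

/-- An arrow that is an identity up to an equality between its source and its target. -/
def IsEqHom {A B : D} (f : A ⟶ B) : Prop := ∃ h : A = B, f = eqToHom h

namespace IsEqHom

theorem id (A : D) : IsEqHom (𝟙 A) := ⟨rfl, rfl⟩

theorem eqToHom {A B : D} (h : A = B) : IsEqHom (eqToHom h) := ⟨h, rfl⟩

theorem comp {A B X : D} {f : A ⟶ B} {g : B ⟶ X} (hf : IsEqHom f) (hg : IsEqHom g) :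
    IsEqHom (f ≫ g) := by
  obtain ⟨rfl, rfl⟩ := hf
  obtain ⟨rfl, rfl⟩ := hg
  exact ⟨rfl, by simp⟩

theorem of_comp {A B X : D} {f : A ⟶ B} {g : B ⟶ X} (h : IsEqHom (f ≫ g)) (hg : IsEqHom g) :
    IsEqHom f := by
  obtain ⟨rfl, rfl⟩ := hg
  simpa using h

theorem inv {A B : D} {e : A ≅ B} (h : IsEqHom e.hom) : IsEqHom e.inv := by
  obtain ⟨h, he⟩ := h
  exact ⟨h.symm, (Iso.inv_ext (f := eqToIso h) (by
    rw [eqToIso.hom, ← he, e.hom_inv_id])).symm⟩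

theorem map {A B : D} {f : A ⟶ B} (h : IsEqHom f) (F : D ⥤ E) : IsEqHom (F.map f) := by
  obtain ⟨rfl, rfl⟩ := h
  exact ⟨rfl, by simp⟩

theorem th {S : MonoidalCategory D} {A A' B B' : D} {f : A ⟶ A'} {g : B ⟶ B'} (hf : IsEqHom f)
    (hg : IsEqHom g) : IsEqHom (th S f g) := by
  obtain ⟨rfl, rfl⟩ := hf
  obtain ⟨rfl, rfl⟩ := hg
  exact ⟨rfl, th_id S A B⟩

/-- Equality proofs are irrelevant, so every coherence question among strict comparisons is settled
here without inspecting the arrows. -/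
theorem ext {A B : D} {f g : A ⟶ B} (hf : IsEqHom f) (hg : IsEqHom g) : f = g := by
  obtain ⟨rfl, rfl⟩ := hf
  obtain ⟨_, rfl⟩ := hg
  rfl

theorem pi {K : Type} {A B : K → D} {f : A ⟶ B} (h : ∀ i, IsEqHom (f i)) : IsEqHom f := by
  have e : A = B := funext fun i => (h i).1
  subst e
  exact ⟨rfl, funext fun i => (h i).ext (IsEqHom.id (A i))⟩

theorem apply {K : Type} {A B : K → D} {f : A ⟶ B} (h : IsEqHom f) (i : K) :
    IsEqHom (f i) := by
  obtain ⟨rfl, rfl⟩ := h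
  exact ⟨rfl, rfl⟩

end IsEqHom

theorem _root_.SMI.IsStrict.as_isEqHom {S : MonoidalCategory D} (h : IsStrict S) (A B X : D) :
    IsEqHom (as S A B X).hom := ⟨_, h.assoc_hom A B X⟩

theorem _root_.SMI.IsStrict.lu_isEqHom {S : MonoidalCategory D} (h : IsStrict S) (A : D) :
    IsEqHom (lu S A).hom := ⟨_, h.leftUnit_hom A⟩

theorem _root_.SMI.IsStrict.ru_isEqHom {S : MonoidalCategory D} (h : IsStrict S) (A : D) :
    IsEqHom (ru S A).hom := ⟨_, h.rightUnit_hom A⟩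

theorem IsStrict.pi {S : MonoidalCategory D} (h : IsStrict S) (K : Type) :
    IsStrict (piMon K S) where
  assoc_obj X Y Z := funext fun i => h.assoc_obj (X i) (Y i) (Z i)
  leftUnit_obj X := funext fun i => h.leftUnit_obj (X i)
  rightUnit_obj X := funext fun i => h.rightUnit_obj (X i)
  assoc_hom X Y Z := IsEqHom.ext
    (IsEqHom.pi (f := (as (piMon K S) X Y Z).hom) fun i => h.as_isEqHom (X i) (Y i) (Z i))
    (IsEqHom.eqToHom _)
  leftUnit_hom X := IsEqHom.ext
    (IsEqHom.pi (f := (lu (piMon K S) X).hom) fun i => h.lu_isEqHom (X i)) (IsEqHom.eqToHom _)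
  rightUnit_hom X := IsEqHom.ext
    (IsEqHom.pi (f := (ru (piMon K S) X).hom) fun i => h.ru_isEqHom (X i)) (IsEqHom.eqToHom _)

variable {ι κ : Type}

theorem gApp_isEqHom {S : MonoidalCategory D} (h : IsStrict S) (A : ι → D) (L L' : List ι) :
    IsEqHom (gApp S A L L') := by
  induction L with
  | nil => exact h.lu_isEqHom _
  | cons i L ih => exact (h.as_isEqHom _ _ _).comp ((IsEqHom.id _).th ih)

theorem gFlat_isEqHom {S : MonoidalCategory D} (h : IsStrict S) (ℓ : κ → List ι) (A : ι → D)
    (K : List κ) : IsEqHom (gFlat S ℓ A K) := by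
  induction K with
  | nil => exact IsEqHom.id _
  | cons j K ih => exact ((IsEqHom.id _).th ih).comp (gApp_isEqHom h A _ _)

end EqHom

/-! ### One step of the iterated reduced bar construction -/

section Step

variable {D₁ : Type u} [Category.{v} D₁] {D₂ : Type u} [Category.{v} D₂]
  {D₃ : Type u} [Category.{v} D₃] {D₄ : Type u} [Category.{v} D₄] {ι κ κ' κ'' : Type}

/-- The comparison of two successive products of lists with the product of the concatenation. -/
def gComp (S : MonoidalCategory D₁) (ℓ : κ → List ι) {K : List κ} {L : List ι}
    (h : L = K.flatMap ℓ) (A : ι → D₁) :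
    (tl S K).obj ((barL S ℓ).obj A) ⟶ (tl S L).obj A :=
  gFlat S ℓ A K ≫ eqToHom (congrArg (fun L => (tl S L).obj A) h.symm)

theorem gComp_rfl (S : MonoidalCategory D₁) (ℓ : κ → List ι) (K : List κ) (A : ι → D₁) :
    gComp S ℓ (K := K) rfl A = gFlat S ℓ A K :=
  Category.comp_id _

theorem gComp_isEqHom {S : MonoidalCategory D₁} (hS : IsStrict S) (ℓ : κ → List ι) {K : List κ}
    {L : List ι} (h : L = K.flatMap ℓ) (A : ι → D₁) : IsEqHom (gComp S ℓ h A) :=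
  (gFlat_isEqHom hS ℓ A K).comp (IsEqHom.eqToHom _)

theorem gComp_nat (S : MonoidalCategory D₁) (ℓ : κ → List ι) {K : List κ} {L : List ι}
    (h : L = K.flatMap ℓ) {A B : ι → D₁} (f : A ⟶ B) :
    (tl S K).map ((barL S ℓ).map f) ≫ gComp S ℓ h B = gComp S ℓ h A ≫ (tl S L).map f := by
  subst h
  rw [gComp_rfl, gComp_rfl, gFlat_nat]

theorem gComp_isMon {R S : MonoidalCategory D₁} (a : Inter R S) (ℓ : κ → List ι) {K : List κ}
    {L : List ι} (h : L = K.flatMap ℓ) :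
    IsMon ((barLax a ℓ).comp (listLax a K)) (listLax a L) (fun A => gComp S ℓ h A) := by
  subst h
  simpa only [gComp_rfl] using gFlat_isMon a ℓ K

theorem chi_gComp {S : MonoidalCategory D₁} {S' : MonoidalCategory D₂} {F : D₁ ⥤ D₂}
    (l : Lax S S' F) (ℓ : κ → List ι) {K : List κ} {L : List ι} (h : L = K.flatMap ℓ)
    (A : ι → D₁) :
    (tl S' K).map (chiBar l A ℓ) ≫ chi l ((barL S ℓ).obj A) K ≫ F.map (gComp S ℓ h A) =
      gComp S' ℓ h ((pw F).obj A) ≫ chi l A L := by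
  subst h
  rw [gComp_rfl, gComp_rfl, chi_gFlat]

/-- The functor given by products of lists, followed by a power of a functor. -/
abbrev step (S : MonoidalCategory D₁) (F : D₁ ⥤ D₂) (ℓ : κ → List ι) : (ι → D₁) ⥤ (κ → D₂) :=
  barL S ℓ ⋙ pw F

/-- The lax monoidal structure on `step`. -/
def stepLax {R S : MonoidalCategory D₁} {R' : MonoidalCategory D₂} (a : Inter R S) {F : D₁ ⥤ D₂}
    (r : Lax R R' F) (ℓ : κ → List ι) : Lax (piMon ι R) (piMon κ R') (step S F ℓ) :=
  (barLax a ℓ).comp (r.pi κ)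

theorem stepDouble {R S T : MonoidalCategory D₁} {R' S' : MonoidalCategory D₂} {a : Inter R S}
    {a' : Inter R' S'} {b : Inter R T} {c : Inter S T} {F : D₁ ⥤ D₂} {r : Lax R R' F}
    {s : Lax S S' F} (h : Hex a b c) (d : Double a a' r s) (ℓ : κ → List ι) :
    Double (a.pi ι) (a'.pi κ) (stepLax b r ℓ) (stepLax c s ℓ) :=
  (barDouble h ℓ).comp (d.pi κ)

/-- The comparison of a composite of two steps with a single one. -/
def stepΩ {S : MonoidalCategory D₁} {S' : MonoidalCategory D₂} {F : D₁ ⥤ D₂} {F' : D₂ ⥤ D₃}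
    {F'' : D₁ ⥤ D₃} (l : Lax S S' F) (ω : ∀ A, F'.obj (F.obj A) ⟶ F''.obj A) {ℓ : κ → List ι}
    {ℓ' : κ' → List κ} {ℓ'' : κ' → List ι} (h : ∀ j, ℓ'' j = (ℓ' j).flatMap ℓ) (A : ι → D₁) :
    (step S' F' ℓ').obj ((step S F ℓ).obj A) ⟶ (step S F'' ℓ'').obj A :=
  fun j => F'.map (chi l ((barL S ℓ).obj A) (ℓ' j)) ≫ ω _ ≫ F''.map (gComp S ℓ (h j) A)

theorem stepΩ_nat {S : MonoidalCategory D₁} {S' : MonoidalCategory D₂} {F : D₁ ⥤ D₂}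
    {F' : D₂ ⥤ D₃} {F'' : D₁ ⥤ D₃} (l : Lax S S' F) {ω : ∀ A, F'.obj (F.obj A) ⟶ F''.obj A}
    (hω : ∀ {A B : D₁} (f : A ⟶ B), F'.map (F.map f) ≫ ω B = ω A ≫ F''.map f)
    {ℓ : κ → List ι} {ℓ' : κ' → List κ} {ℓ'' : κ' → List ι}
    (h : ∀ j, ℓ'' j = (ℓ' j).flatMap ℓ) {A B : ι → D₁} (f : A ⟶ B) :
    (step S' F' ℓ').map ((step S F ℓ).map f) ≫ stepΩ l ω h B =
      stepΩ l ω h A ≫ (step S F'' ℓ'').map f := by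
  funext j
  change F'.map ((tl S' (ℓ' j)).map ((pw F).map ((barL S ℓ).map f))) ≫
      F'.map (chi l _ (ℓ' j)) ≫ ω _ ≫ F''.map (gComp S ℓ (h j) B) =
    (F'.map (chi l _ (ℓ' j)) ≫ ω _ ≫ F''.map (gComp S ℓ (h j) A)) ≫
      F''.map ((tl S (ℓ'' j)).map f)
  rw [← F'.map_comp_assoc, chi_nat, F'.map_comp_assoc, reassoc_of% hω,
    ← F''.map_comp, gComp_nat, F''.map_comp]
  simp only [Category.assoc]

/-- The comparison is composed of three monoidal pieces: `chi` (by `chi_double`, hence the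
hypothesis `d`), `ω`, and concatenation (by `gComp_isMon`). Naturality brings the structure arrows
of each piece into position. -/
theorem stepΩ_isMon {R S : MonoidalCategory D₁} {R' S' : MonoidalCategory D₂}
    {R'' : MonoidalCategory D₃} {a : Inter R S} {a' : Inter R' S'} {F : D₁ ⥤ D₂} {F' : D₂ ⥤ D₃}
    {F'' : D₁ ⥤ D₃} {r : Lax R R' F} {r' : Lax R' R'' F'} {r'' : Lax R R'' F''}
    {l : Lax S S' F} (d : Double a a' r l) {ω : ∀ A, F'.obj (F.obj A) ⟶ F''.obj A}
    (hω : ∀ {A B : D₁} (f : A ⟶ B), F'.map (F.map f) ≫ ω B = ω A ≫ F''.map f)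
    (hm : IsMon (r.comp r') r'' ω) {ℓ : κ → List ι} {ℓ' : κ' → List κ} {ℓ'' : κ' → List ι}
    (h : ∀ j, ℓ'' j = (ℓ' j).flatMap ℓ) :
    IsMon ((stepLax a r ℓ).comp (stepLax a' r' ℓ')) (stepLax a r'' ℓ'') (stepΩ l ω h) := by
  constructor
  · funext j
    have h1 := (chi_double d (ℓ' j)).unit
    have h2 := hm.unit
    have h3 := (gComp_isMon a ℓ (h j)).unit
    have h4 := chi_nat l (barLax a ℓ).ε (ℓ' j)
    change ((listLax a' (ℓ' j)).ε ≫ (tl S' (ℓ' j)).map (r.pi κ).ε) ≫ chi l _ (ℓ' j) =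
      r.ε ≫ F.map (listLax a (ℓ' j)).ε at h1
    change (r'.ε ≫ F'.map r.ε) ≫ ω _ = r''.ε at h2
    change ((listLax a (ℓ' j)).ε ≫ (tl S (ℓ' j)).map (barLax a ℓ).ε) ≫ gComp S ℓ (h j) _ =
      (listLax a (ℓ'' j)).ε at h3
    change ((r'.ε ≫ F'.map (listLax a' (ℓ' j)).ε) ≫
        F'.map ((tl S' (ℓ' j)).map ((r.pi κ).ε ≫ (pw F).map (barLax a ℓ).ε))) ≫
          F'.map (chi l _ (ℓ' j)) ≫ ω _ ≫ F''.map (gComp S ℓ (h j) _) =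
      r''.ε ≫ F''.map (listLax a (ℓ'' j)).ε
    rw [← h3, ← h2, Functor.map_comp (tl S' (ℓ' j))]
    simp only [Category.assoc, ← F'.map_comp_assoc]
    rw [h4, reassoc_of% h1]
    simp only [F'.map_comp, F''.map_comp, Category.assoc, reassoc_of% hω]
  · intro A B
    funext j
    have h1 := (chi_double d (ℓ' j)).mul ((barL S ℓ).obj A) ((barL S ℓ).obj B)
    have h2 := hm.mul ((tl S (ℓ' j)).obj ((barL S ℓ).obj A)) ((tl S (ℓ' j)).obj ((barL S ℓ).obj B))
    have h3 := (gComp_isMon a ℓ (h j)).mul A B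
    have h4 := chi_nat l ((barLax a ℓ).μ A B) (ℓ' j)
    change ((listLax a' (ℓ' j)).μ _ _ ≫ (tl S' (ℓ' j)).map ((r.pi κ).μ _ _)) ≫ chi l _ (ℓ' j) =
      th R' (chi l _ (ℓ' j)) (chi l _ (ℓ' j)) ≫ r.μ _ _ ≫ F.map ((listLax a (ℓ' j)).μ _ _) at h1
    change (r'.μ _ _ ≫ F'.map (r.μ _ _)) ≫ ω _ = th R'' (ω _) (ω _) ≫ r''.μ _ _ at h2
    change ((listLax a (ℓ' j)).μ _ _ ≫ (tl S (ℓ' j)).map ((barLax a ℓ).μ A B)) ≫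
        gComp S ℓ (h j) _ =
      th R (gComp S ℓ (h j) A) (gComp S ℓ (h j) B) ≫ (listLax a (ℓ'' j)).μ A B at h3
    change ((r'.μ _ _ ≫ F'.map ((listLax a' (ℓ' j)).μ _ _)) ≫
        F'.map ((tl S' (ℓ' j)).map ((r.pi κ).μ _ _ ≫ (pw F).map ((barLax a ℓ).μ A B)))) ≫
          F'.map (chi l _ (ℓ' j)) ≫ ω _ ≫ F''.map (gComp S ℓ (h j) _) =
      th R'' (F'.map (chi l _ (ℓ' j)) ≫ ω _ ≫ F''.map (gComp S ℓ (h j) A))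
        (F'.map (chi l _ (ℓ' j)) ≫ ω _ ≫ F''.map (gComp S ℓ (h j) B)) ≫
      r''.μ _ _ ≫ F''.map ((listLax a (ℓ'' j)).μ A B)
    rw [← th_comp, ← th_comp, Category.assoc (th R'' _ _), Category.assoc (th R'' _ _),
      reassoc_of% r''.μ_nat, ← F''.map_comp, ← h3, ← reassoc_of% h2,
      Functor.map_comp (tl S' (ℓ' j))]
    simp only [Category.assoc, ← F'.map_comp_assoc]
    rw [h4, reassoc_of% h1]
    simp only [F'.map_comp, F''.map_comp, Category.assoc, reassoc_of% hω, reassoc_of% r'.μ_nat]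

end Step

/-! ### Associativity and unit laws for the comparison of two steps. -/

section StepLaws

variable {D₁ : Type u} [Category.{v} D₁] {D₂ : Type u} [Category.{v} D₂]
  {D₃ : Type u} [Category.{v} D₃] {D₄ : Type u} [Category.{v} D₄] {ι κ κ' κ'' : Type}

/-- On both sides the arrows of the form `chi` are moved to the front and the concatenations to the
end. The middle is then `hω`, the associativity for the remaining coordinates. -/
theorem stepΩ_assoc {S : MonoidalCategory D₁} {S' : MonoidalCategory D₂} {S'' : MonoidalCategory D₃}
    (hS : IsStrict S) {F : D₁ ⥤ D₂} {F' : D₂ ⥤ D₃} {F'' : D₃ ⥤ D₄} {F₁₂ : D₁ ⥤ D₃}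
    {F₂₃ : D₂ ⥤ D₄} {F₁₂₃ : D₁ ⥤ D₄} {l : Lax S S' F} {l' : Lax S' S'' F'} {l₁₂ : Lax S S'' F₁₂}
    {ω₁₂ : ∀ A, F'.obj (F.obj A) ⟶ F₁₂.obj A} {ω₂₃ : ∀ A, F''.obj (F'.obj A) ⟶ F₂₃.obj A}
    {θ₁₂ : ∀ A, F''.obj (F₁₂.obj A) ⟶ F₁₂₃.obj A} {θ₂₃ : ∀ A, F₂₃.obj (F.obj A) ⟶ F₁₂₃.obj A}
    (m₁₂ : IsMon (l.comp l') l₁₂ ω₁₂)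
    (n₂₃ : ∀ {A B : D₂} (f : A ⟶ B), F''.map (F'.map f) ≫ ω₂₃ B = ω₂₃ A ≫ F₂₃.map f)
    (k₁₂ : ∀ {A B : D₁} (f : A ⟶ B), F''.map (F₁₂.map f) ≫ θ₁₂ B = θ₁₂ A ≫ F₁₂₃.map f)
    (k₂₃ : ∀ {A B : D₁} (f : A ⟶ B), F₂₃.map (F.map f) ≫ θ₂₃ B = θ₂₃ A ≫ F₁₂₃.map f)
    (hω : ∀ A, F''.map (ω₁₂ A) ≫ θ₁₂ A = ω₂₃ (F.obj A) ≫ θ₂₃ A)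
    {ℓ : κ → List ι} {ℓ' : κ' → List κ} {ℓ'' : κ'' → List κ'} {ℓ₁₂ : κ' → List ι}
    {ℓ₂₃ : κ'' → List κ} {ℓ₁₂₃ : κ'' → List ι} (h₁₂ : ∀ j, ℓ₁₂ j = (ℓ' j).flatMap ℓ)
    (h₂₃ : ∀ j, ℓ₂₃ j = (ℓ'' j).flatMap ℓ') (e₁₂ : ∀ j, ℓ₁₂₃ j = (ℓ'' j).flatMap ℓ₁₂)
    (e₂₃ : ∀ j, ℓ₁₂₃ j = (ℓ₂₃ j).flatMap ℓ) (A : ι → D₁) :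
    (step S'' F'' ℓ'').map (stepΩ l ω₁₂ h₁₂ A) ≫ stepΩ l₁₂ θ₁₂ e₁₂ A =
      stepΩ l' ω₂₃ h₂₃ ((step S F ℓ).obj A) ≫ stepΩ l θ₂₃ e₂₃ A := by
  funext j
  let B := (barL S ℓ).obj A
  let B' := (barL S ℓ').obj B
  let w : (pw F').obj ((pw F).obj B') ⟶ (pw F₁₂).obj B' := fun i => ω₁₂ (B' i)
  let γ : B' ⟶ (barL S ℓ₁₂).obj A := fun i => gComp S ℓ (h₁₂ i) A
  have c1 := chi_nat l' (chiBar l B ℓ') (ℓ'' j)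
  -- Monoidality of `ω₁₂` enters here: applying it before or after taking the product gives the same
  -- arrow.
  have c2 : chi l' ((pw F).obj B') (ℓ'' j) ≫ F'.map (chi l B' (ℓ'' j)) ≫ ω₁₂ _ =
      (tl S'' (ℓ'' j)).map w ≫ chi l₁₂ B' (ℓ'' j) := by
    have h := chi_isMon m₁₂ B' (ℓ'' j)
    rw [chi_comp] at h
    rw [← Category.assoc]
    exact h
  have c4 := chi_nat l₁₂ γ (ℓ'' j)
  have c5 := chi_gComp l ℓ' (h₂₃ j) B
  -- The two ways of concatenating three levels of lists agree because in the strict case both are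
  -- identities up to equality of objects.
  have c6 : (tl S (ℓ'' j)).map γ ≫ gComp S ℓ₁₂ (e₁₂ j) A =
      gComp S ℓ' (h₂₃ j) B ≫ gComp S ℓ (e₂₃ j) A :=
    (((IsEqHom.pi fun i => gComp_isEqHom hS _ (h₁₂ i) A).map _).comp
      (gComp_isEqHom hS _ _ A)).ext ((gComp_isEqHom hS _ _ _).comp (gComp_isEqHom hS _ _ A))
  have e1 : (tl S'' (ℓ'' j)).map (stepΩ l ω₁₂ h₁₂ A) =
      (tl S'' (ℓ'' j)).map ((pw F').map (chiBar l B ℓ')) ≫ (tl S'' (ℓ'' j)).map w ≫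
        (tl S'' (ℓ'' j)).map ((pw F₁₂).map γ) :=
    ((tl S'' (ℓ'' j)).map_comp _ (_ ≫ _)).trans
      (congrArg (_ ≫ ·) ((tl S'' (ℓ'' j)).map_comp _ _))
  have e2 : (tl S'' (ℓ'' j)).map (stepΩ l ω₁₂ h₁₂ A) ≫ chi l₁₂ ((barL S ℓ₁₂).obj A) (ℓ'' j) =
      chi l' ((barL S' ℓ').obj ((pw F).obj B)) (ℓ'' j) ≫
        F'.map ((tl S' (ℓ'' j)).map (chiBar l B ℓ')) ≫ F'.map (chi l B' (ℓ'' j)) ≫ ω₁₂ _ ≫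
          F₁₂.map ((tl S (ℓ'' j)).map γ) := by
    rw [e1, Category.assoc, Category.assoc, c4, ← reassoc_of% c2, reassoc_of% c1]
  change F''.map ((tl S'' (ℓ'' j)).map (stepΩ l ω₁₂ h₁₂ A)) ≫
      F''.map (chi l₁₂ ((barL S ℓ₁₂).obj A) (ℓ'' j)) ≫ θ₁₂ _ ≫
        F₁₂₃.map (gComp S ℓ₁₂ (e₁₂ j) A) =
    (F''.map (chi l' ((barL S' ℓ').obj ((pw F).obj B)) (ℓ'' j)) ≫
      ω₂₃ _ ≫ F₂₃.map (gComp S' ℓ' (h₂₃ j) ((pw F).obj B))) ≫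
        F₂₃.map (chi l B (ℓ₂₃ j)) ≫ θ₂₃ _ ≫ F₁₂₃.map (gComp S ℓ (e₂₃ j) A)
  rw [← F''.map_comp_assoc, e2, Category.assoc, Category.assoc, ← F₂₃.map_comp_assoc, ← c5]
  simp only [Functor.map_comp, Category.assoc]
  rw [reassoc_of% k₁₂, ← F₁₂₃.map_comp, c6, reassoc_of% k₂₃, F₁₂₃.map_comp, reassoc_of% hω,
    reassoc_of% n₂₃, reassoc_of% n₂₃]

/-! ### Units -/

/-- The comparison of the product of a singleton with its element. -/
def rComp (S : MonoidalCategory D₁) {L : List ι} {j : ι} (h : L = [j]) (A : ι → D₁) :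
    (tl S L).obj A ⟶ A j :=
  eqToHom (congrArg (fun L => (tl S L).obj A) h) ≫ (ru S (A j)).hom

theorem rComp_rfl (S : MonoidalCategory D₁) (j : ι) (A : ι → D₁) :
    rComp S (j := j) rfl A = (ru S (A j)).hom :=
  Category.id_comp _

theorem rComp_isEqHom {S : MonoidalCategory D₁} (hS : IsStrict S) {L : List ι} {j : ι}
    (h : L = [j]) (A : ι → D₁) : IsEqHom (rComp S h A) :=
  (IsEqHom.eqToHom _).comp (hS.ru_isEqHom _)

theorem rComp_nat (S : MonoidalCategory D₁) {L : List ι} {j : ι} (h : L = [j]) {A B : ι → D₁}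
    (f : A ⟶ B) : (tl S L).map f ≫ rComp S h B = rComp S h A ≫ f j := by
  subst h
  rw [rComp_rfl, rComp_rfl]
  exact ru_nat S (f j)

/-- After the substitution this is the monoidality of the right unitor, `i_ruT` and `x_ruT`. -/
theorem rComp_isMon {R S : MonoidalCategory D₁} (a : Inter R S) {L : List ι} {j : ι}
    (h : L = [j]) : IsMon (listLax a L) (Lax.eval R j) (fun A => rComp S h A) := by
  subst h
  simp only [rComp_rfl]
  constructor
  · change (a.i1 ≫ th S (𝟙 _) a.i0) ≫ (ru S (un R)).hom = 𝟙 _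
    rw [Category.assoc, a.i_ruT]
  · intro A B
    change (a.x _ _ _ _ ≫ th S (𝟙 (ten R (A j) (B j))) a.i2) ≫ (ru S (ten R (A j) (B j))).hom =
      th R (ru S (A j)).hom (ru S (B j)).hom ≫ 𝟙 _
    rw [Category.assoc, a.x_ruT]
    exact (Category.comp_id _).symm

/-- The comparison of a step along singletons with the identity. -/
def stepU (S : MonoidalCategory D₁) {F : D₁ ⥤ D₁} (υ : ∀ A, F.obj A ⟶ A) {ℓ : ι → List ι}
    (h : ∀ j, ℓ j = [j]) (A : ι → D₁) : (step S F ℓ).obj A ⟶ A :=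
  fun j => F.map (rComp S (h j) A) ≫ υ (A j)

theorem stepU_isMon {R S : MonoidalCategory D₁} (a : Inter R S) {F : D₁ ⥤ D₁} {r : Lax R R F}
    {υ : ∀ A, F.obj A ⟶ A} (hm : IsMon r (Lax.id R) υ) {ℓ : ι → List ι} (h : ∀ j, ℓ j = [j]) :
    IsMon (stepLax a r ℓ) (Lax.id (piMon ι R)) (stepU S υ h) := by
  constructor
  · funext j
    have h1 : r.ε ≫ υ (un R) = 𝟙 _ := hm.unit
    have h2 : (listLax a (ℓ j)).ε ≫ rComp S (h j) _ = 𝟙 _ := (rComp_isMon a (h j)).unit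
    change (r.ε ≫ F.map (listLax a (ℓ j)).ε) ≫ F.map (rComp S (h j) (un (piMon ι R))) ≫
      υ (un R) = 𝟙 _
    rw [Category.assoc, ← F.map_comp_assoc, h2]
    exact (congrArg (fun z => r.ε ≫ z ≫ υ (un R)) (F.map_id _)).trans
      ((congrArg (r.ε ≫ ·) (Category.id_comp _)).trans h1)
  · intro A B
    funext j
    have h1 : r.μ _ _ ≫ υ (ten R (A j) (B j)) = th R (υ (A j)) (υ (B j)) ≫ 𝟙 _ :=
      hm.mul (A j) (B j)
    have h2 : (listLax a (ℓ j)).μ A B ≫ rComp S (h j) (ten (piMon ι R) A B) =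
      th R (rComp S (h j) A) (rComp S (h j) B) ≫ 𝟙 _ := (rComp_isMon a (h j)).mul A B
    change (r.μ _ _ ≫ F.map ((listLax a (ℓ j)).μ A B)) ≫ F.map (rComp S (h j) (ten (piMon ι R) A B)) ≫
        υ (ten R (A j) (B j)) =
      th R (F.map (rComp S (h j) A) ≫ υ (A j)) (F.map (rComp S (h j) B) ≫ υ (B j)) ≫ 𝟙 _
    rw [Category.assoc, ← F.map_comp_assoc, h2, Category.comp_id, ← th_comp, Category.assoc,
      ← h1, reassoc_of% r.μ_nat]

theorem stepU_nat (S : MonoidalCategory D₁) {F : D₁ ⥤ D₁} {υ : ∀ A, F.obj A ⟶ A}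
    (hυ : ∀ {A B : D₁} (f : A ⟶ B), F.map f ≫ υ B = υ A ≫ f) {ℓ : ι → List ι}
    (h : ∀ j, ℓ j = [j]) {A B : ι → D₁} (f : A ⟶ B) :
    (step S F ℓ).map f ≫ stepU S υ h B = stepU S υ h A ≫ f := by
  funext j
  change F.map ((tl S (ℓ j)).map f) ≫ F.map (rComp S (h j) B) ≫ υ (B j) =
    (F.map (rComp S (h j) A) ≫ υ (A j)) ≫ f j
  rw [← F.map_comp_assoc, rComp_nat, F.map_comp_assoc, hυ, Category.assoc]

theorem stepU_isEqHom {S : MonoidalCategory D₁} (hS : IsStrict S) {F : D₁ ⥤ D₁}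
    {υ : ∀ A, F.obj A ⟶ A} (hυ : ∀ A, IsEqHom (υ A)) {ℓ : ι → List ι} (h : ∀ j, ℓ j = [j])
    (A : ι → D₁) : IsEqHom (stepU S υ h A) :=
  IsEqHom.pi fun j => ((rComp_isEqHom hS (h j) A).map F).comp (hυ _)

theorem chi_isEqHom {S : MonoidalCategory D₁} {S' : MonoidalCategory D₂} {F : D₁ ⥤ D₂}
    {l : Lax S S' F} (hε : IsEqHom l.ε) (hμ : ∀ A B, IsEqHom (l.μ A B)) (A : ι → D₁)
    (L : List ι) : IsEqHom (chi l A L) := by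
  induction L with
  | nil => exact hε
  | cons i L ih => exact ((IsEqHom.id _).th ih).comp (hμ _ _)

/-- The monoidal transformation `υ` turns `chi l` into `chi` of the identity functor, which is an
identity, and `υ` itself can be cancelled. -/
theorem chi_isEqHom_of_isMon {S : MonoidalCategory D₁} {F : D₁ ⥤ D₁} {l : Lax S S F}
    {υ : ∀ A, F.obj A ⟶ A} (hm : IsMon l (Lax.id S) υ) (hυ : ∀ A, IsEqHom (υ A)) (A : ι → D₁)
    (L : List ι) : IsEqHom (chi l A L) := by
  refine IsEqHom.of_comp (g := υ _) ?_ (hυ _)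
  have h := chi_isMon hm A L
  rw [chi_id] at h
  rw [show chi l A L ≫ υ _ = _ from h]
  exact ((IsEqHom.pi fun i => hυ (A i)).map (tl S L)).comp (IsEqHom.id _)

/-- On a singleton `chi` is `μ` after the unit arrow in the second factor, so the right unit law of
`l` identifies it with a right unitor once `F` of a right unitor is appended. -/
theorem chi_singleton_isEqHom {S : MonoidalCategory D₁} {S' : MonoidalCategory D₂}
    (hS : IsStrict S) (hS' : IsStrict S') {F : D₁ ⥤ D₂} (l : Lax S S' F) (A : ι → D₁) (i : ι) :
    IsEqHom (chi l A [i]) := by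
  refine IsEqHom.of_comp (g := F.map (ru S (A i)).hom) ?_ ((hS.ru_isEqHom _).map F)
  change IsEqHom ((th S' (𝟙 _) l.ε ≫ l.μ _ _) ≫ F.map (ru S (A i)).hom)
  rw [Category.assoc, l.right]
  exact hS'.ru_isEqHom _

theorem stepΩ_isEqHom {S : MonoidalCategory D₁} (hS : IsStrict S) {S' : MonoidalCategory D₂}
    {F : D₁ ⥤ D₂} {F' : D₂ ⥤ D₃} {F'' : D₁ ⥤ D₃} {l : Lax S S' F}
    {ω : ∀ A, F'.obj (F.obj A) ⟶ F''.obj A} (hω : ∀ A, IsEqHom (ω A)) {ℓ : κ → List ι}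
    {ℓ' : κ' → List κ} {ℓ'' : κ' → List ι} (h : ∀ j, ℓ'' j = (ℓ' j).flatMap ℓ) (A : ι → D₁)
    (hchi : ∀ j, IsEqHom (chi l ((barL S ℓ).obj A) (ℓ' j))) : IsEqHom (stepΩ l ω h A) :=
  IsEqHom.pi fun j => ((hchi j).map F').comp
    ((hω _).comp ((gComp_isEqHom hS ℓ (h j) A).map F''))

end StepLaws

/-! ### Interchanges given by symmetries -/

section Symmetry

variable {C : Type u} [Category.{v} C]

section

open MonoidalCategory

/-- The interchange of a braided monoidal structure with itself. -/
def braidedInter [S : MonoidalCategory C] [BraidedCategory C] : Inter S S where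
  x A B A' B' := tensorμ A B A' B'
  i2 := (λ_ (𝟙_ C)).hom
  i1 := (λ_ (𝟙_ C)).inv
  i0 := 𝟙 (𝟙_ C)
  x_nat f g f' g' := tensorμ_natural f g f' g'
  x_assoc A B A' B' A'' B'' := by
    change (tensorμ A B A' B' ⊗ₘ 𝟙 (A'' ⊗ B'')) ≫ tensorμ _ _ _ _ ≫
        ((α_ A A' A'').hom ⊗ₘ (α_ B B' B'').hom) =
      (α_ (A ⊗ B) (A' ⊗ B') (A'' ⊗ B'')).hom ≫ (𝟙 (A ⊗ B) ⊗ₘ tensorμ _ _ _ _) ≫ tensorμ _ _ _ _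
    rw [tensorHom_id, id_tensorHom, tensor_associativity]
  x_left A B := by
    change ((λ_ (𝟙_ C)).inv ⊗ₘ 𝟙 (A ⊗ B)) ≫ tensorμ _ _ _ _ ≫ ((λ_ A).hom ⊗ₘ (λ_ B).hom) =
      (λ_ (A ⊗ B)).hom
    rw [tensorHom_id, tensor_left_unitality]
  x_right A B := by
    change (𝟙 (A ⊗ B) ⊗ₘ (λ_ (𝟙_ C)).inv) ≫ tensorμ _ _ _ _ ≫ ((ρ_ A).hom ⊗ₘ (ρ_ B).hom) =
      (ρ_ (A ⊗ B)).hom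
    rw [id_tensorHom, tensor_right_unitality]
  i_assoc := by
    change ((λ_ (𝟙_ C)).hom ⊗ₘ 𝟙 (𝟙_ C)) ≫ (λ_ (𝟙_ C)).hom =
      (α_ (𝟙_ C) (𝟙_ C) (𝟙_ C)).hom ≫ (𝟙 (𝟙_ C) ⊗ₘ (λ_ (𝟙_ C)).hom) ≫ (λ_ (𝟙_ C)).hom
    monoidal
  i_left := by
    change (𝟙 (𝟙_ C) ⊗ₘ 𝟙 (𝟙_ C)) ≫ (λ_ (𝟙_ C)).hom = (λ_ (𝟙_ C)).hom
    simp
  i_right := by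
    change (𝟙 (𝟙_ C) ⊗ₘ 𝟙 (𝟙_ C)) ≫ (λ_ (𝟙_ C)).hom = (ρ_ (𝟙_ C)).hom
    monoidal
  x_asT A B E A' B' E' := by
    change ((α_ A B E).hom ⊗ₘ (α_ A' B' E').hom) ≫ tensorμ _ _ _ _ ≫
        (𝟙 (A ⊗ A') ⊗ₘ tensorμ _ _ _ _) =
      tensorμ _ _ _ _ ≫ (tensorμ _ _ _ _ ⊗ₘ 𝟙 (E ⊗ E')) ≫ (α_ (A ⊗ A') (B ⊗ B') (E ⊗ E')).hom
    rw [tensorHom_id, id_tensorHom, associator_monoidal]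
  i_asT := by
    change (λ_ (𝟙_ C)).inv ≫ ((λ_ (𝟙_ C)).inv ⊗ₘ 𝟙 (𝟙_ C)) ≫ (α_ (𝟙_ C) (𝟙_ C) (𝟙_ C)).hom =
      (λ_ (𝟙_ C)).inv ≫ (𝟙 (𝟙_ C) ⊗ₘ (λ_ (𝟙_ C)).inv)
    monoidal
  x_luT A B := by
    change tensorμ _ _ _ _ ≫ ((λ_ (𝟙_ C)).hom ⊗ₘ 𝟙 (A ⊗ B)) ≫ (λ_ (A ⊗ B)).hom =
      (λ_ A).hom ⊗ₘ (λ_ B).hom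
    rw [tensorHom_id, leftUnitor_monoidal]
  i_luT := by
    change (λ_ (𝟙_ C)).inv ≫ (𝟙 (𝟙_ C) ⊗ₘ 𝟙 (𝟙_ C)) ≫ (λ_ (𝟙_ C)).hom = 𝟙 (𝟙_ C)
    simp
  x_ruT A B := by
    change tensorμ _ _ _ _ ≫ (𝟙 (A ⊗ B) ⊗ₘ (λ_ (𝟙_ C)).hom) ≫ (ρ_ (A ⊗ B)).hom =
      (ρ_ A).hom ⊗ₘ (ρ_ B).hom
    rw [id_tensorHom, rightUnitor_monoidal]
  i_ruT := by
    change (λ_ (𝟙_ C)).inv ≫ (𝟙 (𝟙_ C) ⊗ₘ 𝟙 (𝟙_ C)) ≫ (ρ_ (𝟙_ C)).hom = 𝟙 (𝟙_ C)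
    monoidal

/-- The componentwise braiding on a product. -/
abbrev prodBraided [MonoidalCategory C] [BraidedCategory C] : BraidedCategory (C × C) where
  braiding X Y := Iso.prod (β_ X.1 Y.1) (β_ X.2 Y.2)

/-- The lax monoidal structure given by an interchange on a tensor product. -/
abbrev Inter.tensorLax {T : MonoidalCategory C} [S : MonoidalCategory C] (b : Inter S T) :
    (@tensor C _ T).LaxMonoidal where
  ε := b.i1
  μ X Y := b.x X.1 X.2 Y.1 Y.2
  μ_natural_left {X Y} f X' := by
    change th T f.1 f.2 ▷ ten T X'.1 X'.2 ≫ b.x _ _ _ _ = b.x _ _ _ _ ≫ th T (f.1 ▷ X'.1) (f.2 ▷ X'.2)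
    have h := b.x_nat f.1 f.2 (𝟙 X'.1) (𝟙 X'.2)
    rw [th_id] at h
    simpa only [tensorHom_id] using h
  μ_natural_right {X Y} X' f := by
    change ten T X'.1 X'.2 ◁ th T f.1 f.2 ≫ b.x _ _ _ _ = b.x _ _ _ _ ≫ th T (X'.1 ◁ f.1) (X'.2 ◁ f.2)
    have h := b.x_nat (𝟙 X'.1) (𝟙 X'.2) f.1 f.2
    rw [th_id] at h
    simpa only [id_tensorHom] using h
  associativity X Y Z := by
    have h := b.x_assoc X.1 X.2 Y.1 Y.2 Z.1 Z.2
    rwa [show th S (b.x X.1 X.2 Y.1 Y.2) (𝟙 (ten T Z.1 Z.2)) = _ from tensorHom_id _ _,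
      show th S (𝟙 (ten T X.1 X.2)) (b.x Y.1 Y.2 Z.1 Z.2) = _ from id_tensorHom _ _] at h
  left_unitality X := by
    have h := b.x_left X.1 X.2
    rw [show th S b.i1 (𝟙 (ten T X.1 X.2)) = _ from tensorHom_id _ _] at h
    exact h.symm
  right_unitality X := by
    have h := b.x_right X.1 X.2
    rw [show th S (𝟙 (ten T X.1 X.2)) b.i1 = _ from id_tensorHom _ _] at h
    exact h.symm

/-- The two copies of `i1` are inserted one after the other, so that the left unit law applies to
the second insertion. The nullary cases of `hex_braidedInter` rest on this and on `Inter.th_i0`. -/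
theorem Inter.th_i1 {S T : MonoidalCategory C} (b : Inter S T) :
    th S b.i1 b.i1 ≫ b.x _ _ _ _ ≫ th T (lu S (un S)).hom (lu S (un S)).hom =
      (lu S (un S)).hom ≫ b.i1 := by
  have e : th S b.i1 b.i1 = th S (𝟙 (un S)) b.i1 ≫ th S b.i1 (𝟙 _) := by simp
  rw [e, Category.assoc, b.x_left, lu_nat]

theorem Inter.th_i0 {S T : MonoidalCategory C} (b : Inter S T) :
    th S b.i0 b.i0 ≫ b.i2 = (lu S (un S)).hom ≫ b.i0 := by
  have e : th S b.i0 b.i0 = th S (𝟙 (un S)) b.i0 ≫ th S b.i0 (𝟙 _) := by simp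
  rw [e, Category.assoc, b.i_left, lu_nat]

/-- A braided interchange is compatible with the braiding. -/
theorem hex_braidedInter {T : MonoidalCategory C} [S : MonoidalCategory C] [BraidedCategory C]
    (b : Inter S T)
    (hx : ∀ A B A' B' : C, (β_ (ten T A B) (ten T A' B')).hom ≫ b.x A' B' A B =
      b.x A B A' B' ≫ th T (β_ A A').hom (β_ B B').hom)
    (hi : (β_ (un T) (un T)).hom ≫ b.i2 = b.i2) : Hex (braidedInter (S := S)) b b where
  x_bb A B E G A' B' E' G' := by
    -- By `hx` the product of `T` is a lax braided functor from `C × C` to `C`; the hexagon is the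
    -- compatibility of such a functor with `tensorμ`, applied to pairs.
    let : BraidedCategory (C × C) := prodBraided
    let := b.tensorLax
    let : (@tensor C _ T).LaxBraided := { braided := fun X Y => (hx X.1 X.2 Y.1 Y.2).symm }
    exact tensorμ_comp_μ_tensorHom_μ_comp_μ (@tensor C _ T) (A, B) (E, G) (A', B') (E', G')
  x_bn := by
    have h := b.th_i1
    have e : th T (lu S (un S)).hom (lu S (un S)).hom ≫
        th T (lu S (un S)).inv (lu S (un S)).inv = 𝟙 _ := by
      rw [th_comp, Iso.hom_inv_id, th_id]
    change (lu S (un S)).inv ≫ th S b.i1 b.i1 ≫ b.x _ _ _ _ =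
      b.i1 ≫ th T (lu S (un S)).inv (lu S (un S)).inv
    rw [Iso.inv_comp_eq, ← reassoc_of% h, e, Category.comp_id]
  x_nb := b.th_i1.symm
  x_nn := (Category.id_comp _).trans ((Category.comp_id _).symm.trans
    (congrArg (b.i1 ≫ ·) (th_id T _ _).symm))
  i_bb := by
    -- The unit of `T` is an `S`-monoid, commutative by `hi`; the required equation is the exchange
    -- of the two middle factors in a product of four.
    let _ : MonObj (un T) :=
      { one := b.i0
        mul := b.i2
        one_mul := (congrArg (· ≫ b.i2) (tensorHom_id _ _)).symm.trans b.i_left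
        mul_one := (congrArg (· ≫ b.i2) (id_tensorHom _ _)).symm.trans b.i_right
        mul_assoc := by
          have h := b.i_assoc
          rwa [show th S b.i2 (𝟙 (un T)) = _ from tensorHom_id _ _,
            show th S (𝟙 (un T)) b.i2 = _ from id_tensorHom _ _] at h }
    have : IsCommMonObj (un T) := ⟨hi⟩
    exact MonObj.mul_mul_mul_comm (un T)
  i_bn := by
    change (lu S (un S)).inv ≫ th S b.i0 b.i0 ≫ b.i2 = b.i0
    rw [b.th_i0, Iso.inv_hom_id_assoc]
  i_nb := b.th_i0.symm
  i_nn := Category.id_comp _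

/-- Symmetry is essential: the braiding of the two products crosses `A` over `B'`, and `tensorμ`
crosses them back. The two crossings cancel only if braiding twice is the identity. -/
theorem braiding_tensorμ [MonoidalCategory C] [SymmetricCategory C] (A B A' B' : C) :
    (β_ (A ⊗ B) (A' ⊗ B')).hom ≫ MonoidalCategory.tensorμ A' B' A B =
      MonoidalCategory.tensorμ A B A' B' ≫ ((β_ A A').hom ⊗ₘ (β_ B B').hom) := by
  simp [MonoidalCategory.tensorμ, SymmetricCategory.braiding_swap_eq_inv_braiding B' A,
    MonoidalCategory.tensorHom_def]

end

end Symmetry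
-- Explicit symmetries.
section Braiding

variable {C : Type u} [Category.{v} C]

/-- The symmetry of a given symmetric monoidal structure. -/
abbrev br (S : MonoidalCategory C) [σ : @SymmetricCategory C _ S] (A B : C) :
    ten S A B ≅ ten S B A :=
  @BraidedCategory.braiding C _ S σ.toBraidedCategory A B

variable (S : MonoidalCategory C) [σ : @SymmetricCategory C _ S]

theorem br_nat {A A' B B' : C} (f : A ⟶ A') (g : B ⟶ B') :
    th S f g ≫ (br S A' B').hom = (br S A B).hom ≫ th S g f :=
  BraidedCategory.braiding_naturality f g

theorem br_br (A B : C) : (br S A B).hom ≫ (br S B A).hom = 𝟙 _ :=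
  SymmetricCategory.symmetry A B

theorem br_lu (A : C) : (br S A (un S)).hom ≫ (lu S A).hom = (ru S A).hom :=
  braiding_leftUnitor A

theorem br_ru (A : C) : (br S (un S) A).hom ≫ (ru S A).hom = (lu S A).hom :=
  braiding_rightUnitor A

end Braiding

/-! ### Interchanges compatible with the symmetry of the second structure. -/

section Cobraided

variable {C : Type u} [Category.{v} C] {S T : MonoidalCategory C}

/-- The interchange of a symmetric monoidal structure with itself. -/
abbrev symInter (T : MonoidalCategory C) [τ : @SymmetricCategory C _ T] : Inter T T :=
  @braidedInter C _ T τ.toBraidedCategory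

/-- The exchange of the first two factors of a triple product. -/
def exch (T : MonoidalCategory C) [τ : @SymmetricCategory C _ T] (B E G : C) :
    ten T B (ten T E G) ⟶ ten T E (ten T B G) :=
  (as T B E G).inv ≫ th T (br T B E).hom (𝟙 G) ≫ (as T E B G).hom

/-- Isolating `exch` between two associators lets the compatibility with `a.x` be checked separately
for the associators and for the exchange. All factors are written with `th`, without whiskering, a
form that arrow terms can also express. -/
theorem symInter_x [τ : @SymmetricCategory C _ T] (A B E G : C) : (symInter T).x A B E G =
    (as T A B (ten T E G)).hom ≫ th T (𝟙 A) (exch T B E G) ≫ (as T A E (ten T B G)).inv := by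
  change MonoidalCategory.tensorμ A B E G = _ ≫ MonoidalCategoryStruct.tensorHom _ _ ≫ _
  rw [MonoidalCategory.id_tensorHom]
  simp only [exch, MonoidalCategory.tensorHom_id, MonoidalCategory.whiskerLeft_comp,
    MonoidalCategory.tensorμ, Category.assoc]

variable (a : Inter S T)

theorem Inter.x_asT_inv (A B E A' B' E' : C) :
    th S (as T A B E).inv (as T A' B' E').inv ≫ a.x _ _ _ _ ≫ th T (a.x A B A' B') (𝟙 _) =
      a.x _ _ _ _ ≫ th T (𝟙 _) (a.x B E B' E') ≫ (as T _ _ _).inv := by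
  have h := a.x_asT A B E A' B' E'
  have e : th S (as T A B E).inv (as T A' B' E').inv ≫
      th S (as T A B E).hom (as T A' B' E').hom = 𝟙 _ := by
    rw [th_comp, Iso.inv_hom_id, Iso.inv_hom_id, th_id]
  rw [← Category.assoc (a.x _ _ _ _), Iso.eq_comp_inv, Category.assoc, Category.assoc, ← h,
    reassoc_of% e]

/-- This is `x_asT` with a product as third factor, followed by the interchange inside that factor;
it handles the outer associators of `symInter_x`. -/
theorem Inter.x_as4 (A B E G A' B' E' G' : C) :
    th S (as T A B (ten T E G)).hom (as T A' B' (ten T E' G')).hom ≫ a.x _ _ _ _ ≫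
        th T (𝟙 _) (a.x _ _ _ _ ≫ th T (𝟙 (ten S B B')) (a.x E G E' G')) =
      a.x _ _ _ _ ≫ th T (a.x A B A' B') (a.x E G E' G') ≫ (as T _ _ _).hom := by
  have h := a.x_asT A B (ten T E G) A' B' (ten T E' G')
  have e : th T (a.x A B A' B') (a.x E G E' G') =
      th T (a.x A B A' B') (𝟙 _) ≫ th T (th T (𝟙 _) (𝟙 _)) (a.x E G E' G') := by
    rw [th_id, th_comp, Category.comp_id, Category.id_comp]
  rw [th_id_comp, reassoc_of% h, e, Category.assoc, as_nat]

theorem Inter.x_as4_inv (A B E G A' B' E' G' : C) :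
    th S (as T A B (ten T E G)).inv (as T A' B' (ten T E' G')).inv ≫ a.x _ _ _ _ ≫
        th T (a.x A B A' B') (a.x E G E' G') =
      a.x _ _ _ _ ≫ th T (𝟙 _) (a.x _ _ _ _ ≫ th T (𝟙 (ten S B B')) (a.x E G E' G')) ≫
        (as T _ _ _).inv := by
  have h := a.x_as4 A B E G A' B' E' G'
  have e : th S (as T A B (ten T E G)).inv (as T A' B' (ten T E' G')).inv ≫
      th S (as T A B (ten T E G)).hom (as T A' B' (ten T E' G')).hom = 𝟙 _ := by
    rw [th_comp, Iso.inv_hom_id, Iso.inv_hom_id, th_id]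
  rw [← Category.assoc (a.x _ _ _ _), Iso.eq_comp_inv, Category.assoc, Category.assoc, ← h,
    reassoc_of% e]

theorem Inter.i1_as4 :
    a.i1 ≫ th T a.i1 a.i1 ≫ (as T _ _ _).hom =
      a.i1 ≫ th T (𝟙 _) (a.i1 ≫ th T (𝟙 _) a.i1) := by
  have h := a.i_asT
  have e : th T a.i1 a.i1 = th T a.i1 (𝟙 _) ≫ th T (th T (𝟙 _) (𝟙 _)) a.i1 := by
    rw [th_id, th_comp, Category.comp_id, Category.id_comp]
  rw [th_id_comp, ← reassoc_of% h, e, Category.assoc, as_nat]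

variable [τ : @SymmetricCategory C _ T]

/-- The three factors of `exch` are treated in turn by `x_asT_inv`, `hx` and `x_asT`. -/
theorem Inter.x_exch (hx : ∀ A B A' B' : C, th S (br T A B).hom (br T A' B').hom ≫ a.x B A B' A' =
      a.x A B A' B' ≫ (br T (ten S A A') (ten S B B')).hom) (B E G B' E' G' : C) :
    th S (exch T B E G) (exch T B' E' G') ≫ a.x _ _ _ _ ≫ th T (𝟙 _) (a.x B G B' G') =
      a.x _ _ _ _ ≫ th T (𝟙 _) (a.x E G E' G') ≫ exch T _ _ _ := by
  have h1 := a.x_asT E B G E' B' G'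
  have h2 := a.x_asT_inv B E G B' E' G'
  rw [exch, exch, exch, ← th_comp, ← th_comp, Category.assoc, Category.assoc, h1,
    reassoc_of% a.x_nat, th_comp_assoc, hx, th_id, Category.comp_id, ← reassoc_of% h2,
    th_comp_assoc, Category.id_comp]

theorem Inter.i1_exch (hi : a.i1 ≫ (br T (un S) (un S)).hom = a.i1) :
    a.i1 ≫ th T (𝟙 _) a.i1 ≫ exch T _ _ _ = a.i1 ≫ th T (𝟙 _) a.i1 := by
  have h := a.i_asT
  have h' : a.i1 ≫ th T (𝟙 _) a.i1 ≫ (as T _ _ _).inv = a.i1 ≫ th T a.i1 (𝟙 _) := by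
    rw [← Category.assoc, Iso.comp_inv_eq, Category.assoc, h]
  rw [exch, reassoc_of% h', th_comp_assoc, hi, Category.comp_id, h]

/-- An interchange that commutes with a symmetry of the second monoidal structure is compatible
with this symmetry. -/
theorem hex_symInter
    (hx : ∀ A B A' B' : C, th S (br T A B).hom (br T A' B').hom ≫ a.x B A B' A' =
      a.x A B A' B' ≫ (br T (ten S A A') (ten S B B')).hom)
    (hi : a.i1 ≫ (br T (un S) (un S)).hom = a.i1) : Hex a a (symInter T) where
  x_bb A B E G A' B' E' G' := by
    have h1 := a.x_as4 A B E G A' B' E' G'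
    have h2 := a.x_as4_inv A E B G A' E' B' G'
    rw [symInter_x, symInter_x, symInter_x, ← th_comp, ← th_comp, Category.assoc, Category.assoc,
      h2, reassoc_of% a.x_nat, th_comp_assoc, a.x_exch hx, th_id, Category.comp_id,
      ← reassoc_of% h1, th_comp_assoc, Category.id_comp, Category.assoc]
  x_bn := by
    have h1 := a.i1_as4
    rw [symInter_x, reassoc_of% h1, th_comp_assoc, Category.comp_id, Category.assoc,
      a.i1_exch hi, ← reassoc_of% h1, Iso.hom_inv_id, Category.comp_id]
  x_nb := by
    have h := a.x_luT (un T) (un T)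
    change a.i2 ≫ (lu T (un T)).inv = th S (lu T (un T)).inv (lu T (un T)).inv ≫ _ ≫ _
    have e : th T a.i2 a.i2 = th T a.i2 (𝟙 _) ≫ th T (𝟙 _) a.i2 := by
      rw [th_comp, Category.comp_id, Category.id_comp]
    have e' : th S (lu T (un T)).inv (lu T (un T)).inv ≫
        th S (lu T (un T)).hom (lu T (un T)).hom = 𝟙 _ := by
      rw [th_comp, Iso.inv_hom_id, th_id]
    rw [Iso.comp_inv_eq, Category.assoc, Category.assoc, e, Category.assoc, lu_nat, reassoc_of% h,
      reassoc_of% e']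
  x_nn := by
    have h := a.i_luT
    change a.i0 ≫ (lu T (un T)).inv = _
    have e : th T a.i0 a.i0 = th T a.i0 (𝟙 _) ≫ th T (𝟙 _) a.i0 := by
      rw [th_comp, Category.comp_id, Category.id_comp]
    rw [Iso.comp_inv_eq, Category.assoc, e, Category.assoc, lu_nat, reassoc_of% h]
  i_bb := by
    have h := a.x_luT (un T) (un T)
    have e : th T a.i2 a.i2 = th T a.i2 (𝟙 _) ≫ th T (𝟙 _) a.i2 := by
      rw [th_comp, Category.comp_id, Category.id_comp]
    change _ ≫ _ ≫ (lu T (un T)).hom = th S (lu T (un T)).hom (lu T (un T)).hom ≫ _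
    rw [e, Category.assoc, lu_nat, reassoc_of% h]
  i_bn := by
    have h := a.i_luT
    have e : th T a.i0 a.i0 = th T a.i0 (𝟙 _) ≫ th T (𝟙 _) a.i0 := by
      rw [th_comp, Category.comp_id, Category.id_comp]
    change _ ≫ _ ≫ (lu T (un T)).hom = _
    rw [e, Category.assoc, lu_nat, reassoc_of% h]
  i_nb := (Category.comp_id _).trans ((Category.id_comp _).symm.trans
    (congrArg (· ≫ a.i2) (th_id S _ _).symm))
  i_nn := Category.comp_id _

end Cobraided

theorem hex_symInter_self {C : Type u} [Category.{v} C] (T : MonoidalCategory C) [τ : @SymmetricCategory C _ T] : Hex (symInter T) (symInter T) (symInter T) :=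
  letI := T
  hex_braidedInter _ braiding_tensorμ (braiding_leftUnitor _ |>.trans
    (MonoidalCategory.unitors_equal (C := C)).symm)

/-! ### The interchanges of an SMI category and their hexagons. -/

section Intermuting

variable {C : Type u} [Category.{v} C] [SMICategory C]

open SMICategory

attribute [local instance] BiSymmetric.veeSymm BiSymmetric.wedgeSymm

/-- The monoidal structure given by `∨` and `⊥`. -/
local notation "V" => BiSymmetric.veeMon (C := C)
/-- The monoidal structure given by `∧` and `⊤`. -/
local notation "W" => BiSymmetric.wedgeMon (C := C)

theorem br_ck (A B A' B' : C) : (br V (A ∧ₒ B) (A' ∧ₒ B')).hom ≫ ck A' B' A B =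
    ck A B A' B' ≫ th W (br V A A').hom (br V B B').hom :=
  eq4 A A' B B'

theorem ck_br (A B A' B' : C) :
    th V (br W A B).hom (br W A' B').hom ≫ ck B A B' A' =
      ck A B A' B' ≫ (br W (A ∨ₒ A') (B ∨ₒ B')).hom :=
  eq3 A B A' B'

theorem br_top : (br V (top : C) top).hom = 𝟙 _ :=
  (eq12 (C := C)).trans (Iso.hom_inv_id _)

theorem br_bot : (br W (bot : C) bot).hom = 𝟙 _ :=
  (eq13 (C := C)).trans (Iso.inv_hom_id _)

theorem ck_right (A B : C) : th V (𝟙 (A ∧ₒ B)) wBot.hom ≫ ck A B bot bot ≫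
    th W (ru V A).hom (ru V B).hom = (ru V (A ∧ₒ B)).hom := by
  rw [eq5]
  simp only [Category.assoc, th_comp_assoc, th_comp, Iso.hom_inv_id, Iso.inv_hom_id, th_id,
    Category.comp_id, Category.id_comp]

theorem ck_ruT (A B : C) : ck A top B top ≫ th W (𝟙 (A ∨ₒ B)) wTop.hom ≫ (ru W (A ∨ₒ B)).hom =
    th V (ru W A).hom (ru W B).hom := by
  rw [eq6]
  simp only [Category.assoc, th_comp_assoc, Iso.inv_hom_id, th_id, Category.comp_id,
    Category.id_comp]

theorem kappa_right : th V (𝟙 (top : C)) kappa ≫ wTop.hom = (ru V (top : C)).hom := by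
  rw [show th V (𝟙 (top : C)) kappa = _ from eq9]
  simp

theorem kappa_ruT : wBot.hom ≫ th W (𝟙 (bot : C)) kappa ≫ (ru W (bot : C)).hom = 𝟙 _ := by
  rw [show th W (𝟙 (bot : C)) kappa = _ from eq10]
  simp

/-- Intermutation is an interchange. -/
def smiInter : Inter V W where
  x A B A' B' := ck A B A' B'
  i2 := wTop.hom
  i1 := wBot.hom
  i0 := kappa
  x_nat f g f' g' := ck_natural f g f' g'
  x_assoc A B A' B' A'' B'' := by
    have h := eq2 A A' A'' B B' B''
    rw [← Iso.inv_comp_eq]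
    have h' := congrArg (· ≫ th W (as V A A' A'').hom (as V B B' B'').hom) h
    simp only [Category.assoc] at h'
    refine h'.trans ?_
    have e : th W (as V A A' A'').inv (as V B B' B'').inv ≫
      th W (as V A A' A'').hom (as V B B' B'').hom = 𝟙 _ := by simp
    exact congrArg (fun z => _ ≫ _ ≫ z) e |>.trans (by rw [Category.comp_id])
  -- The SMI equations give only the right unit law; conjugation with the symmetry of `∨`, which
  -- intermutation respects by `eq4`, yields the left one.
  x_left A B := by
    have h := br_ck (bot : C) bot A B
    have e : th V wBot.hom (𝟙 (A ∧ₒ B)) ≫ (br V _ _).hom = (br V _ _).hom ≫ th V (𝟙 _) wBot.hom :=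
      br_nat V _ _
    have k := ck_right A B
    rw [← br_ru V (A ∧ₒ B), ← k, ← reassoc_of% e, reassoc_of% h, th_comp, br_ru, br_ru]
  x_right A B := ck_right A B
  i_assoc := by
    have h := eq7 (C := C)
    rw [← Iso.inv_comp_eq]
    refine (congrArg (· ≫ th V wTop.hom (𝟙 (top : C)) ≫ wTop.hom) h).trans ?_
    change (th V _ _ ≫ th V _ _) ≫ th V _ _ ≫ _ = th V _ _ ≫ _
    rw [Category.assoc, th_comp_assoc, th_comp_assoc, Category.id_comp, Category.comp_id,
      Iso.inv_hom_id, Category.comp_id]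
  -- The symmetry of `⊤ ∨ ⊤` is the identity by `eq12`, so the two unit laws of the monoid `⊤`
  -- follow from one another.
  i_left := by
    have h := br_nat V (kappa : (bot : C) ⟶ top) (𝟙 (top : C))
    rw [br_top, Category.comp_id] at h
    rw [h, Category.assoc, kappa_right, br_ru]
  i_right := kappa_right
  x_asT A B E A' B' E' := by
    have h := eq1 A B E A' B' E'
    have e : th V (as W A B E).hom (as W A' B' E').hom ≫
        ((wedgeB A B E).hom ∨ₕ (wedgeB A' B' E').hom) = 𝟙 _ := by
      change th V _ _ ≫ th V (as W A B E).inv (as W A' B' E').inv = _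
      rw [th_comp, Iso.hom_inv_id, Iso.hom_inv_id, th_id]
    have h' := congrArg (th V (as W A B E).hom (as W A' B' E').hom ≫ ·) h
    beta_reduce at h'
    rw [reassoc_of% e] at h'
    rw [← Category.assoc, ← Category.assoc (ck _ _ _ _), ← Iso.comp_inv_eq, Category.assoc,
      Category.assoc]
    exact h'.symm
  i_asT := by
    have h := eq8 (C := C)
    rw [← Category.assoc, ← Iso.eq_comp_inv, Category.assoc]
    refine Eq.trans ?_ (congrArg (fun z => wBot.hom ≫ th W (𝟙 (bot : C)) wBot.hom ≫ z) h).symm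
    change _ = _ ≫ th W _ _ ≫ th W _ _ ≫ th W _ _
    rw [th_comp_assoc, Iso.hom_inv_id, Category.comp_id, th_id, Category.id_comp]
  -- The right-hand version is conjugated with the symmetry of `∧`, using `eq3`.
  x_luT A B := by
    have h := ck_br A top B top
    have k := ck_ruT A B
    have e : th W (𝟙 (A ∨ₒ B)) wTop.hom ≫ (br W _ _).hom = (br W _ _).hom ≫ th W wTop.hom (𝟙 _) :=
      br_nat W _ _
    have hl : th V (lu W A).hom (lu W B).hom =
        th V (br W top A).hom (br W top B).hom ≫ th V (ru W A).hom (ru W B).hom := by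
      rw [th_comp, br_ru, br_ru]
    have hr : (ru W (A ∨ₒ B)).hom = (br W _ _).hom ≫ (lu W (A ∨ₒ B)).hom := (br_lu W _).symm
    rw [hl, ← k, hr, reassoc_of% e, ← reassoc_of% h, th_comp_assoc, br_br, br_br, th_id,
      Category.id_comp]
  i_luT := by
    have h := br_nat W (𝟙 (bot : C)) (kappa : (bot : C) ⟶ top)
    rw [br_bot, Category.id_comp] at h
    rw [← h, Category.assoc, br_lu, kappa_ruT]
  x_ruT A B := ck_ruT A B
  i_ruT := kappa_ruT

/-- The two monoidal structures. -/
@[reducible] def smiMon (C : Type u) [Category.{v} C] [SMICategory C] : Bool → MonoidalCategory C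
  | false => BiSymmetric.veeMon
  | true => BiSymmetric.wedgeMon

/-- The interchanges of the two monoidal structures. -/
def smiInterLe (C : Type u) [Category.{v} C] [SMICategory C] :
    ∀ {k k' : Bool}, k ≤ k' → Inter (smiMon C k) (smiMon C k')
  | false, false, _ => symInter BiSymmetric.veeMon
  | false, true, _ => smiInter
  | true, true, _ => symInter BiSymmetric.wedgeMon
  | true, false, h => absurd h (by decide)

/-- When the first two structures are `∨` and the third is `∧`, the hexagon expresses the
compatibility of intermutation with the symmetry of `∨` (`eq4`, `eq12`). When the last two are `∧`
and the first is `∨`, it is the compatibility with the symmetry of `∧` (`eq3`, `eq13`). Three equal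
structures need only their own symmetry. -/
theorem smiHex (C : Type u) [Category.{v} C] [SMICategory C] :
    ∀ {k k' k'' : Bool} (h : k ≤ k') (h' : k' ≤ k''),
      Hex (smiInterLe C h) (smiInterLe C (h.trans h')) (smiInterLe C h')
  | false, false, false, _, _ => hex_symInter_self BiSymmetric.veeMon
  | false, false, true, _, _ =>
    letI := BiSymmetric.veeMon (C := C)
    hex_braidedInter smiInter br_ck ((congrArg (· ≫ _) br_top).trans (Category.id_comp _))
  | false, true, true, _, _ =>
    hex_symInter smiInter ck_br ((congrArg (_ ≫ ·) br_bot).trans (Category.comp_id _))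
  | true, true, true, _, _ => hex_symInter_self BiSymmetric.wedgeMon
  | true, false, _, h, _ => absurd h (by decide)
  | _, true, false, _, h => absurd h (by decide)

theorem smiMon_isStrict (C : Type u) [Category.{v} C] [StrictSMICategory C] :
    ∀ k : Bool, IsStrict (smiMon C k)
  | false => StrictSMICategory.vee_strict
  | true => StrictSMICategory.wedge_strict

end Intermuting

/-! ### Fibres of composites and of identities in the simplicial category. -/

section Fibres

variable {k l j : SimplexCategoryᵒᵖ}

/-- By monotonicity the `x` whose image is below `y` form an initial segment, and membership in an
initial segment is comparison with its cardinality. This Galois connection makes `dual` functorial.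
-/
theorem lt_dual_iff (f : k ⟶ l) (x : Fin (l.unop.len + 1)) (y : ℕ) :
    (x : ℕ) < dual f y ↔ (f.unop.toOrderHom x : ℕ) < y := by
  have hm : ∀ a b : Fin (l.unop.len + 1), a ≤ b →
      (f.unop.toOrderHom a : ℕ) ≤ f.unop.toOrderHom b := fun a b h => f.unop.toOrderHom.monotone h
  constructor
  · intro h
    by_contra hx
    have : (Finset.univ.filter fun z : Fin (l.unop.len + 1) => (f.unop.toOrderHom z : ℕ) < y) ⊆
        Finset.Iio x := by
      intro z hz
      rw [Finset.mem_filter] at hz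
      rw [Finset.mem_Iio]
      by_contra hzx
      exact hx ((hm x z (not_lt.mp hzx)).trans_lt hz.2)
    have := Finset.card_le_card this
    rw [Fin.card_Iio] at this
    exact absurd h (not_lt.mpr this)
  · intro h
    have : Finset.Iic x ⊆
        (Finset.univ.filter fun z : Fin (l.unop.len + 1) => (f.unop.toOrderHom z : ℕ) < y) := by
      intro z hz
      rw [Finset.mem_Iic] at hz
      exact Finset.mem_filter.mpr ⟨Finset.mem_univ _, (hm z x hz).trans_lt h⟩
    have := Finset.card_le_card this
    rw [Fin.card_Iic] at this
    exact this

theorem dual_mono (f : k ⟶ l) : Monotone (dual f) := fun _ _ h =>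
  Finset.card_le_card (Finset.monotone_filter_right _ fun _ _ hz => lt_of_lt_of_le hz h)

theorem dual_comp (f : k ⟶ l) (g : l ⟶ j) (y : ℕ) : dual (f ≫ g) y = dual g (dual f y) :=
  congrArg Finset.card (Finset.filter_congr fun x _ => (lt_dual_iff f _ y).symm)

theorem dual_zero (f : k ⟶ l) : dual f 0 = 0 := by simp [dual]

theorem dual_of_lt (f : k ⟶ l) {y : ℕ} (h : k.unop.len < y) : dual f y = l.unop.len + 1 := by
  rw [dual, Finset.filter_true_of_mem fun x _ =>
    lt_of_lt_of_le (f.unop.toOrderHom x).isLt h, Finset.card_univ, Fintype.card_fin]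

theorem dual_id_apply {y : ℕ} (h : y ≤ k.unop.len) : dual (𝟙 k) y = y := by
  refine le_antisymm ?_ ?_
  · by_contra hy
    exact absurd ((lt_dual_iff (𝟙 k) ⟨y, Nat.lt_succ_of_le h⟩ y).mp (not_le.mp hy)) (lt_irrefl y)
  · rcases y with _ | y
    · exact Nat.zero_le _
    · exact (lt_dual_iff (𝟙 k) ⟨y, by omega⟩ (y + 1)).mpr (Nat.lt_succ_self y)

theorem mem_fibre (f : k ⟶ l) (b : Fin l.unop.len) (a : Fin k.unop.len) :
    a ∈ fibre f b ↔ dual f (a + 1) = b + 1 := by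
  simp [fibre]

theorem fibre_sorted (f : k ⟶ l) (b : Fin l.unop.len) : (fibre f b).Pairwise (· < ·) :=
  (List.pairwise_lt_finRange _).filter _

/-- Both lists are strictly increasing, so it suffices that they have the same members, and this is
functoriality of `dual`. -/
theorem fibre_comp (f : k ⟶ l) (g : l ⟶ j) (c : Fin j.unop.len) :
    fibre (f ≫ g) c = (fibre g c).flatMap (fibre f) := by
  refine (fibre_sorted _ _).eq_of_mem_iff ?_ fun a => ?_
  · refine List.pairwise_flatMap.mpr ⟨fun b _ => fibre_sorted f b, ?_⟩
    refine (fibre_sorted g c).imp fun {b b'} hb x hx y hy => ?_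
    rw [mem_fibre] at hx hy
    by_contra hxy
    have := dual_mono f (Nat.succ_le_succ (not_lt.mp hxy))
    rw [Nat.succ_eq_add_one, Nat.succ_eq_add_one, hx, hy] at this
    exact absurd (Fin.lt_def.mp hb) (by omega)
  · rw [mem_fibre, dual_comp, List.mem_flatMap]
    simp only [mem_fibre]
    constructor
    · intro h
      -- The intermediate position must lie in `1, …, l`: the endpoints `0` and `l + 1` are sent by
      -- `dual g` to endpoints, hence never to `c + 1`.
      have h0 : dual f (a + 1) ≠ 0 := fun h' => by rw [h', dual_zero] at h; omega
      have h1 : ¬ l.unop.len < dual f (a + 1) := fun h' => by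
        rw [dual_of_lt g h'] at h
        exact absurd c.isLt (by omega)
      refine ⟨⟨dual f (a + 1) - 1, by omega⟩, ?_, ?_⟩
      · rw [Nat.sub_add_cancel (Nat.pos_of_ne_zero h0), h]
      · exact (Nat.sub_add_cancel (Nat.pos_of_ne_zero h0)).symm
    · rintro ⟨b, hb, hab⟩
      rw [hab, hb]

theorem fibre_id (b : Fin k.unop.len) : fibre (𝟙 k) b = [b] := by
  refine (fibre_sorted _ _).eq_of_mem_iff (List.pairwise_singleton _ _) fun a => ?_
  rw [mem_fibre, dual_id_apply a.isLt, List.mem_singleton, Fin.ext_iff]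
  omega

end Fibres

/-! ### Currying -/

section Curry

variable {C : Type u} [Category.{v} C] {N : ℕ} {k l j : Fin (N + 1) → SimplexCategoryᵒᵖ}

/-- The tail of a tuple of objects. -/
abbrev tailObj (k : Fin (N + 1) → SimplexCategoryᵒᵖ) : Fin N → SimplexCategoryᵒᵖ :=
  fun i => k i.succ

/-- The tail of a tuple of arrows. -/
abbrev tailHom (f : k ⟶ l) : tailObj k ⟶ tailObj l := fun i => f i.succ

/-- A functor between iterated powers, regarded as a functor between powers. -/
abbrev conj (F : (Fin (k 0).unop.len → MultiIndex (tailObj k) → C) ⥤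
    (Fin (l 0).unop.len → MultiIndex (tailObj l) → C)) : (MultiIndex k → C) ⥤ (MultiIndex l → C) :=
  curryPower C k ⋙ F ⋙ uncurryPower C l

variable {F : (Fin (k 0).unop.len → MultiIndex (tailObj k) → C) ⥤
    (Fin (l 0).unop.len → MultiIndex (tailObj l) → C)}
  {F' : (Fin (l 0).unop.len → MultiIndex (tailObj l) → C) ⥤
    (Fin (j 0).unop.len → MultiIndex (tailObj j) → C)}
  {F'' : (Fin (k 0).unop.len → MultiIndex (tailObj k) → C) ⥤
    (Fin (j 0).unop.len → MultiIndex (tailObj j) → C)}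

/-- The monoidal structure of an iterated power. -/
abbrev piMon₂ (k : Fin (N + 1) → SimplexCategoryᵒᵖ) (S : MonoidalCategory C) :
    MonoidalCategory (Fin (k 0).unop.len → MultiIndex (tailObj k) → C) :=
  piMon (Fin (k 0).unop.len) (piMon (MultiIndex (tailObj k)) S)

/-- The lax monoidal structure on `conj`. -/
def Lax.conj {S S' : MonoidalCategory C} (r : Lax (piMon₂ k S) (piMon₂ l S') F) :
    Lax (piMon (MultiIndex k) S) (piMon (MultiIndex l) S') (SMI.conj F) where
  ε := (uncurryPower C l).map r.ε
  μ A B := (uncurryPower C l).map (r.μ ((curryPower C k).obj A) ((curryPower C k).obj B))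
  μ_nat f g := funext fun α => congrFun (congrFun
    (r.μ_nat ((curryPower C k).map f) ((curryPower C k).map g)) (α 0)) fun i => α i.succ
  assoc A B X := funext fun α => congrFun (congrFun (r.assoc ((curryPower C k).obj A)
    ((curryPower C k).obj B) ((curryPower C k).obj X)) (α 0)) fun i => α i.succ
  left A := funext fun α => congrFun (congrFun
    (r.left ((curryPower C k).obj A)) (α 0)) fun i => α i.succ
  right A := funext fun α => congrFun (congrFun
    (r.right ((curryPower C k).obj A)) (α 0)) fun i => α i.succ

theorem Double.conj {R S R' S' : MonoidalCategory C} {a : Inter R S} {a' : Inter R' S'}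
    {r : Lax (piMon₂ k R) (piMon₂ l R') F} {s : Lax (piMon₂ k S) (piMon₂ l S') F}
    (h : Double ((a.pi (MultiIndex (tailObj k))).pi _) ((a'.pi (MultiIndex (tailObj l))).pi _) r s) :
    Double (a.pi (MultiIndex k)) (a'.pi (MultiIndex l)) r.conj s.conj where
  bb A B A' B' := funext fun α => congrFun (congrFun (h.bb ((curryPower C k).obj A)
    ((curryPower C k).obj B) ((curryPower C k).obj A') ((curryPower C k).obj B')) (α 0))
      fun i => α i.succ
  bn := funext fun α => congrFun (congrFun h.bn (α 0)) fun i => α i.succ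
  nb := funext fun α => congrFun (congrFun h.nb (α 0)) fun i => α i.succ
  nn := funext fun α => congrFun (congrFun h.nn (α 0)) fun i => α i.succ

/-- Uncurrying followed by currying is the identity definitionally, since `Fin.cons` computes at `0`
and at successors. The composite of two conjugated functors is therefore the conjugate of the
composite, and the laws hold coordinate by coordinate. -/
theorem IsMon.conj {S S' S'' : MonoidalCategory C} {r : Lax (piMon₂ k S) (piMon₂ l S') F}
    {r' : Lax (piMon₂ l S') (piMon₂ j S'') F'} {r'' : Lax (piMon₂ k S) (piMon₂ j S'') F''}
    {η : ∀ A, F'.obj (F.obj A) ⟶ F''.obj A} (h : IsMon (r.comp r') r'' η) :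
    IsMon (r.conj.comp r'.conj) r''.conj
      (fun A => (uncurryPower C j).map (η ((curryPower C k).obj A))) where
  unit := funext fun α => congrFun (congrFun h.unit (α 0)) fun i => α i.succ
  mul A B := funext fun α => congrFun (congrFun (h.mul ((curryPower C k).obj A)
    ((curryPower C k).obj B)) (α 0)) fun i => α i.succ

end Curry

/-! ### The iterated reduced bar construction -/

section Iteration

variable {C : Type u} [Category.{v} C] [StrictSMICategory C]

variable (C) in
/-- The reduced bar construction iterated along one of the two monoidal structures for each
coordinate. -/
abbrev smiBar {N : ℕ} (κ : Fin N → Bool) {k l : Fin N → SimplexCategoryᵒᵖ} (f : k ⟶ l) :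
    (MultiIndex k → C) ⥤ (MultiIndex l → C) :=
  iteratedBar C (fun i => smiMon C (κ i)) f

/-- The lax monoidal structures on `smiBar`. -/
def iterLax (b : Bool) : ∀ {N : ℕ} (κ : Fin N → Bool) (_ : ∀ i, b ≤ κ i)
    {k l : Fin N → SimplexCategoryᵒᵖ} (f : k ⟶ l),
    Lax (piMon (MultiIndex k) (smiMon C b)) (piMon (MultiIndex l) (smiMon C b)) (smiBar C κ f)
  | 0, _, _, k, l, _ =>
    Lax.pi' fun _ : MultiIndex l => Lax.eval (smiMon C b) (fun i : Fin 0 => i.elim0 : MultiIndex k)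
  | _ + 1, κ, h, _, _, f =>
    Lax.conj (stepLax ((smiInterLe C (h 0)).pi _)
      (iterLax b (fun i => κ i.succ) (fun i => h i.succ) (tailHom f)) (fibre (f 0)))

/-- The recursive step uses the hexagon for `b ≤ b' ≤ κ 0` together with the compatibility already
known for the remaining coordinates. -/
theorem iterDouble {b b' : Bool} (hb : b ≤ b') : ∀ {N : ℕ} (κ : Fin N → Bool) (h : ∀ i, b ≤ κ i)
    (h' : ∀ i, b' ≤ κ i) {k l : Fin N → SimplexCategoryᵒᵖ} (f : k ⟶ l),
    Double ((smiInterLe C hb).pi (MultiIndex k)) ((smiInterLe C hb).pi (MultiIndex l))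
      (iterLax b κ h f) (iterLax b' κ h' f)
  | 0, _, _, _, k, l, _ =>
    Double.pi' fun _ : MultiIndex l => Double.eval (smiInterLe C hb)
      (fun i : Fin 0 => i.elim0 : MultiIndex k)
  | _ + 1, κ, h, h', _, _, f =>
    Double.conj (stepDouble (((smiHex C hb (h' 0))).pi _)
      (iterDouble hb (fun i => κ i.succ) (fun i => h i.succ) (fun i => h' i.succ) (tailHom f))
      (fibre (f 0)))

theorem fibre_of_comp {k l j : SimplexCategoryᵒᵖ} {f : k ⟶ l} {g : l ⟶ j} {m : k ⟶ j}
    (h : f ≫ g = m) (c : Fin j.unop.len) : fibre m c = (fibre g c).flatMap (fibre f) := by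
  rw [← h, fibre_comp]

/-- The comparison of a composite of two functors `smiBar` with the functor of the composite. -/
def iterΩ : ∀ {N : ℕ} {κ : Fin N → Bool} (_ : Monotone κ) {k l j : Fin N → SimplexCategoryᵒᵖ}
    {f : k ⟶ l} {g : l ⟶ j} {m : k ⟶ j} (_ : f ≫ g = m) (A : MultiIndex k → C),
    (smiBar C κ g).obj ((smiBar C κ f).obj A) ⟶ (smiBar C κ m).obj A
  | 0, _, _, _, _, _, _, _, _, _, A => fun _ => 𝟙 (A fun i => i.elim0)
  | _ + 1, κ, hκ, k, _, j, f, g, m, h, A => (uncurryPower C j).map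
    (stepΩ (S := piMon (MultiIndex (tailObj k)) (smiMon C (κ 0)))
      (iterLax (κ 0) (fun i => κ i.succ) (fun i => hκ (Fin.zero_le _)) (tailHom f))
      (iterΩ (κ := fun i => κ i.succ) (fun _ _ hi => hκ (Fin.succ_le_succ_iff.mpr hi))
        (f := tailHom f) (g := tailHom g) (m := tailHom m) (funext fun i => congrFun h i.succ))
      (fibre_of_comp (congrFun h 0)) ((curryPower C k).obj A))

theorem iterΩ_nat : ∀ {N : ℕ} {κ : Fin N → Bool} (hκ : Monotone κ)
    {k l j : Fin N → SimplexCategoryᵒᵖ} {f : k ⟶ l} {g : l ⟶ j} {m : k ⟶ j} (h : f ≫ g = m)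
    {A B : MultiIndex k → C} (t : A ⟶ B),
    (smiBar C κ g).map ((smiBar C κ f).map t) ≫ iterΩ hκ h B = iterΩ hκ h A ≫ (smiBar C κ m).map t
  | 0, _, _, _, _, _, _, _, _, _, A, B, t =>
    funext fun _ => (Category.comp_id _).trans (Category.id_comp _).symm
  | _ + 1, _, _, k, _, j, f, g, m, h, A, B, t =>
    congrArg (uncurryPower C j).map (stepΩ_nat _ (iterΩ_nat _ _) _ ((curryPower C k).map t))

/-- Associativity needs only the first structure for the remaining coordinates, but the induction
needs every `b` below all the structures: the tail must be monoidal for `b` as well as lax monoidal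
for `κ 0`. -/
theorem iterΩ_isMon (b : Bool) : ∀ {N : ℕ} {κ : Fin N → Bool} (hκ : Monotone κ)
    (hb : ∀ i, b ≤ κ i) {k l j : Fin N → SimplexCategoryᵒᵖ} {f : k ⟶ l} {g : l ⟶ j} {m : k ⟶ j}
    (h : f ≫ g = m),
    IsMon ((iterLax b κ hb f).comp (iterLax b κ hb g)) (iterLax b κ hb m) (iterΩ (C := C) hκ h)
  | 0, _, _, _, _, _, _, _, _, _, _ =>
    { unit := funext fun _ => (Category.comp_id _).trans (Category.id_comp _)
      mul := fun A B => funext fun _ => by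
        change (𝟙 _ ≫ 𝟙 _) ≫ 𝟙 _ = th (smiMon C b) (𝟙 _) (𝟙 _) ≫ 𝟙 _
        rw [th_id]
        simp only [Category.comp_id] }
  | _ + 1, κ, hκ, hb, k, _, j, f, g, m, h =>
    IsMon.conj (stepΩ_isMon
      ((iterDouble (hb 0) (fun i => κ i.succ) _ (fun i => hκ (Fin.zero_le _)) (tailHom f)))
      (iterΩ_nat _ _) (iterΩ_isMon b _ _ _) _)

/-- Composites enter as variables with equations, so both bracketings share the target `m` and no
transport is needed. Strictness of the first structure and monoidality of the tail comparison are
the inputs of `stepΩ_assoc`. -/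
theorem iterΩ_assoc : ∀ {N : ℕ} {κ : Fin N → Bool} (hκ : Monotone κ)
    {k l j i : Fin N → SimplexCategoryᵒᵖ} {f : k ⟶ l} {g : l ⟶ j} {h : j ⟶ i} {fg : k ⟶ j}
    {gh : l ⟶ i} {m : k ⟶ i} (h₁₂ : f ≫ g = fg) (h₂₃ : g ≫ h = gh) (e₁₂ : fg ≫ h = m)
    (e₂₃ : f ≫ gh = m) (A : MultiIndex k → C),
    (smiBar C κ h).map (iterΩ hκ h₁₂ A) ≫ iterΩ hκ e₁₂ A =
      iterΩ hκ h₂₃ ((smiBar C κ f).obj A) ≫ iterΩ hκ e₂₃ A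
  | 0, _, _, _, _, _, _, _, _, _, _, _, _, _, _, _, _, _ => rfl
  | _ + 1, κ, hκ, k, l, j, i, f, g, h, fg, gh, m, h₁₂, h₂₃, e₁₂, e₂₃, A =>
    congrArg (uncurryPower C i).map (stepΩ_assoc ((smiMon_isStrict C (κ 0)).pi _)
      (iterΩ_isMon (κ 0) _ _ _) (iterΩ_nat _ _) (iterΩ_nat _ _) (iterΩ_nat _ _)
      (iterΩ_assoc _ _ _ _ _) _ _ _ _ ((curryPower C k).obj A))

end Iteration

/-! ### Comparisons that are identities. -/

section Units

variable {C : Type u} [Category.{v} C] [StrictSMICategory C]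

theorem fibre_of_id {k : SimplexCategoryᵒᵖ} {f : k ⟶ k} (h : f = 𝟙 k) (b : Fin k.unop.len) :
    fibre f b = [b] := by
  rw [h, fibre_id]

/-- The comparison of the functor of an identity with the identity functor. -/
def iterU : ∀ {N : ℕ} (κ : Fin N → Bool) {k : Fin N → SimplexCategoryᵒᵖ} {f : k ⟶ k}
    (_ : f = 𝟙 k) (A : MultiIndex k → C), (smiBar C κ f).obj A ⟶ A
  | 0, _, _, _, _, A => fun α => eqToHom (congrArg A (funext fun i => i.elim0))
  -- Currying followed by uncurrying replaces `α` by the tuple rebuilt from its head and its tail.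
  -- The two are only propositionally equal, hence the final transport.
  | _ + 1, κ, k, f, h, A => fun α =>
    (uncurryPower C k).map (stepU (piMon (MultiIndex (tailObj k)) (smiMon C (κ 0)))
      (iterU (fun i => κ i.succ) (f := tailHom f) (funext fun i => congrFun h i.succ))
      (fun b => fibre_of_id (congrFun h 0) b) ((curryPower C k).obj A)) α ≫
        eqToHom (congrArg A (Fin.cons_self_tail α))

theorem iterU_isEqHom : ∀ {N : ℕ} (κ : Fin N → Bool) {k : Fin N → SimplexCategoryᵒᵖ} {f : k ⟶ k}
    (h : f = 𝟙 k) (A : MultiIndex k → C), IsEqHom (iterU κ h A)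
  | 0, _, _, _, _, A => IsEqHom.pi fun _ => ⟨congrArg A (funext fun i => i.elim0), rfl⟩
  | _ + 1, κ, k, _, _, A => IsEqHom.pi fun α =>
    (((stepU_isEqHom ((smiMon_isStrict C (κ 0)).pi _) (iterU_isEqHom _ _) _
      ((curryPower C k).obj A)).apply (α 0)).apply fun i => α i.succ).comp (IsEqHom.eqToHom _)

theorem th_eqToHom {S : MonoidalCategory C} {A A' B B' : C} (h : A = A') (h' : B = B') :
    th S (eqToHom h) (eqToHom h') = eqToHom (by rw [h, h']) := by
  subst h h'
  exact th_id S A B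

/-- Knowing that each component is an identity would not determine `chi` for the functor of an
identity arrow; monoidality does, through `chi_isEqHom_of_isMon`. -/
theorem iterU_isMon (b : Bool) : ∀ {N : ℕ} (κ : Fin N → Bool) (hb : ∀ i, b ≤ κ i)
    {k : Fin N → SimplexCategoryᵒᵖ} {f : k ⟶ k} (h : f = 𝟙 k),
    IsMon (iterLax (C := C) b κ hb f) (Lax.id (piMon (MultiIndex k) (smiMon C b))) (iterU κ h)
  | 0, _, _, _, _, h =>
    { unit := funext fun _ => Category.id_comp _
      mul := fun A B => funext fun _ =>
        IsEqHom.ext ((IsEqHom.id _).comp ((iterU_isEqHom _ _ _).apply _))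
          ((IsEqHom.th ((iterU_isEqHom _ _ A).apply _) ((iterU_isEqHom _ _ B).apply _)).comp
            (IsEqHom.id _)) }
  | _ + 1, κ, hb, k, f, h => by
    have hm := stepU_isMon ((smiInterLe C (hb 0)).pi _)
      (iterU_isMon b (fun i => κ i.succ) (fun i => hb i.succ) (f := tailHom f)
        (funext fun i => congrFun h i.succ)) (fun b => fibre_of_id (congrFun h 0) b)
    constructor
    · funext α
      exact (Category.assoc _ _ _).symm.trans ((congrArg (· ≫ _)
        (congrFun (congrFun hm.unit (α 0)) fun i => α i.succ)).trans (Category.id_comp _))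
    · intro A B
      funext α
      have h1 := congrFun (congrFun (hm.mul ((curryPower C k).obj A) ((curryPower C k).obj B))
        (α 0)) fun i => α i.succ
      refine (Category.assoc _ _ _).symm.trans ((congrArg (· ≫ _) h1).trans ?_)
      refine ((congrArg (· ≫ _) (Category.comp_id _)).trans ?_).trans (Category.comp_id _).symm
      refine (congrArg (_ ≫ ·) (th_eqToHom (S := smiMon C b)
        (congrArg A (Fin.cons_self_tail α)) (congrArg B (Fin.cons_self_tail α))).symm).trans ?_
      exact th_comp (smiMon C b) _ _ _ _

/-- The products are moved past the functor of an identity arrow, which `iterU` identifies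
monoidally with the identity functor. -/
theorem iterΩ_left_isEqHom : ∀ {N : ℕ} {κ : Fin N → Bool} (hκ : Monotone κ)
    {k j : Fin N → SimplexCategoryᵒᵖ} {f : k ⟶ k} {g m : k ⟶ j} (_ : f = 𝟙 k) (h : f ≫ g = m)
    (A : MultiIndex k → C), IsEqHom (iterΩ hκ h A)
  | 0, _, _, _, _, _, _, _, _, _, A => IsEqHom.pi fun _ => IsEqHom.id _
  | _ + 1, κ, hκ, k, _, _, _, _, hf, h, A => IsEqHom.pi fun α =>
    ((stepΩ_isEqHom ((smiMon_isStrict C (κ 0)).pi _)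
      (iterΩ_left_isEqHom _ (funext fun i => congrFun hf i.succ) _) _ ((curryPower C k).obj A)
      fun _ => chi_isEqHom_of_isMon
        (iterU_isMon (κ 0) (fun i => κ i.succ) (fun _ => hκ (Fin.zero_le _))
          (funext fun i => congrFun hf i.succ)) (iterU_isEqHom _ _) _ _).apply (α 0)).apply
            fun i => α i.succ

/-- All fibres of the identity `g` are singletons, and a product of one factor passes through any
lax monoidal functor by an identity. -/
theorem iterΩ_right_isEqHom : ∀ {N : ℕ} {κ : Fin N → Bool} (hκ : Monotone κ)
    {k j : Fin N → SimplexCategoryᵒᵖ} {g : j ⟶ j} {f m : k ⟶ j} (_ : g = 𝟙 j) (h : f ≫ g = m)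
    (A : MultiIndex k → C), IsEqHom (iterΩ hκ h A)
  | 0, _, _, _, _, _, _, _, _, _, A => IsEqHom.pi fun _ => IsEqHom.id _
  | _ + 1, κ, hκ, k, j, _, _, _, hg, h, A => IsEqHom.pi fun α =>
    ((stepΩ_isEqHom ((smiMon_isStrict C (κ 0)).pi _)
      (iterΩ_right_isEqHom _ (funext fun i => congrFun hg i.succ) _) _ ((curryPower C k).obj A)
      fun b => by
        rw [fibre_of_id (congrFun hg 0)]
        exact chi_singleton_isEqHom ((smiMon_isStrict C (κ 0)).pi _)
          ((smiMon_isStrict C (κ 0)).pi _) _ _ _).apply (α 0)).apply fun i => α i.succ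

theorem iterΩ_isEqHom_zero {κ : Fin 0 → Bool} (hκ : Monotone κ) {k l j : Fin 0 → SimplexCategoryᵒᵖ}
    {f : k ⟶ l} {g : l ⟶ j} {m : k ⟶ j} (h : f ≫ g = m) (A : MultiIndex k → C) :
    IsEqHom (iterΩ hκ h A) :=
  IsEqHom.pi fun _ => IsEqHom.id _

theorem chi_iterLax_zero_isEqHom (b : Bool) {κ : Fin 0 → Bool} (h : ∀ i, b ≤ κ i)
    {k l : Fin 0 → SimplexCategoryᵒᵖ} (f : k ⟶ l) {ι : Type} (A : ι → MultiIndex k → C)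
    (L : List ι) : IsEqHom (chi (iterLax b κ h f) A L) :=
  chi_isEqHom (IsEqHom.pi fun _ => IsEqHom.id (un (smiMon C b)))
    (fun A B => IsEqHom.pi fun _ => IsEqHom.id (ten (smiMon C b) (A _) (B _))) _ _

/-- With a single coordinate, the functor to be passed belongs to an empty tuple, and the arrows `ε`
and `μ` of its lax structure are identities. -/
theorem iterΩ_isEqHom_of_le_one : ∀ {N : ℕ} (_ : N ≤ 1) {κ : Fin N → Bool} (hκ : Monotone κ)
    {k l j : Fin N → SimplexCategoryᵒᵖ} {f : k ⟶ l} {g : l ⟶ j} {m : k ⟶ j} (h : f ≫ g = m)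
    (A : MultiIndex k → C), IsEqHom (iterΩ hκ h A)
  | 0, _, _, hκ, _, _, _, _, _, _, h, A => iterΩ_isEqHom_zero hκ h A
  | 1, _, κ, _, k, _, _, _, _, _, _, A => IsEqHom.pi fun α =>
    ((stepΩ_isEqHom ((smiMon_isStrict C (κ 0)).pi _) (iterΩ_isEqHom_zero _ _) _
      ((curryPower C k).obj A) fun _ => chi_iterLax_zero_isEqHom _ _ _ _ _).apply (α 0)).apply
        fun i => α i.succ

end Units

/-! ### Assembling the comparisons into a lax functor. -/

section LaxFunctors

/-- Naturality along identity components forces the two functors to agree on arrows, so an equality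
of functors results. -/
theorem exists_eq_eqToHom {D : Type u} [Category.{v} D] {E : Type u} [Category.{v} E] {F G : D ⥤ E}
    (η : F ⟶ G) (h : ∀ A, IsEqHom (η.app A)) : ∃ e : F = G, η = eqToHom e := by
  have e : F = G := by
    refine CategoryTheory.Functor.ext (fun A => (h A).1) fun A B f => ?_
    obtain ⟨eA, hA⟩ := h A
    obtain ⟨eB, hB⟩ := h B
    have n := η.naturality f
    rw [hA, hB] at n
    rw [← reassoc_of% n, eqToHom_trans, eqToHom_refl, Category.comp_id]
  subst e
  exact ⟨rfl, NatTrans.ext (funext fun A => (h A).ext (IsEqHom.id _))⟩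

theorem apply_comp_eqToHom {K : Type} {D : Type u} [Category.{v} D] {A B : K → D} (t : A ⟶ B)
    {i j : K} (h : i = j) : t i ≫ eqToHom (congrArg B h) = eqToHom (congrArg A h) ≫ t j := by
  subst h
  simp

variable (C : Type u) [Category.{v} C]

/-- The objects and the arrows of an iterated reduced bar construction. -/
def barPrelax {N : ℕ} (T : Fin N → MonoidalCategory C) :
    PrelaxFunctor (LocallyDiscrete (Fin N → SimplexCategoryᵒᵖ)) Cat.{v, u} where
  obj k := Cat.of (MultiIndex k.as → C)
  map f := (iteratedBar C T f.as).toCatHom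
  map₂ η := eqToHom (by rw [LocallyDiscrete.eq_of_hom η])
  map₂_id _ := rfl
  map₂_comp _ _ := (eqToHom_trans _ _).symm

variable {C} [StrictSMICategory C]

theorem iterU_nat : ∀ {N : ℕ} (κ : Fin N → Bool) {k : Fin N → SimplexCategoryᵒᵖ} {f : k ⟶ k}
    (h : f = 𝟙 k) {A B : MultiIndex k → C} (t : A ⟶ B),
    (smiBar C κ f).map t ≫ iterU κ h B = iterU κ h A ≫ t
  | 0, _, _, _, _, _, _, t => funext fun α =>
    apply_comp_eqToHom t (show (fun i : Fin 0 => i.elim0) = α from funext fun i => i.elim0)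
  | _ + 1, κ, k, f, h, A, B, t => by
    have hn := stepU_nat (piMon (MultiIndex (tailObj k)) (smiMon C (κ 0)))
      (iterU_nat (fun i => κ i.succ) (f := tailHom f) (funext fun i => congrFun h i.succ))
      (fun b => fibre_of_id (congrFun h 0) b) ((curryPower C k).map t)
    funext α
    refine (Category.assoc _ _ _).symm.trans ((congrArg (· ≫ _)
      (congrFun (congrFun hn (α 0)) fun i => α i.succ)).trans ?_)
    refine (Category.assoc _ _ _).trans
      ((congrArg (_ ≫ ·) (apply_comp_eqToHom t (Fin.cons_self_tail α))).trans
        (Category.assoc _ _ _).symm)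

theorem smiBar_id {N : ℕ} (κ : Fin N → Bool) (k : Fin N → SimplexCategoryᵒᵖ) :
    smiBar C κ (𝟙 k) = 𝟭 (MultiIndex k → C) :=
  (exists_eq_eqToHom { app := iterU κ rfl, naturality := fun _ _ t => iterU_nat κ rfl t }
    (iterU_isEqHom κ rfl)).1

/-- This absorbs the associator of the source bicategory, whose image is a transport along an
equality of arrows. -/
theorem iterΩ_comp_eqToHom {N : ℕ} {κ : Fin N → Bool} (hκ : Monotone κ)
    {k l j : Fin N → SimplexCategoryᵒᵖ} {f : k ⟶ l} {g : l ⟶ j} {m m' : k ⟶ j} (h : f ≫ g = m)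
    (h' : f ≫ g = m') (A : MultiIndex k → C)
    (e : (smiBar C κ m).obj A = (smiBar C κ m').obj A) :
    iterΩ hκ h A ≫ eqToHom e = iterΩ hκ h' A := by
  subst h h'
  exact Category.comp_id _

/-- The natural transformation whose components are the comparisons `iterΩ`. -/
def iterNatTrans {N : ℕ} {κ : Fin N → Bool} (hκ : Monotone κ)
    {k l j : Fin N → SimplexCategoryᵒᵖ} (f : k ⟶ l) (g : l ⟶ j) :
    smiBar C κ f ⋙ smiBar C κ g ⟶ smiBar C κ (f ≫ g) where
  app A := iterΩ hκ rfl A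
  naturality _ _ t := iterΩ_nat hκ rfl t

theorem barPrelax_map₂_app {N : ℕ} (T : Fin N → MonoidalCategory C)
    {k l : LocallyDiscrete (Fin N → SimplexCategoryᵒᵖ)} {f g : k ⟶ l} (η : f ⟶ g)
    (A : MultiIndex k.as → C) : IsEqHom (((barPrelax C T).map₂ η).toNatTrans.app A) := by
  obtain rfl := LocallyDiscrete.eq_of_hom η
  exact IsEqHom.id _

theorem barPrelax_map₂_self {N : ℕ} (T : Fin N → MonoidalCategory C)
    {k l : LocallyDiscrete (Fin N → SimplexCategoryᵒᵖ)} {f : k ⟶ l} (η : f ⟶ f) :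
    (barPrelax C T).map₂ η = 𝟙 _ := rfl

theorem eqToHom_toNatTrans_app {D E : Cat.{v, u}} {F G : D ⟶ E} (h : F = G) (A : D) :
    IsEqHom ((eqToHom h).toNatTrans.app A) := by
  subst h
  exact IsEqHom.id _

theorem eqToHom_smiBar_id_app {N : ℕ} (κ : Fin N → Bool) (k : Fin N → SimplexCategoryᵒᵖ)
    (h : 𝟙 (Cat.of (MultiIndex k → C)) = (smiBar C κ (𝟙 k)).toCatHom) (A : MultiIndex k → C) :
    IsEqHom (D := MultiIndex k → C) ((eqToHom h).toNatTrans.app A) :=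
  eqToHom_toNatTrans_app (D := Cat.of (MultiIndex k → C)) h A

variable (C) in
/-- The iterated reduced bar construction as a lax functor. -/
def barLaxFunctor {N : ℕ} {κ : Fin N → Bool} (hκ : Monotone κ) :
    LaxFunctor (LocallyDiscrete (Fin N → SimplexCategoryᵒᵖ)) Cat.{v, u} where
  toPrelaxFunctor := barPrelax C fun i => smiMon C (κ i)
  mapId k := eqToHom (Cat.ext (smiBar_id κ k.as).symm)
  mapComp f g := (iterNatTrans hκ f.as g.as).toCatHom₂
  mapComp_naturality_left η g := by
    obtain rfl := LocallyDiscrete.eq_of_hom η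
    rw [barPrelax_map₂_self, barPrelax_map₂_self, Bicategory.id_whiskerRight]
    exact (Category.comp_id _).trans (Category.id_comp _).symm
  mapComp_naturality_right f g g' η := by
    obtain rfl := LocallyDiscrete.eq_of_hom η
    rw [barPrelax_map₂_self, barPrelax_map₂_self, Bicategory.whiskerLeft_id]
    exact (Category.comp_id _).trans (Category.id_comp _).symm
  map₂_associator f g h := by
    refine Cat.Hom₂.ext (NatTrans.ext (funext fun A => ?_))
    obtain ⟨e, he⟩ := barPrelax_map₂_app (fun i => smiMon C (κ i)) (Bicategory.associator f g h).hom A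
    change (smiBar C κ h.as).map (iterΩ hκ rfl A) ≫ iterΩ hκ rfl A ≫
        ((barPrelax C fun i => smiMon C (κ i)).map₂
          (Bicategory.associator f g h).hom).toNatTrans.app A =
      𝟙 _ ≫ iterΩ hκ rfl ((smiBar C κ f.as).obj A) ≫ iterΩ hκ rfl A
    rw [he]
    refine (congrArg (_ ≫ ·) (iterΩ_comp_eqToHom hκ rfl (Category.assoc _ _ _) A e)).trans ?_
    exact (iterΩ_assoc hκ rfl rfl _ rfl A).trans (Category.id_comp _).symm
  map₂_leftUnitor {k l} f := by
    refine Cat.Hom₂.ext (NatTrans.ext (funext fun A => ?_))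
    -- Every 2-cell in the unit law has components that are identities up to equality, so
    -- `IsEqHom.ext` suffices.
    refine (barPrelax_map₂_app _ _ A).ext ((IsEqHom.id _).comp (IsEqHom.comp ?_ ?_))
    · exact (eqToHom_smiBar_id_app κ k.as _ A).map (smiBar C κ f.as)
    · exact iterΩ_left_isEqHom hκ rfl rfl A
  map₂_rightUnitor {k l} f := by
    refine Cat.Hom₂.ext (NatTrans.ext (funext fun A => ?_))
    refine (barPrelax_map₂_app _ _ A).ext ((IsEqHom.id _).comp (IsEqHom.comp ?_ ?_))
    · exact eqToHom_smiBar_id_app κ l.as _ ((smiBar C κ f.as).obj A)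
    · exact iterΩ_right_isEqHom hκ rfl rfl A

theorem exists_mapComp_eq_eqToHom {N : ℕ} (hN : N ≤ 1) {κ : Fin N → Bool} (hκ : Monotone κ)
    {k l j : LocallyDiscrete (Fin N → SimplexCategoryᵒᵖ)} (f : k ⟶ l) (g : l ⟶ j) :
    ∃ h, (barLaxFunctor C hκ).mapComp f g = eqToHom h := by
  obtain ⟨e, he⟩ := exists_eq_eqToHom (iterNatTrans (C := C) hκ f.as g.as)
    (iterΩ_isEqHom_of_le_one hN hκ rfl)
  refine ⟨Cat.ext e, Cat.Hom₂.ext ?_⟩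
  rw [Cat.Hom₂.eqToHom_toNatTrans]
  exact he

end LaxFunctors

/-! ### Classes of families of arrows -/

section ArrowClasses

universe w

variable {I : Type w}

/-- A class of families of arrows, in a family of categories, that is closed under composition. -/
structure ArrowClass (D : I → Type u) [∀ i, Category.{v} (D i)] where
  /-- the families of objects in the class -/
  obj : (∀ i, D i) → Prop
  /-- the families of arrows in the class -/
  hom : ∀ {X Y : ∀ i, D i}, (∀ i, X i ⟶ Y i) → Prop
  id_mem : ∀ {X : ∀ i, D i}, obj X → hom fun i => 𝟙 (X i)
  comp_mem : ∀ {X Y Z : ∀ i, D i} {f : ∀ i, X i ⟶ Y i} {g : ∀ i, Y i ⟶ Z i}, hom f → hom g →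
    hom fun i => f i ≫ g i

variable {D : I → Type u} [∀ i, Category.{v} (D i)] {E : I → Type u} [∀ i, Category.{v} (E i)]
  {G : I → Type u} [∀ i, Category.{v} (G i)]

/-- The families of arrows in a power whose coordinates are in a given class. -/
def ArrowClass.pi (K : Type) (P : ArrowClass D) : ArrowClass fun i => K → D i where
  obj X := ∀ a, P.obj fun i => X i a
  hom f := ∀ a, P.hom fun i => f i a
  id_mem h a := P.id_mem (h a)
  comp_mem hf hg a := P.comp_mem (hf a) (hg a)

theorem ArrowClass.eqToHom_mem (P : ArrowClass D) {X Y : ∀ i, D i} (h : ∀ i, X i = Y i)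
    (hX : P.obj X) : P.hom fun i => eqToHom (h i) := by
  obtain rfl := funext h
  exact P.id_mem hX

/-- A class is closed under the operations of a family of monoidal structures. -/
structure MonMem (P : ArrowClass D) (S : ∀ i, MonoidalCategory (D i)) : Prop where
  un : P.obj fun i => un (S i)
  ten : ∀ {A B : ∀ i, D i}, P.obj A → P.obj B → P.obj fun i => ten (S i) (A i) (B i)
  th : ∀ {A A' B B' : ∀ i, D i} {f : ∀ i, A i ⟶ A' i} {g : ∀ i, B i ⟶ B' i}, P.hom f → P.hom g →
    P.hom fun i => th (S i) (f i) (g i)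
  -- Concatenation uses only associators and left unitors; no closure under inverses is required.
  as : ∀ {A B X : ∀ i, D i}, P.obj A → P.obj B → P.obj X →
    P.hom fun i => (as (S i) (A i) (B i) (X i)).hom
  lu : ∀ {A : ∀ i, D i}, P.obj A → P.hom fun i => (lu (S i) (A i)).hom

/-- A class contains the arrows of a family of interchanges. -/
structure InterMem (P : ArrowClass D) {S T : ∀ i, MonoidalCategory (D i)}
    (a : ∀ i, Inter (S i) (T i)) : Prop where
  x : ∀ {A B A' B' : ∀ i, D i}, P.obj A → P.obj B → P.obj A' → P.obj B' →
    P.hom fun i => (a i).x (A i) (B i) (A' i) (B' i)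
  i2 : P.hom fun i => (a i).i2
  i1 : P.hom fun i => (a i).i1
  i0 : P.hom fun i => (a i).i0

/-- A family of functors preserves classes. -/
structure FunMem (P : ArrowClass D) (Q : ArrowClass E) (F : ∀ i, D i ⥤ E i) : Prop where
  obj : ∀ {A : ∀ i, D i}, P.obj A → Q.obj fun i => (F i).obj (A i)
  map : ∀ {A B : ∀ i, D i} {f : ∀ i, A i ⟶ B i}, P.hom f → Q.hom fun i => (F i).map (f i)

/-- A class contains the arrows of a family of lax monoidal structures. -/
structure LaxMem (P : ArrowClass D) (Q : ArrowClass E) {S : ∀ i, MonoidalCategory (D i)}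
    {S' : ∀ i, MonoidalCategory (E i)} {F : ∀ i, D i ⥤ E i} (l : ∀ i, Lax (S i) (S' i) (F i)) :
    Prop where
  ε : Q.hom fun i => (l i).ε
  μ : ∀ {A B : ∀ i, D i}, P.obj A → P.obj B → Q.hom fun i => (l i).μ (A i) (B i)

variable {P : ArrowClass D} {Q : ArrowClass E} {R : ArrowClass G}
  {S T : ∀ i, MonoidalCategory (D i)} {S' T' : ∀ i, MonoidalCategory (E i)}
  {S'' : ∀ i, MonoidalCategory (G i)} {F : ∀ i, D i ⥤ E i} {F' : ∀ i, E i ⥤ G i}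
  {F'' : ∀ i, D i ⥤ G i} {ι κ κ' : Type}

theorem MonMem.pi (K : Type) (h : MonMem P S) : MonMem (P.pi K) fun i => piMon K (S i) where
  un _ := h.un
  ten hA hB a := h.ten (hA a) (hB a)
  th hf hg a := h.th (hf a) (hg a)
  as hA hB hX a := h.as (hA a) (hB a) (hX a)
  lu hA a := h.lu (hA a)

theorem InterMem.pi (K : Type) {a : ∀ i, Inter (S i) (T i)} (h : InterMem P a) :
    InterMem (P.pi K) fun i => (a i).pi K where
  x hA hB hA' hB' k := h.x (hA k) (hB k) (hA' k) (hB' k)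
  i2 _ := h.i2
  i1 _ := h.i1
  i0 _ := h.i0

theorem FunMem.comp (h : FunMem P Q F) (h' : FunMem Q R F') :
    FunMem P R fun i => F i ⋙ F' i where
  obj hA := h'.obj (h.obj hA)
  map hf := h'.map (h.map hf)

theorem FunMem.pi (K : Type) (h : FunMem P Q F) :
    FunMem (P.pi K) (Q.pi K) fun i => pw (ι := K) (F i) where
  obj hA a := h.obj (hA a)
  map hf a := h.map (hf a)

theorem LaxMem.pi (K : Type) {l : ∀ i, Lax (S i) (S' i) (F i)} (h : LaxMem P Q l) :
    LaxMem (P.pi K) (Q.pi K) fun i => (l i).pi K where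
  ε _ := h.ε
  μ hA hB a := h.μ (hA a) (hB a)

theorem LaxMem.comp {l : ∀ i, Lax (S i) (S' i) (F i)} {m : ∀ i, Lax (S' i) (S'' i) (F' i)}
    (hF : FunMem P Q F) (hF' : FunMem Q R F') (h : LaxMem P Q l) (h' : LaxMem Q R m) :
    LaxMem P R fun i => (l i).comp (m i) where
  ε := R.comp_mem h'.ε (hF'.map h.ε)
  μ hA hB := R.comp_mem (h'.μ (hF.obj hA) (hF.obj hB)) (hF'.map (h.μ hA hB))

theorem tl_mem (h : MonMem P S) : ∀ L : List ι, FunMem (P.pi ι) P fun i => tl (S i) L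
  | [] => ⟨fun _ => h.un, fun _ => P.id_mem h.un⟩
  | a :: L => ⟨fun hA => h.ten (hA a) ((tl_mem h L).obj hA),
      fun hf => h.th (hf a) ((tl_mem h L).map hf)⟩

theorem barL_mem (h : MonMem P S) (ℓ : κ → List ι) :
    FunMem (P.pi ι) (P.pi κ) fun i => barL (S i) ℓ where
  obj hA a := (tl_mem h (ℓ a)).obj hA
  map hf a := (tl_mem h (ℓ a)).map hf

theorem listLax_mem {a : ∀ i, Inter (S i) (T i)} (hS : MonMem P S) (hT : MonMem P T)
    (h : InterMem P a) : ∀ L : List ι, LaxMem (P.pi ι) P fun i => listLax (a i) L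
  | [] => ⟨h.i0, fun _ _ => h.i2⟩
  | c :: L => ⟨P.comp_mem h.i1 (hT.th (P.id_mem hS.un) (listLax_mem hS hT h L).ε),
      fun hA hB => P.comp_mem
        (h.x (hA c) ((tl_mem hT L).obj hA) (hB c) ((tl_mem hT L).obj hB))
        (hT.th (P.id_mem (hS.ten (hA c) (hB c))) ((listLax_mem hS hT h L).μ hA hB))⟩

theorem stepLax_mem {a : ∀ i, Inter (S i) (T i)} (hS : MonMem P S) (hT : MonMem P T)
    (h : InterMem P a) {l : ∀ i, Lax (S i) (S' i) (F i)} (hF : FunMem P Q F) (hl : LaxMem P Q l)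
    (ℓ : κ → List ι) : LaxMem (P.pi ι) (Q.pi κ) fun i => stepLax (a i) (l i) ℓ :=
  LaxMem.comp (l := fun i => barLax (a i) ℓ) (barL_mem hT ℓ) (hF.pi κ)
    ⟨fun c => (listLax_mem hS hT h (ℓ c)).ε, fun hA hB c => (listLax_mem hS hT h (ℓ c)).μ hA hB⟩
    (hl.pi κ)

theorem gApp_mem (h : MonMem P S) {A : ∀ i, ι → D i} (hA : (P.pi ι).obj A) :
    ∀ L L' : List ι, P.hom fun i => gApp (S i) (A i) L L'
  | [], L' => h.lu ((tl_mem h L').obj hA)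
  | a :: L, L' => P.comp_mem (h.as (hA a) ((tl_mem h L).obj hA) ((tl_mem h L').obj hA))
      (h.th (P.id_mem (hA a)) (gApp_mem h hA L L'))

theorem gFlat_mem (h : MonMem P S) (ℓ : κ → List ι) {A : ∀ i, ι → D i} (hA : (P.pi ι).obj A) :
    ∀ K : List κ, P.hom fun i => gFlat (S i) ℓ (A i) K
  | [] => P.id_mem h.un
  | a :: K => P.comp_mem (h.th (P.id_mem ((tl_mem h (ℓ a)).obj hA)) (gFlat_mem h ℓ hA K))
      (gApp_mem h hA (ℓ a) (K.flatMap ℓ))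

theorem gComp_mem (h : MonMem P S) (ℓ : κ → List ι) {K : List κ} {L : List ι}
    (e : L = K.flatMap ℓ) {A : ∀ i, ι → D i} (hA : (P.pi ι).obj A) :
    P.hom fun i => gComp (S i) ℓ e (A i) :=
  P.comp_mem (gFlat_mem h ℓ hA K) (P.eqToHom_mem _ ((tl_mem h _).obj hA))

theorem chi_mem {l : ∀ i, Lax (S i) (S' i) (F i)} (hS : MonMem P S) (hS' : MonMem Q S')
    (hF : FunMem P Q F) (hl : LaxMem P Q l) {A : ∀ i, ι → D i} (hA : (P.pi ι).obj A) :
    ∀ L : List ι, Q.hom fun i => chi (l i) (A i) L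
  | [] => hl.ε
  | a :: L => Q.comp_mem (hS'.th (Q.id_mem (hF.obj (hA a))) (chi_mem hS hS' hF hl hA L))
      (hl.μ (hA a) ((tl_mem hS L).obj hA))

theorem stepΩ_mem {l : ∀ i, Lax (S i) (S' i) (F i)}
    {ω : ∀ i A, (F' i).obj ((F i).obj A) ⟶ (F'' i).obj A} (hS : MonMem P S) (hS' : MonMem Q S')
    (hF : FunMem P Q F) (hF' : FunMem Q R F') (hF'' : FunMem P R F'') (hl : LaxMem P Q l)
    (hω : ∀ {A : ∀ i, D i}, P.obj A → R.hom fun i => ω i (A i)) {ℓ : κ → List ι}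
    {ℓ' : κ' → List κ} {ℓ'' : κ' → List ι} (h : ∀ c, ℓ'' c = (ℓ' c).flatMap ℓ)
    {A : ∀ i, ι → D i} (hA : (P.pi ι).obj A) :
    (R.pi κ').hom fun i => stepΩ (l i) (ω i) h (A i) := fun c =>
  R.comp_mem (hF'.map (chi_mem hS hS' hF hl ((barL_mem hS ℓ).obj hA) (ℓ' c)))
    (R.comp_mem (hω ((tl_mem hS (ℓ' c)).obj ((barL_mem hS ℓ).obj hA)))
      (hF''.map (gComp_mem hS ℓ (h c) hA)))

end ArrowClasses

/-! ### Formulae with equal values -/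

section Coherence

variable {P : Type}

/-- The congruence generated by the laws of a monoid, for both monoidal structures. -/
inductive Formula.Rel : Formula P → Formula P → Prop
  | refl (X : Formula P) : Rel X X
  | symm {X Y : Formula P} : Rel X Y → Rel Y X
  | trans {X Y Z : Formula P} : Rel X Y → Rel Y Z → Rel X Z
  | vee {X X' Y Y' : Formula P} : Rel X X' → Rel Y Y' → Rel (X.vee Y) (X'.vee Y')
  | wedge {X X' Y Y' : Formula P} : Rel X X' → Rel Y Y' → Rel (X.wedge Y) (X'.wedge Y')
  | veeAssoc (X Y Z : Formula P) : Rel ((X.vee Y).vee Z) (X.vee (Y.vee Z))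
  | veeLeft (X : Formula P) : Rel (Formula.bot.vee X) X
  | veeRight (X : Formula P) : Rel (X.vee .bot) X
  | wedgeAssoc (X Y Z : Formula P) : Rel ((X.wedge Y).wedge Z) (X.wedge (Y.wedge Z))
  | wedgeLeft (X : Formula P) : Rel (Formula.top.wedge X) X
  | wedgeRight (X : Formula P) : Rel (X.wedge .top) X

/-- `Formula.Rel` as a setoid. -/
def Formula.setoid (P : Type) : Setoid (Formula P) where
  r := Formula.Rel
  iseqv := ⟨.refl, .symm, .trans⟩

variable (P) in
/-- The indiscrete category whose objects are the formulae up to `Formula.Rel`. -/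
structure FormulaClass : Type u where
  ofQuotient ::
  cls : ULift.{u} (Quotient (Formula.setoid P))

namespace FormulaClass

/-- The class of a formula. -/
def mk (X : Formula P) : FormulaClass.{u} P := ⟨⟨Quotient.mk (Formula.setoid P) X⟩⟩

theorem mk_eq {X Y : Formula P} : mk.{u} X = mk Y ↔ X.Rel Y :=
  ⟨fun h => Quotient.exact (s := Formula.setoid P) (congrArg (fun c => c.cls.down) h),
    fun h => congrArg (fun c => (⟨⟨c⟩⟩ : FormulaClass.{u} P))
      (Quotient.sound (s := Formula.setoid P) h)⟩

theorem mk_surjective (c : FormulaClass.{u} P) : ∃ X, mk X = c := by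
  obtain ⟨⟨c⟩⟩ := c
  obtain ⟨X, rfl⟩ := Quotient.exists_rep c
  exact ⟨X, rfl⟩

instance : Category.{v} (FormulaClass.{u} P) where
  Hom _ _ := PUnit
  id _ := ⟨⟩
  comp _ _ := ⟨⟩

/-- The isomorphism between two objects. -/
def iso (X Y : FormulaClass.{u} P) : X ≅ Y := ⟨⟨⟩, ⟨⟩, rfl, rfl⟩

/-- The disjunction of two classes. -/
def vee (X Y : FormulaClass.{u} P) : FormulaClass.{u} P :=
  ⟨⟨Quotient.map₂ (sa := Formula.setoid P) (sb := Formula.setoid P) (sc := Formula.setoid P)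
    Formula.vee (fun _ _ h _ _ h' => .vee h h') X.cls.down Y.cls.down⟩⟩

/-- The conjunction of two classes. -/
def wedge (X Y : FormulaClass.{u} P) : FormulaClass.{u} P :=
  ⟨⟨Quotient.map₂ (sa := Formula.setoid P) (sb := Formula.setoid P) (sc := Formula.setoid P)
    Formula.wedge (fun _ _ h _ _ h' => .wedge h h') X.cls.down Y.cls.down⟩⟩

/-- The monoidal structure with a given product and a given unit. -/
@[reducible] def monoidal (t : FormulaClass.{u} P → FormulaClass.{u} P → FormulaClass.{u} P)
    (e : FormulaClass.{u} P) : MonoidalCategory.{v} (FormulaClass.{u} P) where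
  tensorObj := t
  tensorUnit := e
  tensorHom _ _ := ⟨⟩
  whiskerLeft _ _ _ _ := ⟨⟩
  whiskerRight _ _ := ⟨⟩
  associator _ _ _ := iso _ _
  leftUnitor _ := iso _ _
  rightUnitor _ := iso _ _

/-- The symmetry of `monoidal`. -/
@[reducible] def symmetric (t : FormulaClass.{u} P → FormulaClass.{u} P → FormulaClass.{u} P)
    (e : FormulaClass.{u} P) :
    @SymmetricCategory.{v} (FormulaClass.{u} P) _ (monoidal t e) :=
  letI := monoidal.{v} t e
  { braiding := fun _ _ => iso _ _ }

theorem monoidal_isStrict {t : FormulaClass.{u} P → FormulaClass.{u} P → FormulaClass.{u} P}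
    {e : FormulaClass.{u} P} (h₁ : ∀ X Y Z, t (t X Y) Z = t X (t Y Z)) (h₂ : ∀ X, t e X = X)
    (h₃ : ∀ X, t X e = X) : IsStrict (monoidal.{v} t e) :=
  ⟨h₁, h₂, h₃, fun _ _ _ => rfl, fun _ => rfl, fun _ => rfl⟩

/-- All hom-sets are singletons, so the equations between arrows are trivial. Only strictness has
content: it is where formulae must be identified modulo the monoid laws. -/
instance : StrictSMICategory.{v} (FormulaClass.{u} P) where
  veeMon := monoidal vee (mk .bot)
  veeSymm := symmetric vee (mk .bot)
  wedgeMon := monoidal wedge (mk .top)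
  wedgeSymm := symmetric wedge (mk .top)
  ck _ _ _ _ := ⟨⟩
  wBot := iso _ _
  wTop := iso _ _
  kappa := ⟨⟩
  ck_natural _ _ _ _ := rfl
  eq1 _ _ _ _ _ _ := rfl
  eq2 _ _ _ _ _ _ := rfl
  eq3 _ _ _ _ := rfl
  eq4 _ _ _ _ := rfl
  eq5 _ _ := rfl
  eq6 _ _ := rfl
  eq7 := rfl
  eq8 := rfl
  eq9 := rfl
  eq10 := rfl
  eq11 := rfl
  eq12 := rfl
  eq13 := rfl
  vee_strict := by
    refine monoidal_isStrict (fun X Y Z => ?_) (fun X => ?_) fun X => ?_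
    · obtain ⟨X, rfl⟩ := mk_surjective X
      obtain ⟨Y, rfl⟩ := mk_surjective Y
      obtain ⟨Z, rfl⟩ := mk_surjective Z
      exact mk_eq.2 (.veeAssoc X Y Z)
    · obtain ⟨X, rfl⟩ := mk_surjective X
      exact mk_eq.2 (.veeLeft X)
    · obtain ⟨X, rfl⟩ := mk_surjective X
      exact mk_eq.2 (.veeRight X)
  wedge_strict := by
    refine monoidal_isStrict (fun X Y Z => ?_) (fun X => ?_) fun X => ?_
    · obtain ⟨X, rfl⟩ := mk_surjective X
      obtain ⟨Y, rfl⟩ := mk_surjective Y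
      obtain ⟨Z, rfl⟩ := mk_surjective Z
      exact mk_eq.2 (.wedgeAssoc X Y Z)
    · obtain ⟨X, rfl⟩ := mk_surjective X
      exact mk_eq.2 (.wedgeLeft X)
    · obtain ⟨X, rfl⟩ := mk_surjective X
      exact mk_eq.2 (.wedgeRight X)

theorem eval_letter (X : Formula P) : X.eval (fun p => mk.{u} (.letter p)) = mk X := by
  induction X with
  | letter p => rfl
  | bot => rfl
  | top => rfl
  | vee X Y hX hY => exact congrArg₂ vee hX hY
  | wedge X Y hX hY => exact congrArg₂ wedge hX hY

end FormulaClass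

/-- A strict SMI category with an interpretation of the letters. -/
structure Interp (P : Type) : Type (max (u + 1) (v + 1)) where
  carrier : Type u
  [cat : Category.{v} carrier]
  [smi : StrictSMICategory carrier]
  val : P → carrier

attribute [instance] Interp.cat Interp.smi

/-- In `FormulaClass`, with each letter read as its own class, the value of a formula is its class.
-/
theorem Formula.rel_of_eval {X Y : Formula P}
    (h : ∀ i : Interp.{v, u} P, X.eval i.val = Y.eval i.val) : X.Rel Y := by
  have h' := h ⟨FormulaClass.{u} P, fun p => .mk (.letter p)⟩
  rw [FormulaClass.eval_letter, FormulaClass.eval_letter] at h'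
  exact FormulaClass.mk_eq.1 h'

/-- Formulae that are related have terms between them that are identities in strict SMI
categories. -/
theorem Formula.Rel.exists_term {X Y : Formula P} (h : X.Rel Y) :
    (∃ t : ArrowTerm X Y, ∀ i : Interp.{v, u} P, IsEqHom (t.eval i.val)) ∧
      ∃ t : ArrowTerm Y X, ∀ i : Interp.{v, u} P, IsEqHom (t.eval i.val) := by
  have hv : ∀ i : Interp.{v, u} P, IsStrict (BiSymmetric.veeMon (C := i.carrier)) :=
    fun i => StrictSMICategory.vee_strict
  have hw : ∀ i : Interp.{v, u} P, IsStrict (BiSymmetric.wedgeMon (C := i.carrier)) :=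
    fun i => StrictSMICategory.wedge_strict
  induction h with
  | refl X => exact ⟨⟨.id X, fun i => .id _⟩, ⟨.id X, fun i => .id _⟩⟩
  | symm _ ih => exact ih.symm
  | trans _ _ ih ih' =>
    obtain ⟨⟨s, hs⟩, ⟨s', hs'⟩⟩ := ih
    obtain ⟨⟨t, ht⟩, ⟨t', ht'⟩⟩ := ih'
    exact ⟨⟨.comp s t, fun i => (hs i).comp (ht i)⟩, ⟨.comp t' s', fun i => (ht' i).comp (hs' i)⟩⟩
  | vee _ _ ih ih' =>
    obtain ⟨⟨s, hs⟩, ⟨s', hs'⟩⟩ := ih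
    obtain ⟨⟨t, ht⟩, ⟨t', ht'⟩⟩ := ih'
    exact ⟨⟨.vee s t, fun i => (hs i).th (ht i)⟩, ⟨.vee s' t', fun i => (hs' i).th (ht' i)⟩⟩
  | wedge _ _ ih ih' =>
    obtain ⟨⟨s, hs⟩, ⟨s', hs'⟩⟩ := ih
    obtain ⟨⟨t, ht⟩, ⟨t', ht'⟩⟩ := ih'
    exact ⟨⟨.wedge s t, fun i => (hs i).th (ht i)⟩, ⟨.wedge s' t', fun i => (hs' i).th (ht' i)⟩⟩
  | veeAssoc X Y Z =>
    exact ⟨⟨.veeBInv X Y Z, fun i => (hv i).as_isEqHom _ _ _⟩,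
      ⟨.veeB X Y Z, fun i => ((hv i).as_isEqHom _ _ _).inv⟩⟩
  | veeLeft X =>
    exact ⟨⟨.veeSigma X, fun i => (hv i).lu_isEqHom _⟩,
      ⟨.veeSigmaInv X, fun i => ((hv i).lu_isEqHom _).inv⟩⟩
  | veeRight X =>
    exact ⟨⟨.veeDelta X, fun i => (hv i).ru_isEqHom _⟩,
      ⟨.veeDeltaInv X, fun i => ((hv i).ru_isEqHom _).inv⟩⟩
  | wedgeAssoc X Y Z =>
    exact ⟨⟨.wedgeBInv X Y Z, fun i => (hw i).as_isEqHom _ _ _⟩,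
      ⟨.wedgeB X Y Z, fun i => ((hw i).as_isEqHom _ _ _).inv⟩⟩
  | wedgeLeft X =>
    exact ⟨⟨.wedgeSigma X, fun i => (hw i).lu_isEqHom _⟩,
      ⟨.wedgeSigmaInv X, fun i => ((hw i).lu_isEqHom _).inv⟩⟩
  | wedgeRight X =>
    exact ⟨⟨.wedgeDelta X, fun i => (hw i).ru_isEqHom _⟩,
      ⟨.wedgeDeltaInv X, fun i => ((hw i).ru_isEqHom _).inv⟩⟩

end Coherence

/-! ### Canonical families of arrows -/

section Canonical

variable {P : Type}

/-- The families of arrows that are the interpretations of an arrow term. -/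
def canonical (P : Type) : ArrowClass fun i : Interp.{v, u} P => i.carrier where
  obj X := ∃ a : Formula P, ∀ i, X i = a.eval i.val
  hom {X Y} f := ∃ (a b : Formula P) (t : ArrowTerm a b) (hX : ∀ i, X i = a.eval i.val)
    (hY : ∀ i, b.eval i.val = Y i), ∀ i, f i = eqToHom (hX i) ≫ t.eval i.val ≫ eqToHom (hY i)
  id_mem := by
    rintro X ⟨a, h⟩
    obtain rfl := funext h
    exact ⟨a, a, .id a, fun _ => rfl, fun _ => rfl, fun _ => by simp [ArrowTerm.eval]⟩
  comp_mem := by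
    rintro X Y Z f g ⟨a, b, s, hX, hY, hs⟩ ⟨b', c, t, hY', hZ, ht⟩
    obtain rfl := funext hX
    obtain rfl := funext hZ
    obtain rfl := funext hs
    obtain rfl := funext ht
    -- The target of `s` and the source of `t` have equal values without being the same formula. A
    -- term `e` whose values are identities is inserted between them.
    obtain ⟨⟨e, he⟩, -⟩ := (Formula.rel_of_eval fun i => (hY i).trans (hY' i)).exists_term
    refine ⟨a, c, .comp s (.comp e t), fun _ => rfl, fun _ => rfl, fun i => ?_⟩
    obtain ⟨h, h'⟩ := he i
    simp [ArrowTerm.eval, h']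

theorem canonical_hom {a b : Formula P} (t : ArrowTerm a b) :
    (canonical.{v, u} P).hom fun i => t.eval i.val :=
  ⟨a, b, t, fun _ => rfl, fun _ => rfl, fun _ => by simp⟩

theorem exists_term_of_canonical {X Y : ∀ i : Interp.{v, u} P, i.carrier} {f : ∀ i, X i ⟶ Y i}
    (h : (canonical P).hom f) : ∃ a : CanonicalArrow P, ∀ i, ∃ (hs : X i = a.source.eval i.val)
      (ht : a.target.eval i.val = Y i), f i = eqToHom hs ≫ a.term.eval i.val ≫ eqToHom ht := by
  obtain ⟨a, b, t, hX, hY, h⟩ := h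
  exact ⟨⟨a, b, t⟩, fun i => ⟨hX i, hY i, h i⟩⟩

theorem vee_mem : MonMem (canonical.{v, u} P)
    fun i => BiSymmetric.veeMon (C := i.carrier) where
  un := ⟨.bot, fun _ => rfl⟩
  ten := by
    rintro A B ⟨a, hA⟩ ⟨b, hB⟩
    obtain rfl := funext hA
    obtain rfl := funext hB
    exact ⟨.vee a b, fun _ => rfl⟩
  th := by
    rintro A A' B B' f g ⟨a, a', s, hA, hA', hf⟩ ⟨b, b', t, hB, hB', hg⟩
    obtain rfl := funext hA
    obtain rfl := funext hB
    obtain rfl := funext hA'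
    obtain rfl := funext hB'
    obtain rfl := funext hf
    obtain rfl := funext hg
    simp only [eqToHom_refl, Category.id_comp, Category.comp_id]
    exact canonical_hom (.vee s t)
  as := by
    rintro A B X ⟨a, hA⟩ ⟨b, hB⟩ ⟨x, hX⟩
    obtain rfl := funext hA
    obtain rfl := funext hB
    obtain rfl := funext hX
    exact canonical_hom (.veeBInv a b x)
  lu := by
    rintro A ⟨a, hA⟩
    obtain rfl := funext hA
    exact canonical_hom (.veeSigma a)

theorem wedge_mem : MonMem (canonical.{v, u} P)
    fun i => BiSymmetric.wedgeMon (C := i.carrier) where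
  un := ⟨.top, fun _ => rfl⟩
  ten := by
    rintro A B ⟨a, hA⟩ ⟨b, hB⟩
    obtain rfl := funext hA
    obtain rfl := funext hB
    exact ⟨.wedge a b, fun _ => rfl⟩
  th := by
    rintro A A' B B' f g ⟨a, a', s, hA, hA', hf⟩ ⟨b, b', t, hB, hB', hg⟩
    obtain rfl := funext hA
    obtain rfl := funext hB
    obtain rfl := funext hA'
    obtain rfl := funext hB'
    obtain rfl := funext hf
    obtain rfl := funext hg
    simp only [eqToHom_refl, Category.id_comp, Category.comp_id]
    exact canonical_hom (.wedge s t)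
  as := by
    rintro A B X ⟨a, hA⟩ ⟨b, hB⟩ ⟨x, hX⟩
    obtain rfl := funext hA
    obtain rfl := funext hB
    obtain rfl := funext hX
    exact canonical_hom (.wedgeBInv a b x)
  lu := by
    rintro A ⟨a, hA⟩
    obtain rfl := funext hA
    exact canonical_hom (.wedgeSigma a)

theorem smiMon_mem (b : Bool) :
    MonMem (canonical.{v, u} P) fun i => smiMon i.carrier b := by
  cases b
  · exact vee_mem
  · exact wedge_mem

attribute [local instance] BiSymmetric.veeSymm BiSymmetric.wedgeSymm

theorem symInter_vee_mem : InterMem (canonical.{v, u} P)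
    fun i => symInter (BiSymmetric.veeMon (C := i.carrier)) where
  x := by
    rintro A B A' B' ⟨a, hA⟩ ⟨b, hB⟩ ⟨a', hA'⟩ ⟨b', hB'⟩
    obtain rfl := funext hA
    obtain rfl := funext hB
    obtain rfl := funext hA'
    obtain rfl := funext hB'
    -- `tensorμ` involves whiskerings, which are not constructors of arrow terms; the form
    -- `symInter_x` can be transcribed directly.
    simp only [symInter_x]
    exact canonical_hom (.comp (.veeBInv a b (a'.vee b')) (.comp (.vee (.id a)
      (.comp (.veeB b a' b') (.comp (.vee (.veeC b a') (.id b')) (.veeBInv a' b b'))))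
      (.veeB a a' (b.vee b'))))
  i2 := canonical_hom (.veeSigma .bot)
  i1 := canonical_hom (.veeSigmaInv .bot)
  i0 := canonical_hom (.id .bot)

theorem symInter_wedge_mem : InterMem (canonical.{v, u} P)
    fun i => symInter (BiSymmetric.wedgeMon (C := i.carrier)) where
  x := by
    rintro A B A' B' ⟨a, hA⟩ ⟨b, hB⟩ ⟨a', hA'⟩ ⟨b', hB'⟩
    obtain rfl := funext hA
    obtain rfl := funext hB
    obtain rfl := funext hA'
    obtain rfl := funext hB'
    simp only [symInter_x]
    exact canonical_hom (.comp (.wedgeBInv a b (a'.wedge b')) (.comp (.wedge (.id a)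
      (.comp (.wedgeB b a' b') (.comp (.wedge (.wedgeC b a') (.id b')) (.wedgeBInv a' b b'))))
      (.wedgeB a a' (b.wedge b'))))
  i2 := canonical_hom (.wedgeSigma .top)
  i1 := canonical_hom (.wedgeSigmaInv .top)
  i0 := canonical_hom (.id .top)

theorem smiInter_mem : InterMem (canonical.{v, u} P) fun i => smiInter (C := i.carrier) where
  x := by
    rintro A B A' B' ⟨a, hA⟩ ⟨b, hB⟩ ⟨a', hA'⟩ ⟨b', hB'⟩
    obtain rfl := funext hA
    obtain rfl := funext hB
    obtain rfl := funext hA'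
    obtain rfl := funext hB'
    exact canonical_hom (.ck a b a' b')
  i2 := canonical_hom .wTop
  i1 := canonical_hom .wBot
  i0 := canonical_hom .kappa

theorem smiInterLe_mem {b b' : Bool} (h : b ≤ b') :
    InterMem (canonical.{v, u} P) fun i => smiInterLe i.carrier h :=
  match b, b', h with
  | false, false, _ => symInter_vee_mem
  | false, true, _ => smiInter_mem
  | true, true, _ => symInter_wedge_mem
  | true, false, h => absurd h (by decide)

theorem curryPower_mem {N : ℕ} (k : Fin (N + 1) → SimplexCategoryᵒᵖ) :
    FunMem ((canonical.{v, u} P).pi (MultiIndex k))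
      (((canonical P).pi (MultiIndex (tailObj k))).pi (Fin (k 0).unop.len))
      fun i => curryPower i.carrier k :=
  ⟨fun hA a β => hA (Fin.cons (α := fun i => Fin (k i).unop.len) a β),
    fun hf a β => hf (Fin.cons (α := fun i => Fin (k i).unop.len) a β)⟩

theorem uncurryPower_mem {N : ℕ} (k : Fin (N + 1) → SimplexCategoryᵒᵖ) :
    FunMem (((canonical.{v, u} P).pi (MultiIndex (tailObj k))).pi (Fin (k 0).unop.len))
      ((canonical P).pi (MultiIndex k)) fun i => uncurryPower i.carrier k :=
  ⟨fun hA α => hA (α 0) fun i => α i.succ, fun hf α => hf (α 0) fun i => α i.succ⟩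

theorem smiBar_mem : ∀ {N : ℕ} (κ : Fin N → Bool) {k l : Fin N → SimplexCategoryᵒᵖ} (f : k ⟶ l),
    FunMem ((canonical.{v, u} P).pi (MultiIndex k)) ((canonical P).pi (MultiIndex l))
      fun i => smiBar i.carrier κ f
  | 0, _, _, _, _ => ⟨fun hA _ => hA fun i => i.elim0, fun hf _ => hf fun i => i.elim0⟩
  | _ + 1, κ, k, l, f => (curryPower_mem k).comp
      (((barL_mem ((smiMon_mem (κ 0)).pi _) (fibre (f 0))).comp
        ((smiBar_mem (fun i => κ i.succ) (tailHom f)).pi (Fin (l 0).unop.len))).comp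
          (uncurryPower_mem l))

theorem iterLax_mem (b : Bool) : ∀ {N : ℕ} (κ : Fin N → Bool) (h : ∀ i, b ≤ κ i)
    {k l : Fin N → SimplexCategoryᵒᵖ} (f : k ⟶ l),
    LaxMem ((canonical.{v, u} P).pi (MultiIndex k)) ((canonical P).pi (MultiIndex l))
      fun i => iterLax (C := i.carrier) b κ h f
  | 0, _, _, _, _, _ => ⟨fun _ => (canonical P).id_mem (smiMon_mem b).un,
      fun hA hB _ => (canonical P).id_mem ((smiMon_mem b).ten (hA _) (hB _))⟩
  | _ + 1, κ, h, k, l, f =>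
    have H := stepLax_mem ((smiMon_mem b).pi _) ((smiMon_mem (κ 0)).pi _)
      ((smiInterLe_mem (h 0)).pi _) (smiBar_mem (fun i => κ i.succ) (tailHom f))
      (iterLax_mem b (fun i => κ i.succ) (fun i => h i.succ) (tailHom f)) (fibre (f 0))
    ⟨(uncurryPower_mem l).map H.ε, fun hA hB =>
      (uncurryPower_mem l).map (H.μ ((curryPower_mem k).obj hA) ((curryPower_mem k).obj hB))⟩

theorem iterΩ_mem : ∀ {N : ℕ} {κ : Fin N → Bool} (hκ : Monotone κ)
    {k l j : Fin N → SimplexCategoryᵒᵖ} {f : k ⟶ l} {g : l ⟶ j} {m : k ⟶ j} (h : f ≫ g = m)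
    {A : ∀ i : Interp.{v, u} P, MultiIndex k → i.carrier},
    ((canonical P).pi (MultiIndex k)).obj A →
      ((canonical P).pi (MultiIndex j)).hom fun i => iterΩ hκ h (A i)
  | 0, _, _, _, _, _, _, _, _, _, _, hA => fun _ => (canonical P).id_mem (hA _)
  | _ + 1, κ, hκ, k, _, j, f, g, m, h, A, hA => (uncurryPower_mem j).map
      (stepΩ_mem ((smiMon_mem (κ 0)).pi _) ((smiMon_mem (κ 0)).pi _)
        (smiBar_mem (fun i => κ i.succ) (tailHom f)) (smiBar_mem (fun i => κ i.succ) (tailHom g))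
        (smiBar_mem (fun i => κ i.succ) (tailHom m))
        (iterLax_mem (κ 0) (fun i => κ i.succ) _ (tailHom f))
        (fun hB => iterΩ_mem _ (funext fun i => congrFun h i.succ) hB)
        (fibre_of_comp (congrFun h 0)) ((curryPower_mem k).obj hA))

/-- The coordinates of `iterΩ` are given by arrow terms. -/
theorem exists_term_iterΩ {N : ℕ} {κ : Fin N → Bool} (hκ : Monotone κ)
    {k l j : Fin N → SimplexCategoryᵒᵖ} (f : k ⟶ l) (g : l ⟶ j) (α : MultiIndex j) :
    ∃ a : CanonicalArrow (MultiIndex k), ∀ (C : Type u) [Category.{v} C] [StrictSMICategory C]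
      (A : MultiIndex k → C), ∃ (hs : (smiBar C κ g).obj ((smiBar C κ f).obj A) α =
        a.source.eval A) (ht : a.target.eval A = (smiBar C κ (f ≫ g)).obj A α),
        iterΩ hκ rfl A α = eqToHom hs ≫ a.term.eval A ≫ eqToHom ht := by
  obtain ⟨a, ha⟩ := exists_term_of_canonical
    (iterΩ_mem.{v, u} hκ (rfl : f ≫ g = f ≫ g) (A := fun i => i.val)
      (fun β => ⟨.letter β, fun _ => rfl⟩) α)
  exact ⟨a, fun C _ _ A => ha ⟨C, A⟩⟩

end Canonical

/-! ### The two-level case and the theorem. -/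

section Main

theorem tensors_eq (C : Type u) [Category.{v} C] [StrictSMICategory C] (n m : ℕ) :
    tensors C n m = fun i : Fin (n + m) => smiMon C (decide (n ≤ (i : ℕ))) := by
  funext i
  by_cases h : (i : ℕ) < n
  · rw [decide_eq_false (not_le.mpr h)]
    exact if_pos h
  · rw [decide_eq_true (not_lt.mp h)]
    exact if_neg h

/-- Taking all `∨` coordinates before the `∧` coordinates makes each structure lie below the later
ones, as the lax monoidal structures require. -/
theorem monotone_decide_le (n m : ℕ) :
    Monotone fun i : Fin (n + m) => decide (n ≤ (i : ℕ)) := fun i j hij h =>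
  decide_eq_true ((of_decide_eq_true h).trans (Fin.le_def.mp hij))

/-- An iterated reduced bar construction along the first monoidal structure, then the second one,
underlies a lax functor. -/
theorem exists_laxFunctor {N : ℕ} {κ : Fin N → Bool} (hκ : Monotone κ) (C : Type u)
    [Category.{v} C] [StrictSMICategory C] {T : Fin N → MonoidalCategory C}
    (hT : T = fun i => smiMon C (κ i))
    {τ : ∀ {k l j : Fin N → SimplexCategoryᵒᵖ}, (k ⟶ l) → (l ⟶ j) → MultiIndex j →
      CanonicalArrow (MultiIndex k)}
    (hτ : ∀ {k l j : Fin N → SimplexCategoryᵒᵖ} (f : k ⟶ l) (g : l ⟶ j) (A : MultiIndex k → C)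
      (α : MultiIndex j), ∃ (hs : (smiBar C κ g).obj ((smiBar C κ f).obj A) α =
        (τ f g α).source.eval A)
        (ht : (τ f g α).target.eval A = (smiBar C κ (f ≫ g)).obj A α),
        iterΩ hκ rfl A α = eqToHom hs ≫ (τ f g α).term.eval A ≫ eqToHom ht) :
    ∃ (W : LaxFunctor (LocallyDiscrete (Fin N → SimplexCategoryᵒᵖ)) Cat.{v, u})
      (hW : W.toPrelaxFunctor = barPrelax C T),
      (∀ k : LocallyDiscrete (Fin N → SimplexCategoryᵒᵖ),
        ∃ h : 𝟙 ((barPrelax C T).obj k) = (barPrelax C T).map (𝟙 k), laxId W hW k = eqToHom h) ∧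
      (∀ {k l j : Fin N → SimplexCategoryᵒᵖ} (f : k ⟶ l) (g : l ⟶ j) (A : MultiIndex k → C)
        (α : MultiIndex j),
        ∃ (hs : (iteratedBar C T g).obj ((iteratedBar C T f).obj A) α = (τ f g α).source.eval A)
          (ht : (τ f g α).target.eval A = (iteratedBar C T (f ≫ g)).obj A α),
          (laxComp W hW f.toLoc g.toLoc).toNatTrans.app A α =
            eqToHom hs ≫ (τ f g α).term.eval A ≫ eqToHom ht) ∧
      (N ≤ 1 → ∀ {k l j : LocallyDiscrete (Fin N → SimplexCategoryᵒᵖ)} (f : k ⟶ l) (g : l ⟶ j),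
        ∃ h : (barPrelax C T).map f ≫ (barPrelax C T).map g = (barPrelax C T).map (f ≫ g),
          laxComp W hW f g = eqToHom h) := by
  -- `T` is a variable because `tensors` agrees with `smiMon` only propositionally; substituting the
  -- equation avoids transporting the lax functor along it.
  subst hT
  exact ⟨barLaxFunctor C hκ, rfl, fun k => ⟨Cat.ext (smiBar_id κ k.as).symm, rfl⟩, fun f g A α => hτ f g A α,
    fun hN _ _ _ f g => exists_mapComp_eq_eqToHom hN hκ f g⟩

end Main

end SMI

theorem mainTheorem4 (n m : ℕ) :
    -- canonical arrow terms, chosen once for all strict SMI categories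
    ∃ τ : ∀ {k l j : Fin (n + m) → SimplexCategoryᵒᵖ}, (k ⟶ l) → (l ⟶ j) →
        SMI.MultiIndex j → SMI.CanonicalArrow (SMI.MultiIndex k),
      ∀ (C : Type u) [Category.{v} C] [SMI.StrictSMICategory C],
        -- the construction underlies a lax functor `W`
        ∃ (W : LaxFunctor (LocallyDiscrete (Fin (n + m) → SimplexCategoryᵒᵖ)) Cat.{v, u})
          (hW : W.toPrelaxFunctor = SMI.reducedBar C n m),
          -- identities are preserved strictly
          (∀ k : LocallyDiscrete (Fin (n + m) → SimplexCategoryᵒᵖ),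
            ∃ h : 𝟙 ((SMI.reducedBar C n m).obj k) = (SMI.reducedBar C n m).map (𝟙 k),
              SMI.laxId W hW k = eqToHom h) ∧
          -- each coordinate of the comparison `g^* ∘ f^* ⟶ (g ∘ f)^*` interprets its arrow term
          (∀ {k l j : Fin (n + m) → SimplexCategoryᵒᵖ} (f : k ⟶ l) (g : l ⟶ j)
            (A : SMI.MultiIndex k → C) (α : SMI.MultiIndex j),
            ∃ (hs : (SMI.pull C n m g).obj ((SMI.pull C n m f).obj A) α =
                (τ f g α).source.eval A)
              (ht : (τ f g α).target.eval A = (SMI.pull C n m (f ≫ g)).obj A α),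
              (SMI.laxComp W hW f.toLoc g.toLoc).toNatTrans.app A α =
                eqToHom hs ≫ (τ f g α).term.eval A ≫ eqToHom ht) ∧
          -- for `n + m ≤ 1` it is an ordinary functor
          (n + m ≤ 1 → ∀ {k l j : LocallyDiscrete (Fin (n + m) → SimplexCategoryᵒᵖ)}
            (f : k ⟶ l) (g : l ⟶ j),
            ∃ h : (SMI.reducedBar C n m).map f ≫ (SMI.reducedBar C n m).map g =
                (SMI.reducedBar C n m).map (f ≫ g),
              SMI.laxComp W hW f g = eqToHom h) := by
  have hκ := SMI.monotone_decide_le n m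
  -- In `exists_term_iterΩ` the term precedes the quantifier over `C`, so `τ` is chosen
  -- independently of the category.
  choose τ hτ using fun (k l j : Fin (n + m) → SimplexCategoryᵒᵖ) (f : k ⟶ l) (g : l ⟶ j)
    (α : SMI.MultiIndex j) => SMI.exists_term_iterΩ.{v, u} hκ f g α
  exact ⟨fun {k l j} f g α => τ k l j f g α, fun C _ _ =>
    SMI.exists_laxFunctor hκ C (SMI.tensors_eq C n m) fun f g A α => hτ _ _ _ f g α C A⟩
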